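/- Consider the linear regression model $Y_i=\sum_{j=1}^p\theta_jX_{ij}+\xi_i$, $i=1,\dots,n$, where the $\xi_i$ are i.i.d. $\mathcal N(0,1)$ and independent of the random design $X=(X_{ij})_{1\le i\le n,1\le j\le p}$, the rows $(X_{i1},\dots,X_{ip})$ of $X$ are independent, and all entries $X_{ij}$ have the same law, with $E X_{ij}=0$ and $E X_{ij}^2=1$. Let $P_\theta$ be the law of $Z=(X,Y)$ and $E_\theta$ the corresponding expectation. For real $k,r>0$ let $\Theta_k(r)$ be the set of $\theta\in\mathbb R^p$ with at most $k$ nonzero coordinates and Euclidean norm $\|\theta\|\ge r$. The minimax total error of testing $\theta=0$ against $\theta\in\Theta_k(r)$ is $$\gamma_{n,p,k}(r)=\inf_\psi\Big(E_0\psi+\sup_{\theta\in\Theta_k(r)}E_\theta(1-\psi)\Big),$$ where the infimum is over all measurable functions $\psi$ of $Z$ with values in $[0,1]$. All limits below are taken along a sequence of pairs $(n,p)$ with $n\to\infty$ and $p\to\infty$; the law of $X$ may depend on $(n,p)$. Fix $\beta\in(0,1)$ and let $k=p^{1-\beta}$. Assume: - (A1) $E X_{ij}X_{il}=0$ for all $i$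 and all $j<l$; - (B1) $\max_{i}\max_{1\le j<l\le p}E\big((X_{ij}X_{il})^4\big)=O(1)$; - at least one of the following two conditions: - (B2) there is $h_0>0$ such that $\max_i\max_{1\le j\le l\le p}E\exp(hX_{ij}X_{il})=O(1)$ for every real $h$ with $|h|<h_0$, and $\log^3 p=o(n)$; - (B3) there is an integer $m\ge1$ such that $\max_i\max_{1\le j\le l\le p}E|X_{ij}X_{il}|^m=O(1)$ and $p^{4/m}\log^2 p=o(n)$; if $m=1$, the common law of the $X_{ij}$ is moreover the same for all $(n,p)$. Let $$\varphi(\beta)=\begin{cases}\sqrt{2\beta-1},&1/2<\beta\le3/4,\\ \sqrt2\,(1-\sqrt{1-\beta}),&3/4<\beta<1,\end{cases}$$ and let $r=r_{np}>0$ satisfy $r_{np}^2=o(n^{-1/2})$ and, in addition, - if $\beta\le1/2$: $r_{np}^2=o(\sqrt p/n)$; - if $\beta>1/2$: $\limsup\,(x_{np}-\varphi(\beta))<0$, where $x_{np}$ is defined by $r_{np}=x_{np}\sqrt{k\log(p)/n}$. Then $\gamma_{n,p,k}(r_{np})\to1$. -/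

import Mathlib

open MeasureTheory ProbabilityTheory Filter Topology Asymptotics

namespace SparseRegression

noncomputable section

/-- Number `M(θ)` of nonzero coordinates of `θ`. -/
def numNonzero {p : ℕ} (θ : EuclideanSpace ℝ (Fin p)) : ℕ :=
  Nat.card {j : Fin p // θ j ≠ 0}

/-- The alternative `Θ_k(r)`: at most `k` nonzero coordinates and Euclidean norm at least `r`.
The sparsity `k` is a real number, so that `k = p ^ (1 - β)` can be used as it stands. -/
def sparseAlt (p : ℕ) (k r : ℝ) : Set (EuclideanSpace ℝ (Fin p)) :=
  {θ | (numNonzero θ : ℝ) ≤ k ∧ r ≤ ‖θ‖}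

/-- Design matrices: `X i j` is the entry in row `i` (observation) and column `j` (regressor). -/
abbrev Design (n p : ℕ) : Type := Fin n → Fin p → ℝ

/-- The observation `Z = (X, Y)`. -/
abbrev Obs (n p : ℕ) : Type := Design n p × (Fin n → ℝ)

/-- The law `P_θ` of `Z = (X, Y)`, where `Y i = ∑ j, θ j * X i j + ξ i`, the matrix `X` has law
`PX`, and the `ξ i` are i.i.d. standard Gaussian and independent of `X`. -/
def obsLaw {n p : ℕ} (PX : Measure (Design n p)) (θ : EuclideanSpace ℝ (Fin p)) :
    Measure (Obs n p) :=
  (PX.prod (Measure.pi fun _ : Fin n => gaussianReal 0 1)).map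
    fun w => (w.1, fun i => ∑ j, θ j * w.1 i j + w.2 i)

/-- A test: a measurable function of the observation with values in `[0, 1]`. -/
structure Test (n p : ℕ) where
  toFun : Obs n p → ℝ
  measurable_toFun : Measurable toFun
  mem_Icc : ∀ z, toFun z ∈ Set.Icc (0 : ℝ) 1

/-- Type I error `α(ψ) = E_0 ψ`. -/
def typeI {n p : ℕ} (PX : Measure (Design n p)) (ψ : Test n p) : ℝ :=
  ∫ z, ψ.toFun z ∂(obsLaw PX 0)

/-- Type II error `β(ψ, θ) = E_θ (1 - ψ)`. -/
def typeII {n p : ℕ} (PX : Measure (Design n p)) (ψ : Test n p)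
    (θ : EuclideanSpace ℝ (Fin p)) : ℝ :=
  ∫ z, (1 - ψ.toFun z) ∂(obsLaw PX θ)

/-- Total error `γ(ψ, Θ) = α(ψ) + sup_{θ ∈ Θ} β(ψ, θ)`. -/
def totalError {n p : ℕ} (PX : Measure (Design n p)) (ψ : Test n p)
    (Θ : Set (EuclideanSpace ℝ (Fin p))) : ℝ :=
  typeI PX ψ + ⨆ θ : Θ, typeII PX ψ θ

/-- Minimax total error `γ_{n,p,k}(r)`: the infimum of the total error over all tests. -/
def minimaxError {n p : ℕ} (PX : Measure (Design n p)) (k r : ℝ) : ℝ :=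
  ⨅ ψ : Test n p, totalError PX ψ (sparseAlt p k r)

/-- Standing assumptions on the law of the design: the rows are independent, and the entries are
identically distributed with mean `0` and second moment `1`. -/
structure IsStandardDesign {n p : ℕ} (PX : Measure (Design n p)) : Prop where
  indep_rows : iIndepFun (fun (i : Fin n) (X : Design n p) => X i) PX
  identDistrib : ∀ (i i' : Fin n) (j j' : Fin p),
    IdentDistrib (fun X : Design n p => X i j) (fun X : Design n p => X i' j') PX PX
  mean_zero : ∀ (i : Fin n) (j : Fin p), ∫ X, X i j ∂PX = 0
  second_moment_one : ∀ (i : Fin n) (j : Fin p), ∫ X, X i j ^ 2 ∂PX = 1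

/-- The entries within a row are uncorrelated. -/
def UncorrelatedDesign {n p : ℕ} (PX : Measure (Design n p)) : Prop :=
  ∀ (i : Fin n) (j l : Fin p), j < l → ∫ X, X i j * X i l ∂PX = 0

/-- `max_{j < l} E (U_j U_l)^4 = O(1)` along the sequence. Here and below `(U_j, U_l)` is
distributed as `(X i j, X i l)`, and the bound is required for every row `i`. -/
def FourthMomentBound {n p : ℕ → ℕ} (PX : ∀ t, Measure (Design (n t) (p t))) : Prop :=
  ∃ C : ℝ, ∀ᶠ t in atTop, ∀ (i : Fin (n t)) (j l : Fin (p t)), j < l →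
    Integrable (fun X => (X i j * X i l) ^ 4) (PX t) ∧
      ∫ X, (X i j * X i l) ^ 4 ∂(PX t) ≤ C

/-- For some `h₀ > 0` and every `|h| < h₀`, the exponential moments `E exp (h U_j U_l)`, `j ≤ l`,
are bounded along the sequence, and `log³ p = o(n)`. -/
def ExpMomentCondition {n p : ℕ → ℕ} (PX : ∀ t, Measure (Design (n t) (p t))) : Prop :=
  (∃ h₀ : ℝ, 0 < h₀ ∧ ∀ h : ℝ, |h| < h₀ → ∃ C : ℝ, ∀ᶠ t in atTop,
    ∀ (i : Fin (n t)) (j l : Fin (p t)), j ≤ l →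
      Integrable (fun X => Real.exp (h * (X i j * X i l))) (PX t) ∧
        ∫ X, Real.exp (h * (X i j * X i l)) ∂(PX t) ≤ C) ∧
  (fun t => Real.log (p t) ^ 3) =o[atTop] fun t => (n t : ℝ)

/-- The common law of the entries does not vary along the sequence. -/
def FixedEntryLaw {n p : ℕ → ℕ} (PX : ∀ t, Measure (Design (n t) (p t))) : Prop :=
  ∃ ν : Measure ℝ, ∀ᶠ t in atTop, ∀ (i : Fin (n t)) (j : Fin (p t)),
    (PX t).map (fun X => X i j) = ν

/-- For some integer `m ≥ 1`, the moments `E |U_j U_l|^m`, `j ≤ l`, are bounded along the sequence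
and `log² p · p^(4/m) = o(n)`. If `m = 1`, where the moment bound is implied by `E X_{ij}² = 1`,
the common law of the entries has to be the same along the whole sequence. -/
def PolyMomentCondition {n p : ℕ → ℕ} (PX : ∀ t, Measure (Design (n t) (p t))) : Prop :=
  ∃ m : ℕ, 1 ≤ m ∧ (m = 1 → FixedEntryLaw PX) ∧
    (∃ C : ℝ, ∀ᶠ t in atTop, ∀ (i : Fin (n t)) (j l : Fin (p t)), j ≤ l →
      Integrable (fun X => |X i j * X i l| ^ m) (PX t) ∧
        ∫ X, |X i j * X i l| ^ m ∂(PX t) ≤ C) ∧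
    (fun t => Real.log (p t) ^ 2 * (p t : ℝ) ^ ((4 : ℝ) / (m : ℝ))) =o[atTop]
      fun t => (n t : ℝ)

/-- The constant `φ(β)` of the sharp detection boundary, for `1/2 < β < 1`. -/
def phi (β : ℝ) : ℝ :=
  if β ≤ 3 / 4 then √(2 * β - 1) else √2 * (1 - √(1 - β))

end

end SparseRegression

/-! Bayesian lower bound. Each coordinate of the parameter is drawn independently: zero with
probability `1 - h`, and `±b` with probability `h / 2` each, where `h = (1 - δ) k / p` and `b = r /
√((1 - 2δ) k)`. By Chebyshev this prior charges the alternative up to mass `1 / (δ² k)`. If `L` is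
the likelihood ratio of the mixture given `X`, every test satisfies `ψ + (1 - ψ) L ≥ min 1 L`, so
the minimax error is at least `E min(1, L)` minus the lost mass (`le_minimaxError`). It remains to
show that `E min(1, L)` tends to one.

A second-moment computation for `L` is avoided: the columns of `X` are only nearly orthogonal, so
`L` is not a product. Instead `L` is bounded below pointwise by a mean-field variational argument
(`le_mixRatio`). For fixed `y`, the signs receive product weights imitating the coordinatewise
posterior, cut off where `|w j ⬝ᵥ y|` exceeds a threshold `T`. The inequality `1 + x ≤ exp x` makes
the exponent linear, so only one- and two-coordinate marginals are needed. The outcome is `1 + ∑ U_j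
- 2 ∑ U_j² - |∑ h S_j w_j|² / 2`, where `U_j` is `h` times the centred truncated even ratio and
`S_j` is the truncated odd ratio.

The Gaussian means of these terms are explicit (`le_integral_min_one_mixRatio`). Off the diagonal
they are controlled by the squared inner products of the columns and by pairs of tail means.
Conditioning on `u ⬝ᵥ y` shows that cutting off the ratio in direction `u` changes covariances only
to second order in `u ⬝ᵥ w`, or with a favourable sign.

With `b² n = x² log p` and `T = √2 x log p`, which cuts the standardized score at `√(2 log p)`,
three quantities must vanish. The Gram part is of order `r⁴ n`, by the fourth-moment condition and
Markov. The tail part is governed by `k p^(-(√2 - x)² / 2)`. The diagonal part is `k² / p` times the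
truncated second moment of one coordinate. In the sparse case the last two requirements are the two
pieces of the detection boundary (`exists_exponent_gap`); in the dense case `x → 0` and the diagonal
part is of order `(r² n / √p)²` up to a tail term.

All this needs the Gram matrix to be within `n / (2 log p)` of `n` times the identity in every
entry, with probability tending to one. This follows from a union bound, using Chernoff under
exponential moments or Markov for the `m`-th moment of a sum of independent centred variables. -/

namespace SparseRegression

/-! ### Gaussian shifts and likelihood ratios. -/

/-- The law of `n` independent standard Gaussian variables. -/
noncomputable def stdNormal (n : ℕ) : Measure (Fin n → ℝ) :=
  Measure.pi fun _ : Fin n => gaussianReal 0 1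

instance (n : ℕ) : IsProbabilityMeasure (stdNormal n) := by
  unfold stdNormal; infer_instance

/-- The Cameron–Martin density of the shift by `a`. -/
noncomputable def expTilt {n : ℕ} (a y : Fin n → ℝ) : ℝ :=
  Real.exp (a ⬝ᵥ y - a ⬝ᵥ a / 2)

theorem expTilt_pos {n : ℕ} (a y : Fin n → ℝ) : 0 < expTilt a y := Real.exp_pos _

theorem measurable_dotProduct_left {n : ℕ} (a : Fin n → ℝ) :
    Measurable fun y : Fin n → ℝ => a ⬝ᵥ y := by
  unfold dotProduct; fun_prop

theorem measurable_expTilt {n : ℕ} (a : Fin n → ℝ) : Measurable (expTilt a) := by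
  unfold expTilt
  have := measurable_dotProduct_left a
  fun_prop

theorem gaussianReal_eq_withDensity (a : ℝ) :
    gaussianReal a 1 =
      (gaussianReal 0 1).withDensity fun x => ENNReal.ofReal (Real.exp (a * x - a * a / 2)) := by
  rw [gaussianReal_of_var_ne_zero _ one_ne_zero, gaussianReal_of_var_ne_zero _ one_ne_zero,
    ← withDensity_mul _ (measurable_gaussianPDF 0 1) (by fun_prop)]
  congr 1
  ext x
  simp only [gaussianPDF, Pi.mul_apply, gaussianPDFReal]
  rw [← ENNReal.ofReal_mul (by positivity), mul_assoc _ (Real.exp _), ← Real.exp_add]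
  congr 3
  simp
  ring

theorem stdNormal_map_add {n : ℕ} (a : Fin n → ℝ) :
    (stdNormal n).map (fun y => y + a) =
      (stdNormal n).withDensity fun y => ENNReal.ofReal (expTilt a y) := by
  have h1 : (stdNormal n).map (fun y => y + a) = Measure.pi fun i => gaussianReal (a i) 1 := by
    have := Measure.pi_map_pi (μ := fun _ : Fin n => gaussianReal 0 1)
      (f := fun i x => x + a i) (fun i => by fun_prop)
    simp only [gaussianReal_map_add_const, zero_add] at this
    rw [← this]; rfl
  rw [h1]
  symm
  refine (Measure.pi_eq fun s hs => ?_).symm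
  rw [withDensity_apply _ (MeasurableSet.univ_pi hs), ← lintegral_indicator (MeasurableSet.univ_pi hs)]
  have h2 : (Set.univ.pi s).indicator (fun y => ENNReal.ofReal (expTilt a y)) = fun y =>
      ∏ i, (s i).indicator (fun x => ENNReal.ofReal (Real.exp (a i * x - a i * a i / 2))) (y i) := by
    ext y
    by_cases hy : y ∈ Set.univ.pi s
    · rw [Set.indicator_of_mem hy]
      have : ∀ i, y i ∈ s i := fun i => hy i (Set.mem_univ i)
      simp only [this, Set.indicator_of_mem]
      rw [← ENNReal.ofReal_prod_of_nonneg (fun i _ => (Real.exp_pos _).le), ← Real.exp_sum]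
      simp [expTilt, dotProduct, Finset.sum_sub_distrib, Finset.sum_div]
    · rw [Set.indicator_of_notMem hy]
      have : ∃ i, y i ∉ s i := by simpa using hy
      obtain ⟨i, hi⟩ := this
      exact (Finset.prod_eq_zero (Finset.mem_univ i) (Set.indicator_of_notMem hi _)).symm
  have h3 := lintegral_prod_eq_prod_lintegral_of_indepFun Finset.univ
    (fun i (y : Fin n → ℝ) =>
      (s i).indicator (fun x => ENNReal.ofReal (Real.exp (a i * x - a i * a i / 2))) (y i))
    (μ := stdNormal n)
    (iIndepFun_pi (μ := fun _ : Fin n => gaussianReal 0 1)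
      (X := fun i => (s i).indicator (fun x => ENNReal.ofReal (Real.exp (a i * x - a i * a i / 2))))
      fun i => (Measurable.indicator (by fun_prop) (hs i)).aemeasurable)
    (fun i => (Measurable.indicator (by fun_prop) (hs i)).comp (measurable_pi_apply i))
  rw [h2, h3]
  refine Finset.prod_congr rfl fun i _ => ?_
  rw [gaussianReal_eq_withDensity, withDensity_apply _ (hs i), ← lintegral_indicator (hs i)]
  exact (measurePreserving_eval (fun _ : Fin n => gaussianReal 0 1) i).lintegral_comp
    (Measurable.indicator (by fun_prop) (hs i))

theorem integral_mul_expTilt {n : ℕ} (a : Fin n → ℝ) (f : (Fin n → ℝ) → ℝ) :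
    ∫ y, f y * expTilt a y ∂(stdNormal n) = ∫ y, f (y + a) ∂(stdNormal n) := by
  have h1 := integral_map_equiv (μ := stdNormal n) (MeasurableEquiv.addRight a) f
  simp only [MeasurableEquiv.coe_addRight] at h1
  rw [← h1, stdNormal_map_add, integral_withDensity_eq_integral_toReal_smul
    (measurable_expTilt a).ennreal_ofReal (by simp)]
  refine integral_congr_ae (Eventually.of_forall fun y => ?_)
  simp [ENNReal.toReal_ofReal (expTilt_pos a y).le, mul_comm]

theorem integrable_mul_expTilt_iff {n : ℕ} (a : Fin n → ℝ) (f : (Fin n → ℝ) → ℝ) :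
    Integrable (fun y => f y * expTilt a y) (stdNormal n) ↔
      Integrable (fun y => f (y + a)) (stdNormal n) := by
  have h1 := integrable_map_equiv (μ := stdNormal n) (MeasurableEquiv.addRight a) f
  simp only [MeasurableEquiv.coe_addRight, Function.comp_def] at h1
  rw [← h1, stdNormal_map_add, integrable_withDensity_iff_integrable_smul'
    (measurable_expTilt a).ennreal_ofReal (by simp)]
  simp [ENNReal.toReal_ofReal (expTilt_pos a _).le, mul_comm]

theorem integrable_expTilt {n : ℕ} (a : Fin n → ℝ) : Integrable (expTilt a) (stdNormal n) := by
  simpa using (integrable_mul_expTilt_iff a fun _ => 1).2 (integrable_const _)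

theorem integral_expTilt {n : ℕ} (a : Fin n → ℝ) : ∫ y, expTilt a y ∂(stdNormal n) = 1 := by
  simpa using integral_mul_expTilt a fun _ => 1

theorem integrable_mul_of_memLp_two {Ω : Type*} [MeasurableSpace Ω] {μ : Measure Ω} {f g : Ω → ℝ}
    (hf : MemLp f 2 μ) (hg : MemLp g 2 μ) : Integrable (fun x => f x * g x) μ :=
  hf.integrable_mul hg

theorem _root_.MeasureTheory.Integrable.fun_sub {Ω : Type*} [MeasurableSpace Ω] {μ : Measure Ω}
    {f g : Ω → ℝ} (hf : Integrable f μ) (hg : Integrable g μ) : Integrable (fun x => f x - g x) μ :=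
  hf.sub hg

/-! ### Even and odd parts of the ratio: moments and projection. -/

/-- Even part of the Gaussian likelihood ratio in direction `w`. -/
noncomputable def coshRatio {n : ℕ} (w y : Fin n → ℝ) : ℝ :=
  Real.exp (-(w ⬝ᵥ w) / 2) * Real.cosh (w ⬝ᵥ y)

/-- Odd part of the Gaussian likelihood ratio in direction `w`. -/
noncomputable def sinhRatio {n : ℕ} (w y : Fin n → ℝ) : ℝ :=
  Real.exp (-(w ⬝ᵥ w) / 2) * Real.sinh (w ⬝ᵥ y)

theorem coshRatio_eq {n : ℕ} (w y : Fin n → ℝ) :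
    coshRatio w y = (expTilt w y + expTilt (-w) y) / 2 := by
  simp only [coshRatio, expTilt, Real.cosh_eq, neg_dotProduct, dotProduct_neg, neg_neg, sub_eq_add_neg,
    Real.exp_add, neg_div]
  ring

theorem sinhRatio_eq {n : ℕ} (w y : Fin n → ℝ) :
    sinhRatio w y = (expTilt w y - expTilt (-w) y) / 2 := by
  simp only [sinhRatio, expTilt, Real.sinh_eq, neg_dotProduct, dotProduct_neg, neg_neg, sub_eq_add_neg,
    Real.exp_add, neg_div]
  ring

theorem coshRatio_pos {n : ℕ} (w y : Fin n → ℝ) : 0 < coshRatio w y :=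
  mul_pos (Real.exp_pos _) (Real.cosh_pos _)

theorem abs_sinhRatio_le {n : ℕ} (w y : Fin n → ℝ) : |sinhRatio w y| ≤ coshRatio w y := by
  rw [sinhRatio, coshRatio, abs_mul, abs_of_pos (Real.exp_pos _)]
  refine mul_le_mul_of_nonneg_left ?_ (Real.exp_pos _).le
  rw [Real.abs_sinh]
  exact (Real.sinh_lt_cosh _).le.trans (Real.cosh_abs _).le

theorem measurable_coshRatio {n : ℕ} (w : Fin n → ℝ) : Measurable (coshRatio w) := by
  unfold coshRatio
  have := measurable_dotProduct_left w
  fun_prop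

theorem measurable_sinhRatio {n : ℕ} (w : Fin n → ℝ) : Measurable (sinhRatio w) := by
  unfold sinhRatio
  have := measurable_dotProduct_left w
  fun_prop

theorem expTilt_mul_expTilt {n : ℕ} (u w y : Fin n → ℝ) :
    expTilt u y * expTilt w y = Real.exp (u ⬝ᵥ w) * expTilt (u + w) y := by
  simp only [expTilt, ← Real.exp_add, add_dotProduct, dotProduct_add, dotProduct_comm w u]
  congr 1; ring

theorem integrable_expTilt_mul {n : ℕ} (u w : Fin n → ℝ) :
    Integrable (fun y => expTilt u y * expTilt w y) (stdNormal n) := by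
  simp only [expTilt_mul_expTilt]
  exact (integrable_expTilt _).const_mul _

theorem integral_expTilt_mul {n : ℕ} (u w : Fin n → ℝ) :
    ∫ y, expTilt u y * expTilt w y ∂(stdNormal n) = Real.exp (u ⬝ᵥ w) := by
  simp only [expTilt_mul_expTilt]
  rw [integral_const_mul, integral_expTilt, mul_one]

theorem memLp_expTilt {n : ℕ} (w : Fin n → ℝ) : MemLp (expTilt w) 2 (stdNormal n) := by
  rw [memLp_two_iff_integrable_sq (measurable_expTilt w).aestronglyMeasurable]
  simpa only [sq] using integrable_expTilt_mul w w

theorem memLp_coshRatio {n : ℕ} (w : Fin n → ℝ) : MemLp (coshRatio w) 2 (stdNormal n) := by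
  have := ((memLp_expTilt w).add (memLp_expTilt (-w))).const_mul (1 / 2)
  refine this.congr_norm (measurable_coshRatio w).aestronglyMeasurable (Eventually.of_forall fun y => ?_)
  simp [coshRatio_eq]; ring_nf

theorem memLp_sinhRatio {n : ℕ} (w : Fin n → ℝ) : MemLp (sinhRatio w) 2 (stdNormal n) := by
  refine (memLp_coshRatio w).mono (measurable_sinhRatio w).aestronglyMeasurable
    (Eventually.of_forall fun y => ?_)
  simpa [Real.norm_eq_abs, abs_of_pos (coshRatio_pos w y)] using abs_sinhRatio_le w y

theorem integral_coshRatio {n : ℕ} (w : Fin n → ℝ) :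
    ∫ y, coshRatio w y ∂(stdNormal n) = 1 := by
  simp only [coshRatio_eq]
  rw [integral_div, integral_add (integrable_expTilt _) (integrable_expTilt _), integral_expTilt,
    integral_expTilt]
  norm_num

theorem integral_coshRatio_mul {n : ℕ} (u w : Fin n → ℝ) :
    ∫ y, coshRatio u y * coshRatio w y ∂(stdNormal n) = Real.cosh (u ⬝ᵥ w) := by
  have h : (fun y => coshRatio u y * coshRatio w y) = fun y =>
      (((expTilt u y * expTilt w y) + (expTilt (-u) y * expTilt (-w) y)) +
        ((expTilt (-u) y * expTilt w y) + (expTilt u y * expTilt (-w) y))) / 4 := by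
    ext y; simp only [coshRatio_eq]; ring
  rw [h, integral_div, integral_add, integral_add, integral_add, integral_expTilt_mul,
    integral_expTilt_mul, integral_expTilt_mul, integral_expTilt_mul]
  · simp only [neg_dotProduct, dotProduct_neg, neg_neg, Real.cosh_eq]; ring
  all_goals first
    | exact integrable_expTilt_mul _ _
    | exact (integrable_expTilt_mul _ _).add (integrable_expTilt_mul _ _)

theorem integral_sinhRatio_mul {n : ℕ} (u w : Fin n → ℝ) :
    ∫ y, sinhRatio u y * sinhRatio w y ∂(stdNormal n) = Real.sinh (u ⬝ᵥ w) := by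
  have h : (fun y => sinhRatio u y * sinhRatio w y) = fun y =>
      (((expTilt u y * expTilt w y) + (expTilt (-u) y * expTilt (-w) y)) -
        ((expTilt (-u) y * expTilt w y) + (expTilt u y * expTilt (-w) y))) / 4 := by
    ext y; simp only [sinhRatio_eq]; ring
  rw [h, integral_div, integral_sub, integral_add, integral_add, integral_expTilt_mul,
    integral_expTilt_mul, integral_expTilt_mul, integral_expTilt_mul]
  · simp only [neg_dotProduct, dotProduct_neg, neg_neg, Real.sinh_eq]; ring
  all_goals first
    | exact integrable_expTilt_mul _ _
    | exact (integrable_expTilt_mul _ _).add (integrable_expTilt_mul _ _)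

/-- Conditioning on `u ⬝ᵥ y` replaces the direction `w` by its projection on `u`. -/
theorem integral_comp_mul_expTilt {n : ℕ} (F : ℝ → ℝ) (u w : Fin n → ℝ) (hu : u ⬝ᵥ u ≠ 0) :
    ∫ y, F (u ⬝ᵥ y) * expTilt w y ∂(stdNormal n) =
      ∫ y, F (u ⬝ᵥ y) * expTilt ((u ⬝ᵥ w / u ⬝ᵥ u) • u) y ∂(stdNormal n) := by
  -- After Cameron–Martin both sides are means of `F` at `u ⬝ᵥ y` plus `u ⬝ᵥ shift`, and the two
  -- shifts have the same inner product with `u`.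
  rw [integral_mul_expTilt w fun y => F (u ⬝ᵥ y), integral_mul_expTilt _ fun y => F (u ⬝ᵥ y)]
  simp [dotProduct_add, hu]

theorem integral_comp_mul_coshRatio {n : ℕ} (F : ℝ → ℝ) (u w : Fin n → ℝ) (hu : u ⬝ᵥ u ≠ 0)
    (hF : MemLp (fun y => F (u ⬝ᵥ y)) 2 (stdNormal n)) :
    ∫ y, F (u ⬝ᵥ y) * coshRatio w y ∂(stdNormal n) =
      ∫ y, F (u ⬝ᵥ y) * coshRatio ((u ⬝ᵥ w / u ⬝ᵥ u) • u) y ∂(stdNormal n) := by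
  have h : ∀ w : Fin n → ℝ, ∫ y, F (u ⬝ᵥ y) * coshRatio w y ∂(stdNormal n) =
      (∫ y, F (u ⬝ᵥ y) * expTilt w y ∂(stdNormal n) +
        ∫ y, F (u ⬝ᵥ y) * expTilt (-w) y ∂(stdNormal n)) / 2 := fun w => by
    rw [← integral_add (integrable_mul_of_memLp_two hF (memLp_expTilt w))
        (integrable_mul_of_memLp_two hF (memLp_expTilt _)),
      ← integral_div]
    refine integral_congr_ae (Eventually.of_forall fun y => ?_)
    simp only [coshRatio_eq]; ring
  rw [h, h, integral_comp_mul_expTilt F u w hu, integral_comp_mul_expTilt F u (-w) hu]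
  simp [neg_div]

theorem integral_comp_mul_sinhRatio {n : ℕ} (F : ℝ → ℝ) (u w : Fin n → ℝ) (hu : u ⬝ᵥ u ≠ 0)
    (hF : MemLp (fun y => F (u ⬝ᵥ y)) 2 (stdNormal n)) :
    ∫ y, F (u ⬝ᵥ y) * sinhRatio w y ∂(stdNormal n) =
      ∫ y, F (u ⬝ᵥ y) * sinhRatio ((u ⬝ᵥ w / u ⬝ᵥ u) • u) y ∂(stdNormal n) := by
  have h : ∀ w : Fin n → ℝ, ∫ y, F (u ⬝ᵥ y) * sinhRatio w y ∂(stdNormal n) =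
      (∫ y, F (u ⬝ᵥ y) * expTilt w y ∂(stdNormal n) -
        ∫ y, F (u ⬝ᵥ y) * expTilt (-w) y ∂(stdNormal n)) / 2 := fun w => by
    rw [← integral_sub (integrable_mul_of_memLp_two hF (memLp_expTilt w))
        (integrable_mul_of_memLp_two hF (memLp_expTilt _)),
      ← integral_div]
    refine integral_congr_ae (Eventually.of_forall fun y => ?_)
    simp only [sinhRatio_eq]; ring
  rw [h, h, integral_comp_mul_expTilt F u w hu, integral_comp_mul_expTilt F u (-w) hu]
  simp [neg_div]

/-! ### Truncated ratios and their tails. -/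

/-- `coshRatio` on the event `|w ⬝ᵥ y| ≤ T`. -/
noncomputable def coshTrunc {n : ℕ} (T : ℝ) (w y : Fin n → ℝ) : ℝ :=
  if |w ⬝ᵥ y| ≤ T then coshRatio w y else 0

/-- `sinhRatio` on the event `|w ⬝ᵥ y| ≤ T`. -/
noncomputable def sinhTrunc {n : ℕ} (T : ℝ) (w y : Fin n → ℝ) : ℝ :=
  if |w ⬝ᵥ y| ≤ T then sinhRatio w y else 0

/-- `coshRatio` on the event `|w ⬝ᵥ y| > T`. -/
noncomputable def coshTail {n : ℕ} (T : ℝ) (w y : Fin n → ℝ) : ℝ :=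
  if |w ⬝ᵥ y| ≤ T then 0 else coshRatio w y

/-- `sinhRatio` on the event `|w ⬝ᵥ y| > T`. -/
noncomputable def sinhTail {n : ℕ} (T : ℝ) (w y : Fin n → ℝ) : ℝ :=
  if |w ⬝ᵥ y| ≤ T then 0 else sinhRatio w y

section trunc
variable {n : ℕ} (T : ℝ) (u w y : Fin n → ℝ)

theorem measurableSet_abs_dotProduct_le : MeasurableSet {y : Fin n → ℝ | |w ⬝ᵥ y| ≤ T} :=
  measurableSet_le (measurable_dotProduct_left w).abs measurable_const

theorem coshTrunc_eq : coshTrunc T w y = coshRatio w y - coshTail T w y := by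
  unfold coshTrunc coshTail; split_ifs <;> simp

theorem sinhTrunc_eq : sinhTrunc T w y = sinhRatio w y - sinhTail T w y := by
  unfold sinhTrunc sinhTail; split_ifs <;> simp

theorem coshTail_nonneg : 0 ≤ coshTail T w y := by
  unfold coshTail; split_ifs
  · exact le_rfl
  · exact (coshRatio_pos w y).le

theorem coshTrunc_nonneg : 0 ≤ coshTrunc T w y := by
  unfold coshTrunc; split_ifs
  · exact (coshRatio_pos w y).le
  · exact le_rfl

theorem coshTrunc_le : coshTrunc T w y ≤ coshRatio w y := by
  linarith [coshTrunc_eq T w y, coshTail_nonneg T w y]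

theorem abs_sinhTail_le : |sinhTail T w y| ≤ coshTail T w y := by
  unfold coshTail sinhTail; split_ifs
  · simp
  · exact abs_sinhRatio_le w y

theorem sinhTrunc_sq_le : sinhTrunc T w y ^ 2 ≤ sinhRatio w y ^ 2 := by
  unfold sinhTrunc; split_ifs
  · exact le_rfl
  · simpa using sq_nonneg _

theorem sinhTrunc_sq_le_coshTrunc_sq : sinhTrunc T w y ^ 2 ≤ coshTrunc T w y ^ 2 := by
  unfold sinhTrunc coshTrunc; split_ifs
  · exact sq_le_sq' (neg_le_of_abs_le (abs_sinhRatio_le w y)) (le_of_abs_le (abs_sinhRatio_le w y))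
  · simp

theorem memLp_coshTail : MemLp (coshTail T w) 2 (stdNormal n) := by
  have h := (memLp_coshRatio w).indicator (measurableSet_abs_dotProduct_le T w).compl
  refine h.congr_norm ?_ (Eventually.of_forall fun y => ?_)
  · exact (Measurable.ite (measurableSet_abs_dotProduct_le T w) measurable_const
      (measurable_coshRatio w)).aestronglyMeasurable
  · by_cases hy : |w ⬝ᵥ y| ≤ T <;> simp [coshTail, hy]

theorem memLp_sinhTail : MemLp (sinhTail T w) 2 (stdNormal n) := by
  refine (memLp_coshTail T w).mono (Measurable.ite (measurableSet_abs_dotProduct_le T w)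
    measurable_const (measurable_sinhRatio w)).aestronglyMeasurable (Eventually.of_forall fun y => ?_)
  simpa [Real.norm_eq_abs, abs_of_nonneg (coshTail_nonneg T w y)] using abs_sinhTail_le T w y

theorem memLp_coshTrunc : MemLp (coshTrunc T w) 2 (stdNormal n) := by
  have := (memLp_coshRatio w).sub (memLp_coshTail T w)
  exact (memLp_congr_ae (Eventually.of_forall fun y => coshTrunc_eq T w y)).2 this

theorem memLp_sinhTrunc : MemLp (sinhTrunc T w) 2 (stdNormal n) := by
  have := (memLp_sinhRatio w).sub (memLp_sinhTail T w)
  exact (memLp_congr_ae (Eventually.of_forall fun y => sinhTrunc_eq T w y)).2 this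

end trunc


/-! ### Gaussian moments of truncated ratios and tails. -/

section bounds
variable {n : ℕ} {T κ : ℝ} {u w : Fin n → ℝ}

/-- Chernoff's device: beyond the threshold, `exp |s|` is at most `exp (-(κ - 1) T) * exp (κ |s|)`.
The majorant is again an even ratio, in direction `κ • w`, so its means and pair moments are
explicit; `κ` is optimized later. -/
theorem coshTail_le (hκ : 1 ≤ κ) (w y : Fin n → ℝ) :
    coshTail T w y ≤
      2 * Real.exp ((κ ^ 2 - 1) * (w ⬝ᵥ w) / 2 - (κ - 1) * T) * coshRatio (κ • w) y := by
  unfold coshTail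
  split_ifs with h
  · have := coshRatio_pos (κ • w) y
    positivity
  push Not at h
  have h1 : Real.cosh (w ⬝ᵥ y) ≤ Real.exp |w ⬝ᵥ y| := by
    rw [← Real.cosh_abs, Real.cosh_eq]
    have : Real.exp (-|w ⬝ᵥ y|) ≤ Real.exp |w ⬝ᵥ y| := Real.exp_le_exp.2 (by linarith [abs_nonneg (w ⬝ᵥ y)])
    linarith
  have h2 : Real.exp |w ⬝ᵥ y| ≤ Real.exp (-(κ - 1) * T) * Real.exp |κ * (w ⬝ᵥ y)| := by
    rw [← Real.exp_add, abs_mul, abs_of_pos (show (0 : ℝ) < κ by linarith)]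
    apply Real.exp_le_exp.2
    nlinarith
  have h3 : Real.exp |κ * (w ⬝ᵥ y)| ≤ 2 * Real.cosh (κ * (w ⬝ᵥ y)) := by
    rw [← Real.cosh_abs, Real.cosh_eq]
    linarith [Real.exp_pos (-|κ * (w ⬝ᵥ y)|)]
  calc coshRatio w y ≤ Real.exp (-(w ⬝ᵥ w) / 2) *
      (Real.exp (-(κ - 1) * T) * (2 * Real.cosh (κ * (w ⬝ᵥ y)))) := by
        refine mul_le_mul_of_nonneg_left (h1.trans (h2.trans ?_)) (Real.exp_pos _).le
        exact mul_le_mul_of_nonneg_left h3 (Real.exp_pos _).le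
    _ = _ := by
        simp only [coshRatio, smul_dotProduct, dotProduct_smul, smul_eq_mul]
        rw [show (κ ^ 2 - 1) * (w ⬝ᵥ w) / 2 - (κ - 1) * T =
          -(w ⬝ᵥ w) / 2 + -(κ - 1) * T + κ * (κ * (w ⬝ᵥ w)) / 2 by ring, Real.exp_add, Real.exp_add,
          neg_div (2:ℝ) (κ * (κ * (w ⬝ᵥ w))), Real.exp_neg (κ * (κ * (w ⬝ᵥ w)) / 2)]
        field_simp

theorem integral_coshTail_le (hκ : 1 ≤ κ) :
    ∫ y, coshTail T w y ∂(stdNormal n) ≤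
      2 * Real.exp ((κ ^ 2 - 1) * (w ⬝ᵥ w) / 2 - (κ - 1) * T) := by
  refine (integral_mono ((memLp_coshTail T w).integrable one_le_two)
    (((memLp_coshRatio (κ • w)).integrable one_le_two).const_mul _)
    fun y => coshTail_le hκ w y).trans ?_
  rw [integral_const_mul, integral_coshRatio, mul_one]

theorem integral_coshTail_mul_le (hκ : 1 ≤ κ) :
    ∫ y, coshTail T u y * coshTail T w y ∂(stdNormal n) ≤
      4 * Real.exp ((κ ^ 2 - 1) * (u ⬝ᵥ u + w ⬝ᵥ w) / 2 - 2 * (κ - 1) * T) *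
        Real.cosh (κ ^ 2 * (u ⬝ᵥ w)) := by
  refine (integral_mono (integrable_mul_of_memLp_two (memLp_coshTail T u) (memLp_coshTail T w))
    ((integrable_mul_of_memLp_two (memLp_coshRatio (κ • u)) (memLp_coshRatio (κ • w))).const_mul
      (2 * Real.exp ((κ ^ 2 - 1) * (u ⬝ᵥ u) / 2 - (κ - 1) * T) *
        (2 * Real.exp ((κ ^ 2 - 1) * (w ⬝ᵥ w) / 2 - (κ - 1) * T))))
    fun y => (mul_le_mul (coshTail_le hκ u y) (coshTail_le hκ w y) (coshTail_nonneg _ _ _)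
      ((coshTail_nonneg T u y).trans (coshTail_le hκ u y))).trans (le_of_eq (by ring))).trans ?_
  rw [integral_const_mul, integral_coshRatio_mul]
  refine le_of_eq ?_
  rw [show (κ ^ 2 - 1) * (u ⬝ᵥ u + w ⬝ᵥ w) / 2 - 2 * (κ - 1) * T =
    ((κ ^ 2 - 1) * (u ⬝ᵥ u) / 2 - (κ - 1) * T) + ((κ ^ 2 - 1) * (w ⬝ᵥ w) / 2 - (κ - 1) * T) by ring,
    Real.exp_add]
  simp only [smul_dotProduct, dotProduct_smul, smul_eq_mul]
  ring_nf

/-- The tail depends on `y` through `u ⬝ᵥ y` only, so `w` may be replaced by its projection on `u`.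
Since `cosh ≥ 1`, the projected ratio is at least `exp` of minus half its squared length, hence the
loss is of second order in `u ⬝ᵥ w`. -/
theorem le_integral_coshTail_mul_coshRatio (hu : 0 < u ⬝ᵥ u) :
    (1 - (u ⬝ᵥ w) ^ 2 / (2 * (u ⬝ᵥ u))) * ∫ y, coshTail T u y ∂(stdNormal n) ≤
      ∫ y, coshTail T u y * coshRatio w y ∂(stdNormal n) := by
  have h := integral_comp_mul_coshRatio
    (fun x => if |x| ≤ T then 0 else Real.exp (-(u ⬝ᵥ u) / 2) * Real.cosh x) u w hu.ne'
    (memLp_coshTail T u)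
  change ∫ y, coshTail T u y * coshRatio w y ∂(stdNormal n) =
    ∫ y, coshTail T u y * coshRatio ((u ⬝ᵥ w / u ⬝ᵥ u) • u) y ∂(stdNormal n) at h
  rw [h, ← integral_const_mul]
  refine integral_mono (((memLp_coshTail T u).integrable one_le_two).const_mul _)
    (integrable_mul_of_memLp_two (memLp_coshTail T u) (memLp_coshRatio _)) fun y => ?_
  dsimp only
  rw [mul_comm]
  refine mul_le_mul_of_nonneg_left ?_ (coshTail_nonneg T u y)
  unfold coshRatio
  have h1 := Real.one_le_cosh ((u ⬝ᵥ w / u ⬝ᵥ u) • u ⬝ᵥ y)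
  have h2 := Real.add_one_le_exp (-((u ⬝ᵥ w / u ⬝ᵥ u) • u ⬝ᵥ (u ⬝ᵥ w / u ⬝ᵥ u) • u) / 2)
  have h3 : -((u ⬝ᵥ w / u ⬝ᵥ u) • u ⬝ᵥ (u ⬝ᵥ w / u ⬝ᵥ u) • u) / 2 + 1 =
      1 - (u ⬝ᵥ w) ^ 2 / (2 * (u ⬝ᵥ u)) := by
    simp only [smul_dotProduct, dotProduct_smul, smul_eq_mul]
    field_simp; ring
  rw [h3] at h2
  exact h2.trans (le_mul_of_one_le_right (Real.exp_pos _).le h1)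

/-- After projecting `w` on `u`, the integrand contains `sinh s * sinh (a s)` with `a` of the sign
of `u ⬝ᵥ w`, and this product has the sign of `a`. -/
theorem integral_sinhTail_mul_sinhRatio_nonneg (hu : 0 < u ⬝ᵥ u) :
    0 ≤ u ⬝ᵥ w * ∫ y, sinhTail T u y * sinhRatio w y ∂(stdNormal n) := by
  have h := integral_comp_mul_sinhRatio
    (fun x => if |x| ≤ T then 0 else Real.exp (-(u ⬝ᵥ u) / 2) * Real.sinh x) u w hu.ne'
    (memLp_sinhTail T u)
  change ∫ y, sinhTail T u y * sinhRatio w y ∂(stdNormal n) =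
    ∫ y, sinhTail T u y * sinhRatio ((u ⬝ᵥ w / u ⬝ᵥ u) • u) y ∂(stdNormal n) at h
  rw [h, ← integral_const_mul]
  refine integral_nonneg fun y => ?_
  have key : ∀ a x : ℝ, 0 ≤ a * (Real.sinh x * Real.sinh (a / (u ⬝ᵥ u) * x)) := fun a x => by
    rcases le_total 0 a with ha | ha <;> rcases le_total 0 x with hx | hx
    · exact mul_nonneg ha (mul_nonneg (Real.sinh_nonneg_iff.2 hx) (Real.sinh_nonneg_iff.2 (by positivity)))
    · exact mul_nonneg ha (mul_nonneg_of_nonpos_of_nonpos (Real.sinh_nonpos_iff.2 hx)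
        (Real.sinh_nonpos_iff.2 (mul_nonpos_of_nonneg_of_nonpos (by positivity) hx)))
    · refine mul_nonneg_of_nonpos_of_nonpos ha (mul_nonpos_of_nonneg_of_nonpos
        (Real.sinh_nonneg_iff.2 hx) (Real.sinh_nonpos_iff.2 (mul_nonpos_of_nonpos_of_nonneg ?_ hx)))
      exact div_nonpos_of_nonpos_of_nonneg ha hu.le
    · refine mul_nonneg_of_nonpos_of_nonpos ha (mul_nonpos_of_nonpos_of_nonneg
        (Real.sinh_nonpos_iff.2 hx) (Real.sinh_nonneg_iff.2 (mul_nonneg_of_nonpos_of_nonpos ?_ hx)))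
      exact div_nonpos_of_nonpos_of_nonneg ha hu.le
  dsimp only
  unfold sinhTail
  split_ifs with hy
  · simp
  · unfold sinhRatio
    have := key (u ⬝ᵥ w) (u ⬝ᵥ y)
    simp only [smul_dotProduct, smul_eq_mul]
    calc (0:ℝ) ≤ Real.exp (-(u ⬝ᵥ u) / 2) *
        Real.exp (-(u ⬝ᵥ w / u ⬝ᵥ u * (u ⬝ᵥ (u ⬝ᵥ w / u ⬝ᵥ u) • u)) / 2) *
        (u ⬝ᵥ w * (Real.sinh (u ⬝ᵥ y) * Real.sinh (u ⬝ᵥ w / u ⬝ᵥ u * u ⬝ᵥ y))) := by positivity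
      _ = _ := by ring

/-- Covariance of two centred truncated even ratios. -/
theorem integral_coshTrunc_sub_one_mul_le (hu : 0 < u ⬝ᵥ u) (hw : 0 < w ⬝ᵥ w) :
    ∫ y, (coshTrunc T u y - 1) * (coshTrunc T w y - 1) ∂(stdNormal n) ≤
      (Real.cosh (u ⬝ᵥ w) - 1) +
        (u ⬝ᵥ w) ^ 2 / (2 * (u ⬝ᵥ u)) * ∫ y, coshTail T u y ∂(stdNormal n) +
        (u ⬝ᵥ w) ^ 2 / (2 * (w ⬝ᵥ w)) * ∫ y, coshTail T w y ∂(stdNormal n) +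
        ∫ y, coshTail T u y * coshTail T w y ∂(stdNormal n) := by
  have i1 := fun v : Fin n → ℝ => (memLp_coshRatio v).integrable one_le_two
  have i2 := fun v : Fin n → ℝ => (memLp_coshTail T v).integrable one_le_two
  have m1 := integrable_mul_of_memLp_two (memLp_coshRatio u) (memLp_coshRatio w)
  have m2 := integrable_mul_of_memLp_two (memLp_coshTail T u) (memLp_coshRatio w)
  have m3 := integrable_mul_of_memLp_two (memLp_coshTail T w) (memLp_coshRatio u)
  have m4 := integrable_mul_of_memLp_two (memLp_coshTail T u) (memLp_coshTail T w)
  have h : (fun y => (coshTrunc T u y - 1) * (coshTrunc T w y - 1)) = fun y =>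
      (coshRatio u y * coshRatio w y - (coshRatio u y + coshRatio w y - 1)) -
        (coshTail T u y * coshRatio w y - coshTail T u y) -
        (coshTail T w y * coshRatio u y - coshTail T w y) + coshTail T u y * coshTail T w y := by
    ext y; simp only [coshTrunc_eq]; ring
  rw [h, integral_add (((m1.fun_sub (((i1 u).fun_add (i1 w)).fun_sub (integrable_const 1))).fun_sub
      (m2.fun_sub (i2 u))).fun_sub (m3.fun_sub (i2 w))) m4,
    integral_sub ((m1.fun_sub (((i1 u).fun_add (i1 w)).fun_sub (integrable_const 1))).fun_sub
      (m2.fun_sub (i2 u))) (m3.fun_sub (i2 w)),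
    integral_sub (m1.fun_sub (((i1 u).fun_add (i1 w)).fun_sub (integrable_const 1))) (m2.fun_sub (i2 u)),
    integral_sub m1 (((i1 u).fun_add (i1 w)).fun_sub (integrable_const 1)),
    integral_sub ((i1 u).fun_add (i1 w)) (integrable_const 1), integral_add (i1 u) (i1 w),
    integral_sub m2 (i2 u), integral_sub m3 (i2 w), integral_coshRatio_mul, integral_coshRatio,
    integral_coshRatio]
  -- In the expansion the products of a tail with a full ratio carry a minus sign, so lower bounds
  -- for them are what is needed.
  have k1 := le_integral_coshTail_mul_coshRatio (T := T) (w := w) hu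
  have k2 := le_integral_coshTail_mul_coshRatio (T := T) (w := u) hw
  rw [dotProduct_comm w u] at k2
  simp
  linarith

/-- The factor `u ⬝ᵥ w` is the one with which this moment enters the interaction term, and it fixes
the sign of the mixed products of tail and full ratio: they are subtracted nonnegative quantities
and can be dropped. -/
theorem mul_integral_sinhTrunc_mul_le (hu : 0 < u ⬝ᵥ u) (hw : 0 < w ⬝ᵥ w) :
    u ⬝ᵥ w * ∫ y, sinhTrunc T u y * sinhTrunc T w y ∂(stdNormal n) ≤
      u ⬝ᵥ w * Real.sinh (u ⬝ᵥ w) +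
        |u ⬝ᵥ w| * ∫ y, coshTail T u y * coshTail T w y ∂(stdNormal n) := by
  have m1 := integrable_mul_of_memLp_two (memLp_sinhRatio u) (memLp_sinhRatio w)
  have m2 := integrable_mul_of_memLp_two (memLp_sinhTail T u) (memLp_sinhRatio w)
  have m3 := integrable_mul_of_memLp_two (memLp_sinhTail T w) (memLp_sinhRatio u)
  have m4 := integrable_mul_of_memLp_two (memLp_sinhTail T u) (memLp_sinhTail T w)
  have m5 := integrable_mul_of_memLp_two (memLp_coshTail T u) (memLp_coshTail T w)
  have h : (fun y => sinhTrunc T u y * sinhTrunc T w y) = fun y =>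
      sinhRatio u y * sinhRatio w y - sinhTail T u y * sinhRatio w y -
        sinhTail T w y * sinhRatio u y + sinhTail T u y * sinhTail T w y := by
    ext y; simp only [sinhTrunc_eq]; ring
  rw [h, integral_add ((m1.fun_sub m2).fun_sub m3) m4, integral_sub (m1.fun_sub m2) m3, integral_sub m1 m2,
    integral_sinhRatio_mul]
  have k1 := integral_sinhTail_mul_sinhRatio_nonneg (T := T) (w := w) hu
  have k2 := integral_sinhTail_mul_sinhRatio_nonneg (T := T) (w := u) hw
  rw [dotProduct_comm w u] at k2
  have k3 : u ⬝ᵥ w * ∫ y, sinhTail T u y * sinhTail T w y ∂(stdNormal n) ≤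
      |u ⬝ᵥ w| * ∫ y, coshTail T u y * coshTail T w y ∂(stdNormal n) := by
    refine (le_abs_self _).trans ?_
    rw [abs_mul]
    refine mul_le_mul_of_nonneg_left ?_ (abs_nonneg _)
    refine (abs_integral_le_integral_abs).trans (integral_mono m4.abs m5 fun y => ?_)
    dsimp only
    rw [abs_mul]
    exact mul_le_mul (abs_sinhTail_le T u y) (abs_sinhTail_le T w y) (abs_nonneg _)
      (coshTail_nonneg T u y)
  linarith

theorem integral_coshTrunc_sq_le : ∫ y, coshTrunc T w y ^ 2 ∂(stdNormal n) ≤ Real.cosh (w ⬝ᵥ w) := by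
  rw [← integral_coshRatio_mul]
  refine integral_mono (memLp_coshTrunc T w).integrable_sq
    (integrable_mul_of_memLp_two (memLp_coshRatio w) (memLp_coshRatio w)) fun y => ?_
  have := coshTrunc_le T w y
  have := coshTrunc_nonneg T w y
  dsimp only
  nlinarith

/-- Below the threshold `exp (2 |s|) ≤ exp ((2 - κ) T) * exp (κ |s|)`: the truncation trades the
exponent two of a second moment for a smaller `κ`, and `κ = 2` would ignore it. -/
theorem integral_coshTrunc_sq_le_of_le_two (hκ0 : 0 ≤ κ) (hκ : κ ≤ 2) :
    ∫ y, coshTrunc T w y ^ 2 ∂(stdNormal n) ≤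
      2 * Real.exp ((κ ^ 2 / 2 - 1) * (w ⬝ᵥ w) + (2 - κ) * T) := by
  have h : ∀ y, coshTrunc T w y ^ 2 ≤
      2 * Real.exp ((κ ^ 2 / 2 - 1) * (w ⬝ᵥ w) + (2 - κ) * T) * coshRatio (κ • w) y := by
    intro y
    unfold coshTrunc
    split_ifs with hy
    swap
    · have := coshRatio_pos (κ • w) y
      simp only [ne_eq, OfNat.ofNat_ne_zero, not_false_eq_true, zero_pow]
      positivity
    have h1 : Real.cosh (w ⬝ᵥ y) ≤ Real.exp |w ⬝ᵥ y| := by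
      rw [← Real.cosh_abs, Real.cosh_eq]
      have : Real.exp (-|w ⬝ᵥ y|) ≤ Real.exp |w ⬝ᵥ y| :=
        Real.exp_le_exp.2 (by linarith [abs_nonneg (w ⬝ᵥ y)])
      linarith
    have h2 : Real.exp |w ⬝ᵥ y| ^ 2 ≤ Real.exp ((2 - κ) * T) * Real.exp |κ * (w ⬝ᵥ y)| := by
      rw [← Real.exp_add, ← Real.exp_nat_mul, abs_mul κ, abs_of_nonneg hκ0]
      apply Real.exp_le_exp.2
      push_cast
      nlinarith
    have h3 : Real.exp |κ * (w ⬝ᵥ y)| ≤ 2 * Real.cosh (κ * (w ⬝ᵥ y)) := by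
      rw [← Real.cosh_abs, Real.cosh_eq]
      linarith [Real.exp_pos (-|κ * (w ⬝ᵥ y)|)]
    calc coshRatio w y ^ 2 = Real.exp (-(w ⬝ᵥ w)) * Real.cosh (w ⬝ᵥ y) ^ 2 := by
          rw [coshRatio, mul_pow, ← Real.exp_nat_mul]; congr 2; push_cast; ring
      _ ≤ Real.exp (-(w ⬝ᵥ w)) *
        (Real.exp ((2 - κ) * T) * (2 * Real.cosh (κ * (w ⬝ᵥ y)))) := by
          refine mul_le_mul_of_nonneg_left ?_ (Real.exp_pos _).le
          refine (pow_le_pow_left₀ (Real.cosh_pos _).le h1 2).trans (h2.trans ?_)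
          exact mul_le_mul_of_nonneg_left h3 (Real.exp_pos _).le
      _ = _ := by
          simp only [coshRatio, smul_dotProduct, dotProduct_smul, smul_eq_mul]
          rw [show (κ ^ 2 / 2 - 1) * (w ⬝ᵥ w) + (2 - κ) * T =
            -(w ⬝ᵥ w) + (2 - κ) * T + κ * (κ * (w ⬝ᵥ w)) / 2 by ring, Real.exp_add, Real.exp_add,
            neg_div (2:ℝ) (κ * (κ * (w ⬝ᵥ w))), Real.exp_neg (κ * (κ * (w ⬝ᵥ w)) / 2)]
          field_simp
  refine (integral_mono (memLp_coshTrunc T w).integrable_sq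
    (((memLp_coshRatio (κ • w)).integrable one_le_two).const_mul _) h).trans ?_
  rw [integral_const_mul, integral_coshRatio, mul_one]

theorem integral_sinhTrunc_sq_le : ∫ y, sinhTrunc T w y ^ 2 ∂(stdNormal n) ≤ Real.sinh (w ⬝ᵥ w) := by
  rw [← integral_sinhRatio_mul]
  refine integral_mono (memLp_sinhTrunc T w).integrable_sq
    (integrable_mul_of_memLp_two (memLp_sinhRatio w) (memLp_sinhRatio w)) fun y => ?_
  simpa [sq] using sinhTrunc_sq_le T w y

theorem integral_sinhTrunc_sq_le_coshTrunc_sq :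
    ∫ y, sinhTrunc T w y ^ 2 ∂(stdNormal n) ≤ ∫ y, coshTrunc T w y ^ 2 ∂(stdNormal n) :=
  integral_mono (memLp_sinhTrunc T w).integrable_sq (memLp_coshTrunc T w).integrable_sq
    fun y => sinhTrunc_sq_le_coshTrunc_sq T w y

/-- The full ratio has mean one, so the truncated one has mean one minus the tail mean; this is the
source of the last term. -/
theorem integral_coshTrunc_sub_one_sq :
    ∫ y, (coshTrunc T w y - 1) ^ 2 ∂(stdNormal n) =
      ∫ y, coshTrunc T w y ^ 2 ∂(stdNormal n) - 1 + 2 * ∫ y, coshTail T w y ∂(stdNormal n) := by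
  have i1 := (memLp_coshRatio w).integrable one_le_two
  have i2 := (memLp_coshTail T w).integrable one_le_two
  have h : (fun y => (coshTrunc T w y - 1) ^ 2) = fun y =>
      (coshTrunc T w y ^ 2 - (2 * coshRatio w y - 1)) + 2 * coshTail T w y := by
    ext y
    have := coshTrunc_eq T w y
    rw [show coshTail T w y = coshRatio w y - coshTrunc T w y by linarith]
    ring
  rw [h, integral_add ((memLp_coshTrunc T w).integrable_sq.fun_sub
    ((i1.const_mul 2).fun_sub (integrable_const 1))) (i2.const_mul 2),
    integral_sub (memLp_coshTrunc T w).integrable_sq ((i1.const_mul 2).fun_sub (integrable_const 1)),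
    integral_sub (i1.const_mul 2) (integrable_const 1), integral_const_mul, integral_const_mul,
    integral_coshRatio]
  norm_num

theorem integral_coshTrunc_sub_one_sq_le_add_one :
    ∫ y, (coshTrunc T w y - 1) ^ 2 ∂(stdNormal n) ≤ ∫ y, coshTrunc T w y ^ 2 ∂(stdNormal n) + 1 := by
  have i1 := (memLp_coshTrunc T w).integrable_sq
  refine (integral_mono ((memLp_coshTrunc T w).sub (memLp_const 1)).integrable_sq
    (i1.add (integrable_const 1)) fun y => ?_).trans (le_of_eq ?_)
  · have := coshTrunc_nonneg T w y
    simp only [Pi.add_apply, Pi.sub_apply]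
    nlinarith
  · simp only [Pi.add_apply]
    rw [integral_add i1 (integrable_const 1)]; simp

end bounds

/-! ### Sums against product weights. -/

section productWeights
variable {p : ℕ} {α : Type*} [Fintype α] {ρ : Fin p → α → ℝ}

theorem sum_prod_mul_prod (ρ F : Fin p → α → ℝ) :
    ∑ σ : Fin p → α, (∏ j, ρ j (σ j)) * ∏ j, F j (σ j) = ∏ j, ∑ s, ρ j s * F j s := by
  rw [Finset.prod_univ_sum, Fintype.piFinset_univ]
  exact Finset.sum_congr rfl fun σ _ => Finset.prod_mul_distrib.symm

theorem sum_prod_eq_one (hρ : ∀ j, ∑ s, ρ j s = 1) :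
    ∑ σ : Fin p → α, ∏ j, ρ j (σ j) = 1 := by
  have := sum_prod_mul_prod ρ fun _ _ => 1
  simpa [hρ] using this

theorem sum_prod_mul_apply (hρ : ∀ j, ∑ s, ρ j s = 1) (i : Fin p) (f : α → ℝ) :
    ∑ σ : Fin p → α, (∏ j, ρ j (σ j)) * f (σ i) = ∑ s, ρ i s * f s := by
  have := sum_prod_mul_prod ρ fun j s => if j = i then f s else 1
  simp only [Finset.prod_ite_eq', Finset.mem_univ, if_true] at this
  rw [this, Finset.prod_eq_single i]
  · simp
  · intro j _ hj; simp [hj, hρ]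
  · simp

theorem sum_prod_mul_apply_mul_apply (hρ : ∀ j, ∑ s, ρ j s = 1) {i l : Fin p} (hil : i ≠ l)
    (f g : α → ℝ) :
    ∑ σ : Fin p → α, (∏ j, ρ j (σ j)) * (f (σ i) * g (σ l)) =
      (∑ s, ρ i s * f s) * ∑ s, ρ l s * g s := by
  have := sum_prod_mul_prod ρ fun j s => (if j = i then f s else 1) * (if j = l then g s else 1)
  simp only [Finset.prod_mul_distrib, Finset.prod_ite_eq', Finset.mem_univ, if_true] at this
  rw [this, ← Finset.mul_prod_erase _ _ (Finset.mem_univ i),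
    ← Finset.mul_prod_erase _ _ (Finset.mem_erase.2 ⟨hil.symm, Finset.mem_univ l⟩),
    Finset.prod_eq_one]
  · simp [hil, hil.symm]
  · intro j hj
    simp only [Finset.mem_erase] at hj
    simp [hj.1, hj.2.1, hρ]

end productWeights

theorem sum_smul_dotProduct_self {n p : ℕ} (c : Fin p → ℝ) (w : Fin p → Fin n → ℝ) :
    (∑ j, c j • w j) ⬝ᵥ (∑ j, c j • w j) = ∑ j, ∑ l, c j * c l * (w j ⬝ᵥ w l) := by
  simp only [sum_dotProduct, smul_dotProduct, dotProduct_sum, dotProduct_smul, smul_eq_mul,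
    Finset.mul_sum]
  exact Finset.sum_congr rfl fun j _ => Finset.sum_congr rfl fun l _ => by
    rw [dotProduct_comm (w l)]; ring

theorem sum_signType (f : SignType → ℝ) : ∑ s, f s = f 0 + f (-1) + f 1 := by
  rw [SignType.univ_eq, Finset.sum_insert (by decide), Finset.sum_insert (by decide),
    Finset.sum_singleton, add_assoc]

/-! ### The mixture ratio and its mean-field lower bound. -/

/-- The weights `1 - h`, `h / 2`, `h / 2` of the values `0`, `-1`, `1`. -/
noncomputable def signWeight (h : ℝ) (s : SignType) : ℝ := if s = 0 then 1 - h else h / 2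

theorem sum_signWeight (h : ℝ) : ∑ s, signWeight h s = 1 := by
  rw [sum_signType]; simp [signWeight]; ring

theorem signWeight_nonneg {h : ℝ} (h0 : 0 ≤ h) (h1 : h ≤ 1) (s : SignType) :
    0 ≤ signWeight h s := by
  unfold signWeight; split_ifs <;> linarith

/-- The linear combination of the directions `w j` with signs `σ j`. -/
def signComb {n p : ℕ} (w : Fin p → Fin n → ℝ) (σ : Fin p → SignType) : Fin n → ℝ :=
  ∑ j, ((σ j : SignType) : ℝ) • w j

/-- The likelihood ratio of the mixture over independent signs. -/
noncomputable def mixRatio {n p : ℕ} (h : ℝ) (w : Fin p → Fin n → ℝ) (y : Fin n → ℝ) : ℝ :=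
  ∑ σ : Fin p → SignType, (∏ j, signWeight h (σ j)) * expTilt (signComb w σ) y

/-- Truncated posterior weights of a single coordinate. -/
noncomputable def truncWeight {n : ℕ} (h T : ℝ) (w y : Fin n → ℝ) (s : SignType) : ℝ :=
  if s = 0 then 1 - h * coshTrunc T w y
  else if |w ⬝ᵥ y| ≤ T then h / 2 * expTilt ((s : ℝ) • w) y else 0

section gibbs
variable {n p : ℕ} {h T : ℝ} {w : Fin p → Fin n → ℝ} {y : Fin n → ℝ}

theorem sum_truncWeight (h T : ℝ) (w y : Fin n → ℝ) : ∑ s, truncWeight h T w y s = 1 := by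
  rw [sum_signType]
  simp only [truncWeight, coshTrunc]
  by_cases hy : |w ⬝ᵥ y| ≤ T <;> simp [hy, coshRatio_eq]
  ring

theorem sum_truncWeight_mul_sign (h T : ℝ) (w y : Fin n → ℝ) :
    ∑ s, truncWeight h T w y s * (s : ℝ) = h * sinhTrunc T w y := by
  rw [sum_signType]
  simp only [truncWeight, sinhTrunc]
  by_cases hy : |w ⬝ᵥ y| ≤ T <;> simp [hy, sinhRatio_eq]
  ring

theorem truncWeight_nonneg (h0 : 0 ≤ h) {w : Fin n → ℝ} (hw : h * coshTrunc T w y ≤ 1)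
    (s : SignType) : 0 ≤ truncWeight h T w y s := by
  unfold truncWeight
  have := expTilt_pos ((s : ℝ) • w) y
  split_ifs
  · linarith
  · positivity
  · exact le_rfl

theorem signComb_dotProduct_self (w : Fin p → Fin n → ℝ) (σ : Fin p → SignType) :
    signComb w σ ⬝ᵥ signComb w σ = ∑ j, ∑ l, (σ j : ℝ) * (σ l : ℝ) * (w j ⬝ᵥ w l) :=
  sum_smul_dotProduct_self _ w

/-- Expanding the squared norm, the diagonal terms go into the coordinatewise ratios, and the
off-diagonal Gram entries are all that separates the likelihood from a product. -/
theorem expTilt_signComb (w : Fin p → Fin n → ℝ) (σ : Fin p → SignType) (y : Fin n → ℝ) :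
    expTilt (signComb w σ) y = (∏ j, expTilt ((σ j : ℝ) • w j) y) *
      Real.exp (-(∑ j, ∑ l, if j = l then 0 else (σ j : ℝ) * (σ l : ℝ) * (w j ⬝ᵥ w l)) / 2) := by
  have h1 : ∑ j, ∑ l, (σ j : ℝ) * (σ l : ℝ) * (w j ⬝ᵥ w l) =
      ∑ j, (σ j : ℝ) * (σ j : ℝ) * (w j ⬝ᵥ w j) +
        ∑ j, ∑ l, if j = l then 0 else (σ j : ℝ) * (σ l : ℝ) * (w j ⬝ᵥ w l) := by
    rw [← Finset.sum_add_distrib]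
    refine Finset.sum_congr rfl fun j _ => ?_
    rw [← Finset.add_sum_erase _ _ (Finset.mem_univ j)]
    congr 1
    rw [← Finset.add_sum_erase (Finset.univ) _ (Finset.mem_univ j)]
    simp only [if_true, zero_add]
    exact Finset.sum_congr rfl fun l hl => by simp [(Finset.ne_of_mem_erase hl).symm]
  unfold expTilt
  rw [signComb_dotProduct_self, h1, ← Real.exp_sum, ← Real.exp_add]
  congr 1
  simp only [signComb, sum_dotProduct, smul_dotProduct, dotProduct_smul, smul_eq_mul,
    Finset.sum_sub_distrib, ← Finset.sum_div, mul_assoc]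
  ring

/-- At a nonzero sign the truncated weight either equals prior times likelihood or vanishes. Only
the zero state, which absorbs the remaining mass, needs the correction factor, and there equality
holds. -/
theorem truncWeight_le (h0 : 0 ≤ h) (h1 : h < 1) {w : Fin n → ℝ} (hw : h * coshTrunc T w y < 1)
    (s : SignType) :
    truncWeight h T w y s *
        Real.exp (-(if s = 0 then Real.log ((1 - h * coshTrunc T w y) / (1 - h)) else 0)) ≤
      signWeight h s * expTilt ((s : ℝ) • w) y := by
  unfold truncWeight signWeight
  have := expTilt_pos ((s : ℝ) • w) y
  split_ifs with hs hy
  · have h2 : 0 < 1 - h * coshTrunc T w y := by linarith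
    have h3 : 0 < 1 - h := by linarith
    rw [Real.exp_neg, Real.exp_log (by positivity)]
    subst hs
    simp [expTilt]
    field_simp
    exact le_rfl
  · simp
  · simp; positivity

/-- Variational lower bound for the mixture likelihood ratio. -/
theorem le_mixRatio (h0 : 0 ≤ h) (h1 : h ≤ 1 / 2) (hw : ∀ j, h * coshTrunc T (w j) y < 1) :
    1 + ∑ j, h * (coshTrunc T (w j) y - 1) - 2 * ∑ j, (h * (coshTrunc T (w j) y - 1)) ^ 2 -
      (∑ j, (h * sinhTrunc T (w j) y) • w j) ⬝ᵥ (∑ j, (h * sinhTrunc T (w j) y) • w j) / 2 ≤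
      mixRatio h w y := by
  set ρ : Fin p → SignType → ℝ := fun j => truncWeight h T (w j) y with hρdef
  have hρ : ∀ j, ∑ s, ρ j s = 1 := fun j => sum_truncWeight h T (w j) y
  have hρ0 : ∀ j s, 0 ≤ ρ j s := fun j s => truncWeight_nonneg h0 (hw j).le s
  set c : Fin p → ℝ := fun j => Real.log ((1 - h * coshTrunc T (w j) y) / (1 - h)) with hc
  set R : (Fin p → SignType) → ℝ := fun σ =>
    ∑ j, ∑ l, if j = l then 0 else (σ j : ℝ) * (σ l : ℝ) * (w j ⬝ᵥ w l) with hR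
  have step : ∀ σ : Fin p → SignType,
      (∏ j, ρ j (σ j)) * (1 + (-(∑ j, if σ j = 0 then c j else 0) + -(R σ) / 2)) ≤
        (∏ j, signWeight h (σ j)) * expTilt (signComb w σ) y := fun σ => by
    rw [expTilt_signComb, ← mul_assoc, ← Finset.prod_mul_distrib]
    -- The tangent bound `1 + x ≤ exp x` makes the exponent linear, so its mean under the product
    -- weights involves at most two coordinates at a time.
    have e1 : 1 + (-(∑ j, if σ j = 0 then c j else 0) + -(R σ) / 2) ≤
        (∏ j, Real.exp (-(if σ j = 0 then c j else 0))) * Real.exp (-(R σ) / 2) := by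
      rw [← Real.exp_sum, ← Real.exp_add, Finset.sum_neg_distrib, add_comm]
      exact Real.add_one_le_exp _
    refine (mul_le_mul_of_nonneg_left e1 (Finset.prod_nonneg fun j _ => hρ0 j _)).trans ?_
    rw [← mul_assoc, ← Finset.prod_mul_distrib]
    refine mul_le_mul_of_nonneg_right ?_ (Real.exp_pos _).le
    exact Finset.prod_le_prod (fun j _ => mul_nonneg (hρ0 j _) (Real.exp_pos _).le)
      fun j _ => truncWeight_le h0 (by linarith) (hw j) _
  have hsum : ∑ σ : Fin p → SignType,
      (∏ j, ρ j (σ j)) * (1 + (-(∑ j, if σ j = 0 then c j else 0) + -(R σ) / 2)) ≤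
        mixRatio h w y := Finset.sum_le_sum fun σ _ => step σ
  have e2 : ∑ σ : Fin p → SignType, (∏ j, ρ j (σ j)) * (∑ j, if σ j = 0 then c j else 0) =
      ∑ j, (1 - h * coshTrunc T (w j) y) * c j := by
    simp only [Finset.mul_sum]
    rw [Finset.sum_comm]
    refine Finset.sum_congr rfl fun i _ => ?_
    rw [sum_prod_mul_apply hρ i fun s => if s = 0 then c i else 0, sum_signType]
    simp [hρdef, truncWeight]
  have e3 : ∑ σ : Fin p → SignType, (∏ j, ρ j (σ j)) * R σ =
      ∑ j, ∑ l, if j = l then 0 else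
        (h * sinhTrunc T (w j) y) * (h * sinhTrunc T (w l) y) * (w j ⬝ᵥ w l) := by
    simp only [hR, Finset.mul_sum]
    rw [Finset.sum_comm]
    refine Finset.sum_congr rfl fun i _ => ?_
    rw [Finset.sum_comm]
    refine Finset.sum_congr rfl fun l _ => ?_
    split_ifs with hil
    · simp
    · have := sum_prod_mul_apply_mul_apply hρ hil (fun s => (s : ℝ)) fun s => (s : ℝ)
      simp only [hρdef, sum_truncWeight_mul_sign] at this
      rw [← this, Finset.sum_mul]
      exact Finset.sum_congr rfl fun σ _ => by ring
  -- Adding back the nonnegative diagonal turns the interaction into a squared norm, which is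
  -- nonnegative for every `y`.
  have e4 : (∑ j, ∑ l, if j = l then 0 else
        (h * sinhTrunc T (w j) y) * (h * sinhTrunc T (w l) y) * (w j ⬝ᵥ w l)) ≤
      (∑ j, (h * sinhTrunc T (w j) y) • w j) ⬝ᵥ (∑ j, (h * sinhTrunc T (w j) y) • w j) := by
    rw [sum_smul_dotProduct_self]
    refine Finset.sum_le_sum fun j _ => Finset.sum_le_sum fun l _ => ?_
    split_ifs with hjl
    · subst hjl
      have : 0 ≤ w j ⬝ᵥ w j := Finset.sum_nonneg fun i _ => mul_self_nonneg _
      exact mul_nonneg (mul_self_nonneg _) this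
    · exact le_rfl
  have e5 : ∑ j, (1 - h * coshTrunc T (w j) y) * c j ≤
      -(∑ j, h * (coshTrunc T (w j) y - 1)) + 2 * ∑ j, (h * (coshTrunc T (w j) y - 1)) ^ 2 := by
    rw [← Finset.sum_neg_distrib, Finset.mul_sum, ← Finset.sum_add_distrib]
    refine Finset.sum_le_sum fun j _ => ?_
    have h2 : 0 < 1 - h * coshTrunc T (w j) y := by linarith [hw j]
    have h3 : 0 < 1 - h := by linarith
    have h4 : c j ≤ (1 - h * coshTrunc T (w j) y) / (1 - h) - 1 :=
      Real.log_le_sub_one_of_pos (by positivity)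
    refine (mul_le_mul_of_nonneg_left h4 h2.le).trans ?_
    set U := h * (coshTrunc T (w j) y - 1) with hU
    have h5 : 1 - h * coshTrunc T (w j) y = 1 - h - U := by rw [hU]; ring
    rw [h5]
    have h6 : (1 - h - U) * ((1 - h - U) / (1 - h) - 1) = -U + U ^ 2 / (1 - h) := by
      field_simp; ring
    rw [h6]
    -- Here `h ≤ 1 / 2` gives `1 / (1 - h) ≤ 2`.
    have : U ^ 2 / (1 - h) ≤ 2 * U ^ 2 := by
      rw [div_le_iff₀ h3]; nlinarith [sq_nonneg U]
    linarith
  have e6 : ∑ σ : Fin p → SignType,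
      (∏ j, ρ j (σ j)) * (1 + (-(∑ j, if σ j = 0 then c j else 0) + -(R σ) / 2)) =
      1 - (∑ σ : Fin p → SignType, (∏ j, ρ j (σ j)) * (∑ j, if σ j = 0 then c j else 0)) -
        (∑ σ : Fin p → SignType, (∏ j, ρ j (σ j)) * R σ) / 2 := by
    nth_rewrite 2 [← sum_prod_eq_one hρ]
    rw [Finset.sum_div, ← Finset.sum_sub_distrib, ← Finset.sum_sub_distrib]
    exact Finset.sum_congr rfl fun σ _ => by ring
  rw [e6, e2, e3] at hsum
  linarith

theorem mixRatio_nonneg (h0 : 0 ≤ h) (h1 : h ≤ 1) : 0 ≤ mixRatio h w y :=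
  Finset.sum_nonneg fun _ _ => mul_nonneg
    (Finset.prod_nonneg fun _ _ => signWeight_nonneg h0 h1 _) (expTilt_pos _ _).le

/-- The pointwise restriction `h * coshTrunc < 1` is removed by the size of the constant. If the sum
of squares is at most `1 / 16`, each centred term is at most `1 / 4`, so `h * coshTrunc ≤ 1 / 2`;
otherwise `18 / 16 > 1` makes the left side negative. -/
theorem le_min_one_mixRatio (h0 : 0 ≤ h) (h1 : h ≤ 1 / 4) :
    1 - |∑ j, h * (coshTrunc T (w j) y - 1)| - 18 * ∑ j, (h * (coshTrunc T (w j) y - 1)) ^ 2 -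
      (∑ j, (h * sinhTrunc T (w j) y) • w j) ⬝ᵥ (∑ j, (h * sinhTrunc T (w j) y) • w j) / 2 ≤
      min 1 (mixRatio h w y) := by
  have hA : 0 ≤ (∑ j, (h * sinhTrunc T (w j) y) • w j) ⬝ᵥ (∑ j, (h * sinhTrunc T (w j) y) • w j) :=
    Finset.sum_nonneg fun i _ => mul_self_nonneg _
  have hB : 0 ≤ ∑ j, (h * (coshTrunc T (w j) y - 1)) ^ 2 := Finset.sum_nonneg fun i _ => sq_nonneg _
  have hC := abs_nonneg (∑ j, h * (coshTrunc T (w j) y - 1))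
  have hD := neg_abs_le (∑ j, h * (coshTrunc T (w j) y - 1))
  refine le_min (by linarith) ?_
  by_cases hU : ∑ j, (h * (coshTrunc T (w j) y - 1)) ^ 2 ≤ 1 / 16
  · have hw : ∀ j, h * coshTrunc T (w j) y < 1 := fun j => by
      have h2 : (h * (coshTrunc T (w j) y - 1)) ^ 2 ≤ 1 / 16 :=
        (Finset.single_le_sum (f := fun j => (h * (coshTrunc T (w j) y - 1)) ^ 2)
          (fun i _ => sq_nonneg _) (Finset.mem_univ j)).trans hU
      nlinarith
    have := le_mixRatio h0 (by linarith) hw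
    linarith
  · have := mixRatio_nonneg (w := w) (y := y) h0 (by linarith)
    push Not at hU
    linarith

end gibbs

/-! ### Averaging the lower bound over the Gaussian noise. -/

theorem cosh_sub_one_le_sq {x : ℝ} (hx : |x| ≤ 1) : Real.cosh x - 1 ≤ x ^ 2 := by
  have h1 := Real.abs_exp_sub_one_sub_id_le hx
  have h2 := Real.abs_exp_sub_one_sub_id_le (x := -x) (by rwa [abs_neg])
  rw [abs_le] at h1 h2
  rw [Real.cosh_eq]
  linarith [h1.2, h2.2, neg_sq x]

theorem mul_sinh_le {x : ℝ} (hx : |x| ≤ 1) : x * Real.sinh x ≤ 2 * x ^ 2 := by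
  have h1 := Real.abs_exp_sub_one_le hx
  have h2 := Real.abs_exp_sub_one_le (x := -x) (by rwa [abs_neg])
  rw [abs_neg] at h2
  have h3 : |Real.sinh x| ≤ 2 * |x| := by
    rw [Real.sinh_eq, show (Real.exp x - Real.exp (-x)) / 2 =
      ((Real.exp x - 1) - (Real.exp (-x) - 1)) / 2 by ring, abs_div, abs_two]
    have := abs_sub (Real.exp x - 1) (Real.exp (-x) - 1)
    linarith
  calc x * Real.sinh x ≤ |x * Real.sinh x| := le_abs_self _
    _ = |x| * |Real.sinh x| := abs_mul _ _
    _ ≤ |x| * (2 * |x|) := mul_le_mul_of_nonneg_left h3 (abs_nonneg _)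
    _ = 2 * x ^ 2 := by rw [← sq_abs x]; ring

/-- Sum of the squared off-diagonal entries of the Gram matrix. -/
noncomputable def gramOffDiag {n p : ℕ} (w : Fin p → Fin n → ℝ) : ℝ :=
  ∑ j, ∑ l, if j = l then 0 else (w j ⬝ᵥ w l) ^ 2

/-- A double sum is bounded through separate bounds on and off the diagonal. -/
theorem sum_sum_le_of_offDiag {n p : ℕ} {w : Fin p → Fin n → ℝ} {a : Fin p → Fin p → ℝ}
    {C Q D : ℝ} (hQ : 0 ≤ Q) (hdiag : ∀ j, a j j ≤ D)
    (hoff : ∀ j l, j ≠ l → a j l ≤ C * (w j ⬝ᵥ w l) ^ 2 + Q) :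
    ∑ j, ∑ l, a j l ≤ C * gramOffDiag w + (p : ℝ) ^ 2 * Q + p * D := by
  have h : ∀ j l, a j l ≤
      C * (if j = l then 0 else (w j ⬝ᵥ w l) ^ 2) + Q + if j = l then D else 0 := by
    intro j l
    split_ifs with hjl
    · subst hjl; linarith [hdiag j]
    · linarith [hoff j l hjl]
  refine (Finset.sum_le_sum fun j _ => Finset.sum_le_sum fun l _ => h j l).trans (le_of_eq ?_)
  simp only [Finset.sum_add_distrib, ← Finset.mul_sum, gramOffDiag]
  simp
  ring

theorem measurable_mixRatio {n p : ℕ} (h : ℝ) (w : Fin p → Fin n → ℝ) : Measurable (mixRatio h w) :=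
  Finset.measurable_sum _ fun _ _ => (measurable_expTilt _).const_mul _

/-- Lower bound for the expected truncated mixture likelihood ratio at fixed directions. -/
theorem le_integral_min_one_mixRatio {n p : ℕ} {h T q Q D M H₀ ε : ℝ} {w : Fin p → Fin n → ℝ}
    (h0 : 0 ≤ h) (h1 : h ≤ 1 / 4) (hε : 0 < ε) (hH₀ : 0 < H₀) (hQ : 0 ≤ Q)
    (hdiag : ∀ j, H₀ ≤ w j ⬝ᵥ w j) (hoff : ∀ j l, j ≠ l → |w j ⬝ᵥ w l| ≤ 1)
    (hq : ∀ j, ∫ y, coshTail T (w j) y ∂(stdNormal n) ≤ q)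
    (hQ2 : ∀ j l, j ≠ l → ∫ y, coshTail T (w j) y * coshTail T (w l) y ∂(stdNormal n) ≤ Q)
    (hD : ∀ j, ∫ y, (coshTrunc T (w j) y - 1) ^ 2 ∂(stdNormal n) ≤ D)
    (hM : ∀ j, w j ⬝ᵥ w j * ∫ y, sinhTrunc T (w j) y ^ 2 ∂(stdNormal n) ≤ M) :
    1 - ε - (1 / ε + 19) * (h ^ 2 * ((2 + q / H₀) * gramOffDiag w + (p : ℝ) ^ 2 * Q + p * D + p * M)) ≤
      ∫ y, min 1 (mixRatio h w y) ∂(stdNormal n) := by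
  -- Without coordinates the mixture ratio is identically one; otherwise an index exists, from which
  -- `q`, `D` and `M` are seen to be nonnegative.
  rcases Nat.eq_zero_or_pos p with rfl | hp
  · have : mixRatio h w = fun _ => 1 := by
      ext y; simp [mixRatio, expTilt, signComb]
    simp [this, gramOffDiag, hε.le]
  have hpos : ∀ j, 0 < w j ⬝ᵥ w j := fun j => hH₀.trans_le (hdiag j)
  have hq0 : 0 ≤ q := (integral_nonneg fun y => coshTail_nonneg T (w ⟨0, hp⟩) y).trans (hq _)
  have hD0 : 0 ≤ D := (integral_nonneg fun y => sq_nonneg _).trans (hD ⟨0, hp⟩)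
  have hM0 : 0 ≤ M := (mul_nonneg (hpos ⟨0, hp⟩).le (integral_nonneg fun y => sq_nonneg _)).trans (hM ⟨0, hp⟩)
  have hS0 : 0 ≤ gramOffDiag w := Finset.sum_nonneg fun j _ => Finset.sum_nonneg fun l _ => by
    split_ifs
    · exact le_rfl
    · exact sq_nonneg _
  have hc : ∀ j, MemLp (fun y => coshTrunc T (w j) y - 1) 2 (stdNormal n) := fun j =>
    (memLp_coshTrunc T (w j)).sub (memLp_const 1)
  have ic : ∀ j l, Integrable (fun y => (coshTrunc T (w j) y - 1) * (coshTrunc T (w l) y - 1))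
    (stdNormal n) := fun j l => integrable_mul_of_memLp_two (hc j) (hc l)
  have is : ∀ j l, Integrable (fun y => sinhTrunc T (w j) y * sinhTrunc T (w l) y)
    (stdNormal n) := fun j l =>
      integrable_mul_of_memLp_two (memLp_sinhTrunc T (w j)) (memLp_sinhTrunc T (w l))
  -- the linear term
  have eA : (fun y => (∑ j, h * (coshTrunc T (w j) y - 1)) ^ 2) = fun y =>
      h ^ 2 * ∑ j, ∑ l, (coshTrunc T (w j) y - 1) * (coshTrunc T (w l) y - 1) := by
    ext y
    rw [← Finset.mul_sum, mul_pow, sq (∑ j, _), Finset.sum_mul_sum]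
  have iA : Integrable (fun y => (∑ j, h * (coshTrunc T (w j) y - 1)) ^ 2) (stdNormal n) := by
    rw [eA]
    exact (integrable_finsetSum _ fun j _ => integrable_finsetSum _ fun l _ => ic j l).const_mul _
  have bA : ∫ y, (∑ j, h * (coshTrunc T (w j) y - 1)) ^ 2 ∂(stdNormal n) ≤
      h ^ 2 * ((1 + q / H₀) * gramOffDiag w + (p : ℝ) ^ 2 * Q + p * D) := by
    rw [eA, integral_const_mul, integral_finsetSum _ fun j _ => integrable_finsetSum _ fun l _ => ic j l]
    simp only [integral_finsetSum _ fun l _ => ic _ l]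
    refine mul_le_mul_of_nonneg_left (sum_sum_le_of_offDiag hQ (fun j => ?_) fun j l hjl => ?_)
      (sq_nonneg h)
    · simpa only [sq] using hD j
    · refine (integral_coshTrunc_sub_one_mul_le (hpos j) (hpos l)).trans ?_
      have k1 := cosh_sub_one_le_sq (hoff j l hjl)
      have k2 : ∀ i, (w j ⬝ᵥ w l) ^ 2 / (2 * (w i ⬝ᵥ w i)) * ∫ y, coshTail T (w i) y ∂(stdNormal n) ≤
          (w j ⬝ᵥ w l) ^ 2 * (q / H₀) / 2 := fun i => by
        have : (w j ⬝ᵥ w l) ^ 2 / (2 * (w i ⬝ᵥ w i)) ≤ (w j ⬝ᵥ w l) ^ 2 / (2 * H₀) := by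
          have := hdiag i
          gcongr
        refine (mul_le_mul this (hq i) (integral_nonneg fun y => coshTail_nonneg T (w i) y)
          (by positivity)).trans (le_of_eq ?_)
        field_simp
      linarith [k2 j, k2 l, hQ2 j l hjl]
  -- the quadratic term
  have iB : Integrable (fun y => ∑ j, (h * (coshTrunc T (w j) y - 1)) ^ 2) (stdNormal n) :=
    integrable_finsetSum _ fun j _ => ((hc j).const_mul h).integrable_sq
  have bB : ∫ y, ∑ j, (h * (coshTrunc T (w j) y - 1)) ^ 2 ∂(stdNormal n) ≤ h ^ 2 * (p * D) := by
    rw [integral_finsetSum _ fun j _ => ((hc j).const_mul h).integrable_sq]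
    refine (Finset.sum_le_sum (g := fun _ => h ^ 2 * D) fun j _ => ?_).trans (le_of_eq ?_)
    · simp only [mul_pow]
      rw [integral_const_mul]
      exact mul_le_mul_of_nonneg_left (hD j) (sq_nonneg h)
    · simp; ring
  -- the interaction term
  have eC : (fun y => (∑ j, (h * sinhTrunc T (w j) y) • w j) ⬝ᵥ (∑ j, (h * sinhTrunc T (w j) y) • w j)) =
      fun y => h ^ 2 * ∑ j, ∑ l, (w j ⬝ᵥ w l) * (sinhTrunc T (w j) y * sinhTrunc T (w l) y) := by
    ext y
    rw [sum_smul_dotProduct_self]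
    simp only [Finset.mul_sum]
    exact Finset.sum_congr rfl fun j _ => Finset.sum_congr rfl fun l _ => by ring
  have is' : ∀ j l, Integrable (fun y => (w j ⬝ᵥ w l) * (sinhTrunc T (w j) y * sinhTrunc T (w l) y))
    (stdNormal n) := fun j l => (is j l).const_mul _
  have iC : Integrable (fun y =>
      (∑ j, (h * sinhTrunc T (w j) y) • w j) ⬝ᵥ (∑ j, (h * sinhTrunc T (w j) y) • w j)) (stdNormal n) := by
    rw [eC]
    exact (integrable_finsetSum _ fun j _ => integrable_finsetSum _ fun l _ => is' j l).const_mul _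
  have bC : ∫ y, (∑ j, (h * sinhTrunc T (w j) y) • w j) ⬝ᵥ (∑ j, (h * sinhTrunc T (w j) y) • w j)
      ∂(stdNormal n) ≤ h ^ 2 * (2 * gramOffDiag w + (p : ℝ) ^ 2 * Q + p * M) := by
    rw [eC, integral_const_mul, integral_finsetSum _ fun j _ => integrable_finsetSum _ fun l _ => is' j l]
    simp only [integral_finsetSum _ fun l _ => is' _ l]
    refine mul_le_mul_of_nonneg_left (sum_sum_le_of_offDiag hQ (fun j => ?_) fun j l hjl => ?_)
      (sq_nonneg h)
    · rw [integral_const_mul]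
      simpa only [sq] using hM j
    · rw [integral_const_mul]
      refine (mul_integral_sinhTrunc_mul_le (hpos j) (hpos l)).trans ?_
      have k1 := mul_sinh_le (hoff j l hjl)
      have k2 : |w j ⬝ᵥ w l| * ∫ y, coshTail T (w j) y * coshTail T (w l) y ∂(stdNormal n) ≤ 1 * Q :=
        mul_le_mul (hoff j l hjl) (hQ2 j l hjl) (integral_nonneg fun y =>
          mul_nonneg (coshTail_nonneg T (w j) y) (coshTail_nonneg T (w l) y)) zero_le_one
      linarith
  have hmin : ∀ y, 1 - ε - 1 / ε * (∑ j, h * (coshTrunc T (w j) y - 1)) ^ 2 -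
      18 * ∑ j, (h * (coshTrunc T (w j) y - 1)) ^ 2 -
      1 / 2 * ((∑ j, (h * sinhTrunc T (w j) y) • w j) ⬝ᵥ (∑ j, (h * sinhTrunc T (w j) y) • w j)) ≤
      min 1 (mixRatio h w y) := fun y => by
    refine le_trans ?_ (le_min_one_mixRatio (T := T) h0 h1)
    -- The elementary `a ≤ ε + a² / ε` trades the absolute value for a second moment.
    have : |∑ j, h * (coshTrunc T (w j) y - 1)| ≤
        ε + 1 / ε * (∑ j, h * (coshTrunc T (w j) y - 1)) ^ 2 := by
      rw [← sq_abs (∑ j, h * (coshTrunc T (w j) y - 1))]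
      set a := |∑ j, h * (coshTrunc T (w j) y - 1)|
      have h2 : 0 ≤ (a / ε - 1) ^ 2 * ε + a := by positivity
      have h3 : (a / ε - 1) ^ 2 * ε + a = ε + 1 / ε * a ^ 2 - a := by field_simp; ring
      linarith
    linarith
  have imin : Integrable (fun y => min 1 (mixRatio h w y)) (stdNormal n) := by
    refine Integrable.of_bound (measurable_const.min (measurable_mixRatio h w)).aestronglyMeasurable 1
      (Eventually.of_forall fun y => ?_)
    have := mixRatio_nonneg (w := w) (y := y) h0 (by linarith)
    rw [Real.norm_eq_abs, abs_of_nonneg (le_min zero_le_one this)]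
    exact min_le_left _ _
  have j1 := iA.const_mul (1 / ε)
  have j2 := iB.const_mul 18
  have j3 := iC.const_mul (1 / 2)
  have j0 : Integrable (fun _ : Fin n → ℝ => 1 - ε) (stdNormal n) := integrable_const _
  have hint := integral_mono (((j0.fun_sub j1).fun_sub j2).fun_sub j3) imin hmin
  rw [integral_sub ((j0.fun_sub j1).fun_sub j2) j3, integral_sub (j0.fun_sub j1) j2,
    integral_sub j0 j1, integral_const_mul, integral_const_mul, integral_const_mul] at hint
  simp only [integral_const, probReal_univ, one_smul] at hint
  refine le_trans ?_ hint
  -- The three bounds enter with weights `1 / ε`, `18` and `1 / 2`, all absorbed in the common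
  -- factor `1 / ε + 19`.
  have hεi : 0 < 1 / ε := by positivity
  have t1 := mul_le_mul_of_nonneg_left bA hεi.le
  have hh := sq_nonneg h
  have p1 : 0 ≤ h ^ 2 * gramOffDiag w := by positivity
  have p2 : 0 ≤ h ^ 2 * (q / H₀ * gramOffDiag w) := by positivity
  have p3 : 0 ≤ h ^ 2 * ((p : ℝ) ^ 2 * Q) := by positivity
  have p4 : 0 ≤ h ^ 2 * (p * D) := by positivity
  have p5 : 0 ≤ h ^ 2 * (p * M) := by positivity
  have q1 : 0 ≤ 1 / ε * (h ^ 2 * gramOffDiag w) := by positivity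
  have q5 : 0 ≤ 1 / ε * (h ^ 2 * (p * M)) := by positivity
  nlinarith


/-! ### From the minimax error to the mixture ratio. -/

/-- The columns of the design, scaled by `b`. -/
def scaledCols {n p : ℕ} (b : ℝ) (X : Design n p) (j : Fin p) : Fin n → ℝ := fun i => b * X i j

/-- The parameter with coordinates `b * σ j`. -/
noncomputable def signParam {p : ℕ} (b : ℝ) (σ : Fin p → SignType) : EuclideanSpace ℝ (Fin p) :=
  WithLp.toLp 2 fun j => b * (σ j : ℝ)

/-- Prior mass of the sign patterns whose parameter is outside the alternative. -/
noncomputable def priorMassOutside (p : ℕ) (k r h b : ℝ) : ℝ :=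
  open Classical in
  ∑ σ : Fin p → SignType, if signParam b σ ∈ sparseAlt p k r then 0 else ∏ j, signWeight h (σ j)

section
variable {n p : ℕ} {PX : Measure (Design n p)} [IsProbabilityMeasure PX]

theorem signComb_scaledCols (b : ℝ) (X : Design n p) (σ : Fin p → SignType) (i : Fin n) :
    signComb (scaledCols b X) σ i = ∑ j, signParam b σ j * X i j := by
  simp only [signComb, scaledCols, signParam, Finset.sum_apply, Pi.smul_apply, smul_eq_mul]
  exact Finset.sum_congr rfl fun j _ => by ring

theorem measurable_shift (θ : EuclideanSpace ℝ (Fin p)) :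
    Measurable fun w : Design n p × (Fin n → ℝ) =>
      (w.1, fun i => ∑ j, θ j * w.1 i j + w.2 i) := by
  fun_prop

theorem measurable_shift_right (ψ : Test n p) (θ : EuclideanSpace ℝ (Fin p)) :
    Measurable fun w : Design n p × (Fin n → ℝ) =>
      ψ.toFun (w.1, fun i => ∑ j, θ j * w.1 i j + w.2 i) :=
  ψ.measurable_toFun.comp (measurable_shift θ)

theorem integrable_of_mem_Icc {Ω : Type*} [MeasurableSpace Ω] {μ : Measure Ω} [IsFiniteMeasure μ]
    {f : Ω → ℝ} (hf : Measurable f) (h : ∀ x, f x ∈ Set.Icc (0 : ℝ) 1) : Integrable f μ :=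
  Integrable.of_bound hf.aestronglyMeasurable 1 (Eventually.of_forall fun x => by
    rw [Real.norm_eq_abs, abs_of_nonneg (h x).1]; exact (h x).2)

theorem Test.measurable_one_sub (ψ : Test n p) : Measurable fun z => 1 - ψ.toFun z :=
  measurable_const.sub ψ.measurable_toFun

theorem Test.one_sub_mem_Icc (ψ : Test n p) (z : Obs n p) : 1 - ψ.toFun z ∈ Set.Icc (0 : ℝ) 1 :=
  ⟨sub_nonneg.2 (ψ.mem_Icc z).2, by linarith [(ψ.mem_Icc z).1]⟩

theorem integrable_one_sub_shift (ψ : Test n p) (θ : EuclideanSpace ℝ (Fin p)) :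
    Integrable (fun w : Design n p × (Fin n → ℝ) =>
      1 - ψ.toFun (w.1, fun i => ∑ j, θ j * w.1 i j + w.2 i)) (PX.prod (stdNormal n)) :=
  integrable_of_mem_Icc (ψ.measurable_one_sub.comp (measurable_shift θ)) fun _ => ψ.one_sub_mem_Icc _

theorem integral_one_sub_mul_expTilt (ψ : Test n p) (θ : EuclideanSpace ℝ (Fin p)) (X : Design n p) :
    ∫ y, (1 - ψ.toFun (X, y)) * expTilt (fun i => ∑ j, θ j * X i j) y ∂(stdNormal n) =
      ∫ y, (1 - ψ.toFun (X, fun i => ∑ j, θ j * X i j + y i)) ∂(stdNormal n) := by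
  rw [integral_mul_expTilt _ fun y => 1 - ψ.toFun (X, y)]
  refine integral_congr_ae (Eventually.of_forall fun y => ?_)
  have : (y + fun i => ∑ j, θ j * X i j) = fun i => ∑ j, θ j * X i j + y i := by
    ext i; simp [add_comm]
  dsimp only
  rw [this]

theorem typeI_eq (ψ : Test n p) :
    typeI PX ψ = ∫ X, ∫ y, ψ.toFun (X, y) ∂(stdNormal n) ∂PX := by
  unfold typeI obsLaw
  rw [integral_map (measurable_shift 0).aemeasurable ψ.measurable_toFun.aestronglyMeasurable,
    integral_prod _ (integrable_of_mem_Icc (measurable_shift_right ψ 0) fun _ => ψ.mem_Icc _)]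
  simp [stdNormal]

theorem typeII_eq (ψ : Test n p) (θ : EuclideanSpace ℝ (Fin p)) :
    typeII PX ψ θ = ∫ X, ∫ y, (1 - ψ.toFun (X, y)) *
      expTilt (fun i => ∑ j, θ j * X i j) y ∂(stdNormal n) ∂PX := by
  unfold typeII obsLaw
  rw [integral_map (measurable_shift θ).aemeasurable ψ.measurable_one_sub.aestronglyMeasurable]
  exact (integral_prod _ (integrable_one_sub_shift ψ θ)).trans (integral_congr_ae
    (Eventually.of_forall fun X => (integral_one_sub_mul_expTilt ψ θ X).symm))

theorem typeII_mem_Icc (ψ : Test n p) (θ : EuclideanSpace ℝ (Fin p)) :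
    typeII PX ψ θ ∈ Set.Icc (0 : ℝ) 1 := by
  unfold typeII obsLaw
  rw [integral_map (measurable_shift θ).aemeasurable ψ.measurable_one_sub.aestronglyMeasurable]
  refine ⟨integral_nonneg fun _ => (ψ.one_sub_mem_Icc _).1, ?_⟩
  refine (integral_mono (g := fun _ => (1 : ℝ)) (integrable_one_sub_shift ψ θ) (integrable_const 1)
    fun w => (ψ.one_sub_mem_Icc _).2).trans ?_
  simp

omit [IsProbabilityMeasure PX] in
theorem typeI_nonneg (ψ : Test n p) : 0 ≤ typeI PX ψ :=
  integral_nonneg fun _ => (ψ.mem_Icc _).1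

theorem bddAbove_typeII (ψ : Test n p) (Θ : Set (EuclideanSpace ℝ (Fin p))) :
    BddAbove (Set.range fun θ : Θ => typeII PX ψ θ) :=
  ⟨1, by rintro _ ⟨θ, rfl⟩; exact (typeII_mem_Icc ψ _).2⟩

theorem iSup_typeII_nonneg (ψ : Test n p) (Θ : Set (EuclideanSpace ℝ (Fin p))) :
    0 ≤ ⨆ θ : Θ, typeII PX ψ θ :=
  Real.iSup_nonneg fun _ => (typeII_mem_Icc ψ _).1

theorem minimaxError_le_one (k r : ℝ) : minimaxError PX k r ≤ 1 := by
  have h : totalError PX ⟨fun _ => 1, measurable_const, fun _ => by simp⟩ (sparseAlt p k r) = 1 := by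
    have : IsProbabilityMeasure (obsLaw PX 0) :=
      Measure.isProbabilityMeasure_map (measurable_shift 0).aemeasurable
    simp [totalError, typeI, typeII]
  rw [← h]
  exact ciInf_le ⟨0, by rintro _ ⟨ψ, rfl⟩; exact add_nonneg (typeI_nonneg ψ) (iSup_typeII_nonneg ψ _)⟩ _

theorem measurable_mixRatio_prod (h b : ℝ) :
    Measurable fun z : Design n p × (Fin n → ℝ) => mixRatio h (scaledCols b z.1) z.2 := by
  unfold mixRatio expTilt dotProduct
  simp only [signComb_scaledCols]
  fun_prop

theorem min_one_mixRatio_mem_Icc {h : ℝ} (h0 : 0 ≤ h) (h1 : h ≤ 1) (w : Fin p → Fin n → ℝ)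
    (y : Fin n → ℝ) : min 1 (mixRatio h w y) ∈ Set.Icc (0 : ℝ) 1 :=
  ⟨le_min zero_le_one (mixRatio_nonneg h0 h1), min_le_left _ _⟩

theorem integrable_integral_min_one_mixRatio {h : ℝ} (h0 : 0 ≤ h) (h1 : h ≤ 1) (b : ℝ) :
    Integrable (fun X => ∫ y, min 1 (mixRatio h (scaledCols b X) y) ∂(stdNormal n)) PX :=
  (integrable_of_mem_Icc (μ := PX.prod (stdNormal n))
    (measurable_const.min (measurable_mixRatio_prod (n := n) (p := p) h b))
    fun _ => min_one_mixRatio_mem_Icc h0 h1 _ _).integral_prod_left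

/-- The supremum of the type II error dominates its prior average up to the mass outside the
alternative, because type II errors are at most one. The averaged error is the null mean of `ψ + (1
- ψ) L`. -/
theorem le_minimaxError {h : ℝ} (h0 : 0 ≤ h) (h1 : h ≤ 1) (k r b : ℝ) :
    ∫ X, ∫ y, min 1 (mixRatio h (scaledCols b X) y) ∂(stdNormal n) ∂PX -
      priorMassOutside p k r h b ≤ minimaxError PX k r := by
  classical
  have : Nonempty (Test n p) := ⟨⟨fun _ => 1, measurable_const, fun _ => by simp⟩⟩
  refine le_ciInf fun ψ => ?_
  set B := ⨆ θ : sparseAlt p k r, typeII PX ψ θ with hB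
  have hB0 : 0 ≤ B := iSup_typeII_nonneg ψ _
  have hπ0 : ∀ σ : Fin p → SignType, 0 ≤ ∏ j, signWeight h (σ j) := fun σ =>
    Finset.prod_nonneg fun j _ => signWeight_nonneg h0 h1 _
  have hπ1 : ∑ σ : Fin p → SignType, ∏ j, signWeight h (σ j) = 1 :=
    sum_prod_eq_one fun _ => sum_signWeight h
  have hmix : ∑ σ : Fin p → SignType, (∏ j, signWeight h (σ j)) * typeII PX ψ (signParam b σ) ≤
      B + priorMassOutside p k r h b := by
    have : ∀ σ : Fin p → SignType, (∏ j, signWeight h (σ j)) * typeII PX ψ (signParam b σ) ≤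
        (∏ j, signWeight h (σ j)) * B +
          if signParam b σ ∈ sparseAlt p k r then 0 else ∏ j, signWeight h (σ j) := fun σ => by
      split_ifs with hσ
      · rw [add_zero]
        exact mul_le_mul_of_nonneg_left (le_ciSup (bddAbove_typeII ψ _) ⟨_, hσ⟩) (hπ0 σ)
      · nlinarith [hπ0 σ, (typeII_mem_Icc (PX := PX) ψ (signParam b σ)).2, mul_nonneg (hπ0 σ) hB0]
    refine (Finset.sum_le_sum fun σ _ => this σ).trans (le_of_eq ?_)
    rw [Finset.sum_add_distrib, ← Finset.sum_mul, hπ1, one_mul, priorMassOutside]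
  suffices hs : ∫ X, ∫ y, min 1 (mixRatio h (scaledCols b X) y) ∂(stdNormal n) ∂PX ≤
      typeI PX ψ + ∑ σ : Fin p → SignType,
        (∏ j, signWeight h (σ j)) * typeII PX ψ (signParam b σ) by
    change _ ≤ typeI PX ψ + B
    linarith
  have hcols : ∀ (X : Design n p) (σ : Fin p → SignType),
      (fun i => ∑ j, signParam b σ j * X i j) = signComb (scaledCols b X) σ := fun X σ => by
    ext i; rw [signComb_scaledCols]
  simp only [typeI_eq, typeII_eq, hcols]
  have iψ : Integrable (fun X => ∫ y, ψ.toFun (X, y) ∂(stdNormal n)) PX :=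
    (integrable_of_mem_Icc (μ := PX.prod (stdNormal n)) ψ.measurable_toFun
      fun _ => ψ.mem_Icc _).integral_prod_left
  have ifib : ∀ (X : Design n p) (σ : Fin p → SignType), Integrable
      (fun y => (1 - ψ.toFun (X, y)) * expTilt (signComb (scaledCols b X) σ) y) (stdNormal n) :=
    fun X σ => by
      rw [integrable_mul_expTilt_iff _ fun y => 1 - ψ.toFun (X, y)]
      have hm : Measurable fun y : Fin n → ℝ => (X, y + signComb (scaledCols b X) σ) := by fun_prop
      exact integrable_of_mem_Icc (ψ.measurable_one_sub.comp hm) fun _ => ψ.one_sub_mem_Icc _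
  have iσ : ∀ σ : Fin p → SignType, Integrable (fun X => ∫ y, (1 - ψ.toFun (X, y)) *
      expTilt (signComb (scaledCols b X) σ) y ∂(stdNormal n)) PX := fun σ =>
    (integrable_one_sub_shift ψ (signParam b σ)).integral_prod_left.congr
      (Eventually.of_forall fun X => by
        have := integral_one_sub_mul_expTilt ψ (signParam b σ) X
        rw [hcols] at this
        exact this.symm)
  simp only [← integral_const_mul]
  rw [← integral_finsetSum _ fun σ _ => by simpa only [integral_const_mul] using (iσ σ).const_mul _,
    ← integral_add iψ (integrable_finsetSum _ fun σ _ => by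
      simpa only [integral_const_mul] using (iσ σ).const_mul _)]
  refine integral_mono (integrable_integral_min_one_mixRatio h0 h1 b)
    (iψ.add (integrable_finsetSum _ fun σ _ => by
      simpa only [integral_const_mul] using (iσ σ).const_mul _)) fun X => ?_
  dsimp only [Pi.add_apply]
  have iψX : Integrable (fun y => ψ.toFun (X, y)) (stdNormal n) := by
    have := ψ.measurable_toFun
    exact integrable_of_mem_Icc (by fun_prop) fun _ => ψ.mem_Icc _
  rw [← integral_finsetSum _ fun σ _ => (ifib X σ).const_mul _,
    ← integral_add iψX (integrable_finsetSum _ fun σ _ => (ifib X σ).const_mul _)]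
  refine integral_mono (integrable_of_mem_Icc (measurable_const.min (measurable_mixRatio h _))
    fun _ => min_one_mixRatio_mem_Icc h0 h1 _ _)
    (iψX.add (integrable_finsetSum _ fun σ _ => (ifib X σ).const_mul _)) fun y => ?_
  dsimp only [Pi.add_apply]
  have e : ∑ σ : Fin p → SignType, (∏ j, signWeight h (σ j)) *
      ((1 - ψ.toFun (X, y)) * expTilt (signComb (scaledCols b X) σ) y) =
      (1 - ψ.toFun (X, y)) * mixRatio h (scaledCols b X) y := by
    rw [mixRatio, Finset.mul_sum]
    exact Finset.sum_congr rfl fun σ _ => by ring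
  rw [e]
  -- A convex combination of `1` and the mixture ratio is at least their minimum.
  have hψ := ψ.mem_Icc (X, y)
  have m1 := min_le_left 1 (mixRatio h (scaledCols b X) y)
  have m2 := min_le_right 1 (mixRatio h (scaledCols b X) y)
  nlinarith [mul_le_mul_of_nonneg_left m1 hψ.1, mul_le_mul_of_nonneg_left m2 (sub_nonneg.2 hψ.2)]

end

/-! ### Concentration of the prior on the alternative. -/

/-- Number of nonzero signs. -/
noncomputable def signCount {p : ℕ} (σ : Fin p → SignType) : ℝ :=
  ∑ j, if σ j = 0 then (0 : ℝ) else 1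

theorem numNonzero_signParam {p : ℕ} {b : ℝ} (hb : b ≠ 0) (σ : Fin p → SignType) :
    (numNonzero (signParam b σ) : ℝ) = signCount σ := by
  have : ∀ j, (signParam b σ j ≠ 0) ↔ ¬ σ j = 0 := fun j => by
    rcases h : σ j <;> simp [signParam, h, hb]
  simp only [numNonzero, this, signCount]
  rw [Nat.card_eq_fintype_card, Fintype.card_subtype, Finset.card_filter]
  push_cast
  exact Finset.sum_congr rfl fun j _ => by split_ifs <;> simp_all

theorem norm_signParam_sq {p : ℕ} (b : ℝ) (σ : Fin p → SignType) :
    ‖signParam b σ‖ ^ 2 = b ^ 2 * signCount σ := by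
  rw [EuclideanSpace.norm_sq_eq, signCount, Finset.mul_sum]
  refine Finset.sum_congr rfl fun j _ => ?_
  rcases h : σ j <;> simp [signParam, h]

theorem sum_signWeight_mul_signCount_sub_sq {p : ℕ} (h : ℝ) :
    ∑ σ : Fin p → SignType, (∏ j, signWeight h (σ j)) * (signCount σ - p * h) ^ 2 =
      p * (h * (1 - h)) := by
  set f : SignType → ℝ := fun s => (if s = 0 then (0 : ℝ) else 1) - h with hf
  have e : ∀ σ : Fin p → SignType, (signCount σ - p * h) ^ 2 = ∑ j, ∑ l, f (σ j) * f (σ l) := by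
    intro σ
    have : signCount σ - p * h = ∑ j, f (σ j) := by
      simp [hf, signCount, Finset.sum_sub_distrib]
    rw [this, sq, Finset.sum_mul_sum]
  simp only [e, Finset.mul_sum]
  rw [Finset.sum_comm]
  have hw : ∀ j : Fin p, ∑ s, signWeight h s = 1 := fun _ => sum_signWeight h
  have key : ∀ i l : Fin p, ∑ σ : Fin p → SignType, (∏ j, signWeight h (σ j)) * (f (σ i) * f (σ l)) =
      if i = l then h * (1 - h) else 0 := by
    intro i l
    split_ifs with hil
    · subst hil
      have := sum_prod_mul_apply hw i fun s => f s * f s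
      rw [this, sum_signType]
      simp [hf, signWeight]; ring
    · have := sum_prod_mul_apply_mul_apply hw hil f f
      rw [this, sum_signType]
      simp [hf, signWeight]
      ring
  have : ∀ i : Fin p, ∑ σ : Fin p → SignType, ∑ l, (∏ j, signWeight h (σ j)) * (f (σ i) * f (σ l)) =
      h * (1 - h) := fun i => by
    rw [Finset.sum_comm]
    simp [key]
  simp [this]

/-- Chebyshev for the number of nonzero signs, of mean `(1 - δ) k` and variance at most `k`. The
choices of `h` and `b` put a pattern in the alternative as soon as this number lies between `(1 -
2δ) k` and `k`, that is, within `δ k` of its mean. -/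
theorem priorMassOutside_le {p : ℕ} {k r δ : ℝ} (hk : 0 < k) (hr : 0 < r) (hδ : 0 < δ)
    (hδ2 : δ < 1 / 2) (hkp : k ≤ p) :
    priorMassOutside p k r ((1 - δ) * k / p) (r / √((1 - 2 * δ) * k)) ≤ 1 / (δ ^ 2 * k) := by
  classical
  have hp : (0 : ℝ) < p := hk.trans_le hkp
  have hc : 0 < (1 - 2 * δ) * k := by apply mul_pos <;> linarith
  set h := (1 - δ) * k / p with hh
  set b := r / √((1 - 2 * δ) * k) with hb
  have hb0 : 0 < b := div_pos hr (Real.sqrt_pos.2 hc)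
  have h0 : 0 ≤ h := by
    have : 0 ≤ 1 - δ := by linarith
    positivity
  have h1 : h ≤ 1 := by
    rw [hh, div_le_one hp]; nlinarith
  have hph : p * h = (1 - δ) * k := by rw [hh]; field_simp
  have hπ0 : ∀ σ : Fin p → SignType, 0 ≤ ∏ j, signWeight h (σ j) := fun σ =>
    Finset.prod_nonneg fun j _ => signWeight_nonneg h0 h1 _
  have step : ∀ σ : Fin p → SignType,
      (if signParam b σ ∈ sparseAlt p k r then 0 else ∏ j, signWeight h (σ j)) ≤
        1 / (δ * k) ^ 2 * ((∏ j, signWeight h (σ j)) * (signCount σ - p * h) ^ 2) := by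
    intro σ
    split_ifs with hσ
    · have := hπ0 σ; positivity
    have h2 : (δ * k) ^ 2 ≤ (signCount σ - p * h) ^ 2 := by
      by_contra hlt
      push Not at hlt
      have h3 := abs_lt_of_sq_lt_sq hlt (by positivity)
      rw [abs_lt, hph] at h3
      refine hσ ⟨?_, ?_⟩
      · rw [numNonzero_signParam hb0.ne']; linarith [h3.2]
      · refine (sq_le_sq₀ hr.le (norm_nonneg _)).1 ?_
        rw [norm_signParam_sq, hb, div_pow, Real.sq_sqrt hc.le, div_mul_eq_mul_div, le_div_iff₀ hc]
        refine mul_le_mul_of_nonneg_left ?_ (sq_nonneg r)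
        linarith [h3.1]
    have h4 : 1 ≤ 1 / (δ * k) ^ 2 * (signCount σ - p * h) ^ 2 := by
      rw [one_div, inv_mul_eq_div, one_le_div (by positivity)]
      exact h2
    calc ∏ j, signWeight h (σ j) ≤ (∏ j, signWeight h (σ j)) *
        (1 / (δ * k) ^ 2 * (signCount σ - p * h) ^ 2) := le_mul_of_one_le_right (hπ0 σ) h4
      _ = _ := by ring
  refine (Finset.sum_le_sum fun σ _ => step σ).trans ?_
  rw [← Finset.mul_sum, sum_signWeight_mul_signCount_sub_sq, ← mul_assoc (p : ℝ), hph]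
  have : (1 - δ) * k * (1 - h) ≤ k := by
    have : (1 - δ) * (1 - h) ≤ 1 := by nlinarith
    nlinarith
  calc 1 / (δ * k) ^ 2 * ((1 - δ) * k * (1 - h)) ≤ 1 / (δ * k) ^ 2 * k := by gcongr
    _ = 1 / (δ ^ 2 * k) := by field_simp


/-! ### Moments of sums of independent centred variables. -/

theorem exists_add_pow_le (m : ℕ) : ∃ c : ℝ, 0 ≤ c ∧ ∀ x y : ℝ, 0 ≤ x → |y| ≤ x →
    (x + y) ^ (m + 2) ≤ x ^ (m + 2) + (m + 2) * y * x ^ (m + 1) + c * (x ^ m * y ^ 2) := by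
  induction m with
  | zero => exact ⟨1, zero_le_one, fun x y _ _ => by norm_num; nlinarith⟩
  | succ m ih =>
    obtain ⟨c, hc, h⟩ := ih
    refine ⟨2 * c + (m + 2), by positivity, fun x y hx hy => ?_⟩
    have hy' := abs_le.1 hy
    have h1 := mul_le_mul_of_nonneg_right (h x y hx hy) (by linarith : 0 ≤ x + y)
    -- Multiplying by `x + y` creates a cubic remainder, which `y ≤ x` turns back into a quadratic
    -- one.
    have h2 : c * x ^ m * y ^ 2 * y ≤ c * x ^ m * y ^ 2 * x :=
      mul_le_mul_of_nonneg_left hy'.2 (by positivity)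
    calc (x + y) ^ (m + 1 + 2) = (x + y) ^ (m + 2) * (x + y) := by ring
      _ ≤ _ := h1
      _ ≤ _ := by push_cast; ring_nf at h2 ⊢; linarith

/-- A second-order Taylor bound for `|·| ^ (m + 2)`: for `|y| ≤ |x|` it is the binomial estimate,
for larger `|y|` the term `|y| ^ (m + 2)` dominates everything, and negative `x` follows by
symmetry. The linear term is kept exact because it averages to zero in the application. -/
theorem exists_abs_add_pow_le (m : ℕ) : ∃ c : ℝ, 0 ≤ c ∧ ∀ x y : ℝ,
    |x + y| ^ (m + 2) ≤ |x| ^ (m + 2) + (m + 2) * (y * (x * |x| ^ m)) +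
      c * (|x| ^ m * y ^ 2 + |y| ^ (m + 2)) := by
  obtain ⟨c, hc, h⟩ := exists_add_pow_le m
  refine ⟨c + 2 ^ (m + 2) + (m + 2), by positivity, fun x y => ?_⟩
  have hbig : ∀ x y : ℝ, 0 ≤ x → |x + y| ^ (m + 2) ≤ |x| ^ (m + 2) + (m + 2) * (y * (x * |x| ^ m)) +
      (c + 2 ^ (m + 2) + (m + 2)) * (|x| ^ m * y ^ 2 + |y| ^ (m + 2)) := by
    intro x y hx
    rcases le_total |y| |x| with hyx | hyx
    · rw [abs_of_nonneg hx] at hyx ⊢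
      have hy' := abs_le.1 hyx
      rw [abs_of_nonneg (by linarith : 0 ≤ x + y)]
      refine (h x y hx hyx).trans ?_
      have e : (m + 2) * y * x ^ (m + 1) = (m + 2) * (y * (x * x ^ m)) := by ring
      have h1 : c * (x ^ m * y ^ 2) ≤
          (c + 2 ^ (m + 2) + (m + 2)) * (x ^ m * y ^ 2 + |y| ^ (m + 2)) := by
        have a1 : 0 ≤ |y| ^ (m + 2) := by positivity
        have a2 : 0 ≤ x ^ m * y ^ 2 := by positivity
        refine mul_le_mul ?_ (by linarith) a2 (by positivity)
        have : (0:ℝ) ≤ 2 ^ (m + 2) + (m + 2) := by positivity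
        linarith
      rw [e]; linarith
    · have h1 : |x + y| ^ (m + 2) ≤ 2 ^ (m + 2) * |y| ^ (m + 2) := by
        rw [← mul_pow]
        exact pow_le_pow_left₀ (abs_nonneg _) ((abs_add_le x y).trans (by linarith)) _
      have h2 : -(y * (x * |x| ^ m)) ≤ |y| ^ (m + 2) := by
        refine (neg_le_abs _).trans ?_
        rw [abs_mul, abs_mul, abs_pow, abs_abs, pow_add, mul_comm]
        calc |x| * |x| ^ m * |y| ≤ |y| * |y| ^ m * |y| := by gcongr
          _ = _ := by ring
      have h3 : 0 ≤ |x| ^ (m + 2) := by positivity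
      have h4 : 0 ≤ |x| ^ m * y ^ 2 := by positivity
      have h5 : 0 ≤ |y| ^ (m + 2) := by positivity
      have h6 : (m + 2 : ℝ) * -(y * (x * |x| ^ m)) ≤ (m + 2) * |y| ^ (m + 2) :=
        mul_le_mul_of_nonneg_left h2 (by positivity)
      have h7 : 0 ≤ (c + 2 ^ (m + 2) + (m + 2)) * (|x| ^ m * y ^ 2) := by positivity
      have h8 : 0 ≤ c * |y| ^ (m + 2) := by positivity
      linarith
  rcases le_total 0 x with hx | hx
  · exact hbig x y hx
  · have := hbig (-x) (-y) (by linarith)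
    rw [← neg_add, abs_neg, abs_neg, abs_neg] at this
    simpa using this

theorem integral_sum_sq_le {ι Ω : Type*} [MeasurableSpace Ω] {μ : Measure Ω} [IsProbabilityMeasure μ]
    {W : ι → Ω → ℝ} {V : ℝ} (hi : iIndepFun W μ) (h2 : ∀ i, MemLp (W i) 2 μ)
    (h0 : ∀ i, ∫ ω, W i ω ∂μ = 0) (hV : ∀ i, ∫ ω, W i ω ^ 2 ∂μ ≤ V) (s : Finset ι) :
    ∫ ω, (∑ i ∈ s, W i ω) ^ 2 ∂μ ≤ V * s.card := by
  have hS : MemLp (∑ i ∈ s, W i) 2 μ := memLp_finsetSum' s fun i _ => h2 i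
  have hE : ∫ ω, (∑ i ∈ s, W i) ω ∂μ = 0 := by
    simp only [Finset.sum_apply]
    rw [integral_finsetSum _ fun i _ => (h2 i).integrable one_le_two]; simp [h0]
  have h3 := IndepFun.variance_sum (s := s) (fun i _ => h2 i) (fun i _ j _ hij => hi.indepFun hij)
  rw [variance_of_integral_eq_zero hS.aestronglyMeasurable.aemeasurable hE] at h3
  simp only [Finset.sum_apply] at h3
  rw [h3]
  refine (Finset.sum_le_sum (g := fun _ => V) fun i _ => ?_).trans (by simp [mul_comm])
  rw [variance_of_integral_eq_zero (h2 i).aestronglyMeasurable.aemeasurable (h0 i)]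
  exact hV i

/-- Moments of a sum of independent centred variables grow at most like those of a Gaussian. -/
theorem exists_integral_abs_sum_pow_le (m : ℕ) (V C : ℝ) :
    ∃ K : ℝ, 0 ≤ K ∧ ∀ (ι Ω : Type) [MeasurableSpace Ω] (μ : Measure Ω) [IsProbabilityMeasure μ]
      (W : ι → Ω → ℝ),
      (∀ i, Measurable (W i)) → iIndepFun W μ → (∀ i, MemLp (W i) 2 μ) → (∀ i, MemLp (W i) m μ) →
      (∀ i, ∫ ω, W i ω ∂μ = 0) → (∀ i, ∫ ω, W i ω ^ 2 ∂μ ≤ V) → (∀ i, ∫ ω, |W i ω| ^ m ∂μ ≤ C) →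
      ∀ s : Finset ι, ∫ ω, |∑ i ∈ s, W i ω| ^ m ∂μ ≤ K * √(s.card : ℝ) ^ m := by
  -- Adding one summand changes the moment of order `m + 2` by a multiple of the moment of order `m`
  -- plus a constant; summing these increments raises `√card ^ m` to `√card ^ (m + 2)`.
  induction m using Nat.twoStepInduction generalizing V C with
  | zero => exact ⟨1, zero_le_one, fun ι Ω _ μ _ W _ _ _ _ _ _ _ s => by simp⟩
  | one =>
    refine ⟨√(max V 0), Real.sqrt_nonneg _, fun ι Ω _ μ _ W hm hi h2 _ h0 hV _ s => ?_⟩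
    have hS : MemLp (fun ω => ∑ i ∈ s, W i ω) 2 μ := memLp_finsetSum s fun i _ => h2 i
    have hvar := integral_sum_sq_le hi h2 h0 hV s
    simp only [pow_one]
    rw [← Real.sqrt_mul (le_max_right _ _)]
    refine Real.le_sqrt_of_sq_le ?_
    -- For `m = 1`: nonnegativity of this variance gives `(E |S|)² ≤ E S²`.
    have h4 := variance_nonneg (fun ω => |∑ i ∈ s, W i ω|) μ
    rw [variance_eq_sub (by simpa using hS.norm)] at h4
    simp only [Pi.pow_apply, sq_abs] at h4
    have : V * (s.card : ℝ) ≤ max V 0 * s.card := by gcongr; exact le_max_left _ _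
    linarith
  | more m ih _ =>
    -- The lower moment is bounded through `|w| ^ m ≤ 1 + |w| ^ (m + 2)`.
    obtain ⟨K, hK, ih⟩ := ih V (1 + C)
    obtain ⟨c, hc, hadd⟩ := exists_abs_add_pow_le m
    refine ⟨c * (K * max V 0 + max C 0), by positivity, fun ι Ω _ μ _ W hm hi h2 hmem h0 hV hC s => ?_⟩
    have hmem' : ∀ i, MemLp (W i) m μ := fun i => (hmem i).mono_exponent (by simp)
    have ipow : ∀ i, Integrable (fun ω => |W i ω| ^ (m + 2)) μ := fun i => by
      simpa using (hmem i).integrable_norm_pow (by simp)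
    have ipow' : ∀ i, Integrable (fun ω => |W i ω| ^ m) μ := fun i => by
      rcases Nat.eq_zero_or_pos m with rfl | hm0
      · simp
      · simpa using (hmem' i).integrable_norm_pow hm0.ne'
    have hlow := ih ι Ω μ W hm hi h2 hmem' h0 hV fun i => by
      calc ∫ ω, |W i ω| ^ m ∂μ ≤ ∫ ω, (1 + |W i ω| ^ (m + 2)) ∂μ := by
            refine integral_mono (ipow' i) ((integrable_const 1).add (ipow i)) fun ω => ?_
            dsimp only
            rcases le_total |W i ω| 1 with h | h
            · have := pow_le_one₀ (n := m) (abs_nonneg (W i ω)) h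
              have : 0 ≤ |W i ω| ^ (m + 2) := by positivity
              linarith
            · have := pow_le_pow_right₀ h (by omega : m ≤ m + 2)
              linarith
        _ ≤ 1 + C := by
            rw [integral_add (integrable_const 1) (ipow i)]
            simpa using hC i
    classical
    induction s using Finset.induction_on with
    | empty => simp
    | insert a s ha IH =>
      set S : Ω → ℝ := fun ω => ∑ i ∈ s, W i ω with hS
      have hSm : Measurable S := Finset.measurable_sum s fun i _ => hm i
      have hSmem : MemLp S (m + 2 : ℕ) μ := memLp_finsetSum s fun i _ => hmem i
      have hSmem' : MemLp S m μ := memLp_finsetSum s fun i _ => hmem' i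
      have hind : IndepFun (W a) S μ := by
        have h3 := (hi.indepFun_finsetSum_of_notMem hm ha).symm
        have e : (∑ i ∈ s, W i) = S := by ext ω; simp [hS]
        rwa [e] at h3
      have iS : Integrable (fun ω => |S ω| ^ (m + 2)) μ := by
        simpa using hSmem.integrable_norm_pow (by simp)
      have iS1 : Integrable (fun ω => S ω * |S ω| ^ m) μ := by
        have : Integrable (fun ω => |S ω| ^ (m + 1)) μ := by
          simpa using (hSmem.mono_exponent (p := (m + 1 : ℕ)) (by
            exact_mod_cast Nat.le_succ _)).integrable_norm_pow (by simp)
        refine this.mono' (by fun_prop) (Eventually.of_forall fun ω => ?_)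
        rw [norm_mul, norm_pow, Real.norm_eq_abs, Real.norm_eq_abs, abs_abs, pow_succ, mul_comm]
      have iS0 : Integrable (fun ω => |S ω| ^ m) μ := by
        rcases Nat.eq_zero_or_pos m with rfl | hm0
        · simp
        · simpa using hSmem'.integrable_norm_pow hm0.ne'
      have iW : Integrable (W a) μ := (h2 a).integrable one_le_two
      have ind1 : IndepFun (W a) (fun ω => S ω * |S ω| ^ m) μ :=
        hind.comp (φ := id) (ψ := fun x => x * |x| ^ m) measurable_id (by fun_prop)
      have ind0 : IndepFun (fun ω => |S ω| ^ m) (fun ω => W a ω ^ 2) μ :=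
        (hind.comp (φ := fun x => x ^ 2) (ψ := fun x => |x| ^ m) (by fun_prop) (by fun_prop)).symm
      have i1 : Integrable (fun ω => W a ω * (S ω * |S ω| ^ m)) μ := ind1.integrable_mul iW iS1
      have i0 : Integrable (fun ω => |S ω| ^ m * W a ω ^ 2) μ :=
        ind0.integrable_mul iS0 (h2 a).integrable_sq
      -- The first-order term vanishes since the new summand is centred and independent of the
      -- partial sum.
      have e1 : ∫ ω, W a ω * (S ω * |S ω| ^ m) ∂μ = 0 := by
        have := ind1.integral_fun_mul_eq_mul_integral iW.aestronglyMeasurable iS1.aestronglyMeasurable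
        rw [this, h0 a, zero_mul]
      have e0 : ∫ ω, |S ω| ^ m * W a ω ^ 2 ∂μ ≤ K * √(s.card : ℝ) ^ m * max V 0 := by
        have := ind0.integral_fun_mul_eq_mul_integral iS0.aestronglyMeasurable
          (h2 a).integrable_sq.aestronglyMeasurable
        rw [this]
        exact mul_le_mul (hlow s) ((hV a).trans (le_max_left _ _)) (integral_nonneg fun ω => sq_nonneg _)
          (by positivity)
      have hstep : ∫ ω, |S ω + W a ω| ^ (m + 2) ∂μ ≤ ∫ ω, |S ω| ^ (m + 2) ∂μ +
          c * (K * √(s.card : ℝ) ^ m * max V 0 + max C 0) := by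
        have iadd : Integrable (fun ω => |S ω + W a ω| ^ (m + 2)) μ := by
          simpa using (hSmem.add (hmem a)).integrable_norm_pow (by simp)
        have j1 := i1.const_mul (m + 2 : ℝ)
        have j2 : Integrable (fun ω => |S ω| ^ m * W a ω ^ 2 + |W a ω| ^ (m + 2)) μ := i0.add (ipow a)
        have j3 : Integrable (fun ω => |S ω| ^ (m + 2) + (m + 2) * (W a ω * (S ω * |S ω| ^ m))) μ :=
          iS.add j1
        refine (integral_mono iadd (j3.add (j2.const_mul c)) fun ω => hadd (S ω) (W a ω)).trans ?_
        simp only [Pi.add_apply]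
        rw [integral_add j3 (j2.const_mul c), integral_add iS j1, integral_const_mul,
          integral_const_mul, integral_add i0 (ipow a), e1, mul_zero, add_zero]
        have := (hC a).trans (le_max_left C 0)
        gcongr
      have eS : ∀ ω, ∑ i ∈ insert a s, W i ω = S ω + W a ω := fun ω => by
        rw [Finset.sum_insert ha, add_comm]
      simp only [eS]
      refine hstep.trans ((add_le_add_left IH _).trans ?_)
      rw [Finset.card_insert_of_notMem ha]
      push_cast
      set k : ℝ := (s.card : ℝ) with hk
      have hk0 : 0 ≤ k := Nat.cast_nonneg _
      have r1 : √k ^ m ≤ √(k + 1) ^ m :=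
        pow_le_pow_left₀ (Real.sqrt_nonneg _) (Real.sqrt_le_sqrt (by linarith)) _
      have r2 : 1 ≤ √(k + 1) ^ m := one_le_pow₀ (by rw [Real.one_le_sqrt]; linarith)
      have r3 : √k ^ (m + 2) = k * √k ^ m := by rw [pow_add, Real.sq_sqrt hk0]; ring
      have r4 : √(k + 1) ^ (m + 2) = (k + 1) * √(k + 1) ^ m := by
        rw [pow_add, Real.sq_sqrt (by linarith)]; ring
      rw [r3, r4]
      have hV0 : 0 ≤ max V 0 := le_max_right _ _
      have hC0 : 0 ≤ max C 0 := le_max_right _ _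
      have t1 : c * (K * max V 0 + max C 0) * (k * √k ^ m) ≤
          c * (K * max V 0 + max C 0) * (k * √(k + 1) ^ m) := by gcongr
      have t2 : c * (K * √k ^ m * max V 0 + max C 0) ≤
          c * (K * √(k + 1) ^ m * max V 0 + max C 0 * √(k + 1) ^ m) := by
        gcongr
        exact le_mul_of_one_le_right hC0 r2
      linarith


/-! ### Chernoff bounds from exponential moments. -/

theorem exp_le_one_add_add_sq_mul_exp_abs (z : ℝ) :
    Real.exp z ≤ 1 + z + z ^ 2 * Real.exp |z| := by
  have he : 1 ≤ Real.exp |z| := Real.one_le_exp (abs_nonneg z)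
  have hz := sq_nonneg z
  rcases le_total |z| 1 with h | h
  · have := (abs_le.1 (Real.abs_exp_sub_one_sub_id_le h)).2
    nlinarith
  · have h2 : 1 ≤ z ^ 2 := by rw [← sq_abs]; nlinarith
    rcases le_total 0 z with h0 | h0
    · rw [abs_of_nonneg h0] at *
      nlinarith [Real.exp_pos z]
    · rw [abs_of_nonpos h0] at *
      have : Real.exp z ≤ 1 := Real.exp_le_one_iff.2 h0
      nlinarith

/-- With `a = h |w| / 2`, the factor `w²` costs at most `8 / h²` times `exp a`, and `exp |s w| ≤ exp
a`; together they stay within the available moment `exp (h |w|)`. -/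
theorem exp_mul_le_of_abs_le {h s w : ℝ} (hh : 0 < h) (hs0 : |s| ≤ h / 2) :
    Real.exp (s * w) ≤
      1 + s * w + s ^ 2 * (8 / h ^ 2 * (Real.exp (h * w) + Real.exp (-h * w))) := by
  refine (exp_le_one_add_add_sq_mul_exp_abs _).trans ?_
  rw [mul_pow, mul_assoc (s ^ 2)]
  refine add_le_add_right (mul_le_mul_of_nonneg_left ?_ (sq_nonneg s)) _
  set a := h / 2 * |w| with ha
  have ha0 : 0 ≤ a := by positivity
  have h1 : a ^ 2 / 2 ≤ Real.exp a := by
    have := Real.quadratic_le_exp_of_nonneg ha0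
    linarith
  have h2 : w ^ 2 = 8 / h ^ 2 * (a ^ 2 / 2) := by
    rw [ha, mul_pow, sq_abs]; field_simp; norm_num
  have h3 : Real.exp |s * w| ≤ Real.exp a := by
    apply Real.exp_le_exp.2
    rw [abs_mul, ha]
    gcongr
  have h4 : Real.exp a * Real.exp a ≤ Real.exp (h * w) + Real.exp (-h * w) := by
    rw [← Real.exp_add]
    have p1 := Real.exp_pos (h * w)
    have p2 := Real.exp_pos (-h * w)
    rcases le_total 0 w with hw | hw
    · rw [ha, abs_of_nonneg hw, show h / 2 * w + h / 2 * w = h * w by ring]; linarith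
    · rw [ha, abs_of_nonpos hw, show h / 2 * -w + h / 2 * -w = -h * w by ring]; linarith
  calc w ^ 2 * Real.exp |s * w| ≤ 8 / h ^ 2 * Real.exp a * Real.exp a := by
        rw [h2]
        gcongr
    _ = 8 / h ^ 2 * (Real.exp a * Real.exp a) := by ring
    _ ≤ _ := by gcongr

section chernoff
variable {ι Ω : Type*} [Fintype ι] [MeasurableSpace Ω] {μ : Measure Ω} [IsProbabilityMeasure μ]

/-- Centring kills the linear term of the expansion, leaving sub-Gaussian growth for `s` near zero.
-/
theorem mgf_le_of_exp_moment {W : Ω → ℝ} {h C s : ℝ} (hh : 0 < h)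
    (hW : Integrable W μ) (h0 : ∫ ω, W ω ∂μ = 0)
    (i1 : Integrable (fun ω => Real.exp (h * W ω)) μ)
    (i2 : Integrable (fun ω => Real.exp (-h * W ω)) μ)
    (c1 : ∫ ω, Real.exp (h * W ω) ∂μ ≤ C) (c2 : ∫ ω, Real.exp (-h * W ω) ∂μ ≤ C)
    (hs : |s| ≤ h / 2) : mgf W μ s ≤ Real.exp (16 * C / h ^ 2 * s ^ 2) := by
  have j1 : Integrable (fun ω => 8 / h ^ 2 * (Real.exp (h * W ω) + Real.exp (-h * W ω))) μ :=
    (i1.add i2).const_mul _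
  have j2 : Integrable (fun ω => 1 + s * W ω) μ := (integrable_const 1).add (hW.const_mul s)
  have hbound := integral_mono_of_nonneg (Eventually.of_forall fun ω => (Real.exp_pos (s * W ω)).le)
    (j2.add (j1.const_mul (s ^ 2))) (Eventually.of_forall fun ω => exp_mul_le_of_abs_le (w := W ω) hh hs)
  simp only [Pi.add_apply] at hbound
  rw [integral_add j2 (j1.const_mul (s ^ 2)), integral_add (integrable_const 1) (hW.const_mul s),
    integral_const_mul, integral_const_mul, integral_const_mul, integral_add i1 i2, h0] at hbound
  simp only [integral_const, probReal_univ, one_smul, mul_zero, add_zero] at hbound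
  refine hbound.trans ?_
  refine le_trans ?_ (Real.add_one_le_exp _)
  have : s ^ 2 * (8 / h ^ 2 * (∫ ω, Real.exp (h * W ω) ∂μ + ∫ ω, Real.exp (-h * W ω) ∂μ)) ≤
      s ^ 2 * (8 / h ^ 2 * (C + C)) := by gcongr
  calc _ ≤ 1 + s ^ 2 * (8 / h ^ 2 * (C + C)) := by linarith
    _ = _ := by ring

theorem measureReal_abs_sum_ge_le {W : ι → Ω → ℝ} {h C s : ℝ} (hh : 0 < h)
    (hm : ∀ i, Measurable (W i)) (hi : iIndepFun W μ)
    (hW : ∀ i, Integrable (W i) μ) (h0 : ∀ i, ∫ ω, W i ω ∂μ = 0)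
    (i1 : ∀ i, Integrable (fun ω => Real.exp (h * W i ω)) μ)
    (i2 : ∀ i, Integrable (fun ω => Real.exp (-h * W i ω)) μ)
    (c1 : ∀ i, ∫ ω, Real.exp (h * W i ω) ∂μ ≤ C) (c2 : ∀ i, ∫ ω, Real.exp (-h * W i ω) ∂μ ≤ C)
    (hs0 : 0 ≤ s) (hs : s ≤ h / 2) (u : ℝ) :
    μ.real {ω | u ≤ |∑ i, W i ω|} ≤
      2 * Real.exp (-s * u + Fintype.card ι * (16 * C / h ^ 2 * s ^ 2)) := by
  have hmgf : ∀ r : ℝ, |r| ≤ h / 2 →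
      mgf (∑ i, W i) μ r ≤ Real.exp (Fintype.card ι * (16 * C / h ^ 2 * r ^ 2)) := fun r hr => by
    rw [hi.mgf_sum hm]
    refine (Finset.prod_le_prod (fun i _ => mgf_nonneg)
      fun i _ => mgf_le_of_exp_moment hh (hW i) (h0 i) (i1 i) (i2 i) (c1 i) (c2 i) hr).trans ?_
    rw [Finset.prod_const, ← Real.exp_nat_mul, Finset.card_univ]
  have hint : ∀ r : ℝ, |r| ≤ h / 2 → Integrable (fun ω => Real.exp (r * (∑ i, W i) ω)) μ := fun r hr => by
    refine hi.integrable_exp_mul_sum hm fun i _ => ?_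
    refine ((i1 i).add (i2 i)).mono' ((hm i).const_mul r).exp.aestronglyMeasurable
      (Eventually.of_forall fun ω => ?_)
    rw [Real.norm_eq_abs, abs_of_pos (Real.exp_pos _)]
    have hr' := abs_le.1 hr
    simp only [Pi.add_apply]
    rcases le_total 0 (W i ω) with hw | hw
    · have : Real.exp (r * W i ω) ≤ Real.exp (h * W i ω) := Real.exp_le_exp.2 (by nlinarith)
      linarith [Real.exp_pos (-h * W i ω)]
    · have : Real.exp (r * W i ω) ≤ Real.exp (-h * W i ω) := Real.exp_le_exp.2 (by nlinarith)
      linarith [Real.exp_pos (h * W i ω)]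
  have a1 : |s| ≤ h / 2 := by rwa [abs_of_nonneg hs0]
  have a2 : |-s| ≤ h / 2 := by rwa [abs_neg]
  have b1 := measure_ge_le_exp_mul_mgf (μ := μ) (X := ∑ i, W i) u hs0 (hint s a1)
  have b2 := measure_le_le_exp_mul_mgf (μ := μ) (X := ∑ i, W i) (-u) (by linarith : -s ≤ 0) (hint _ a2)
  have hsub : {ω | u ≤ |∑ i, W i ω|} ⊆ {ω | u ≤ (∑ i, W i) ω} ∪ {ω | (∑ i, W i) ω ≤ -u} := by
    intro ω hω
    simp only [Set.mem_ofPred_eq, Set.mem_union, Finset.sum_apply] at hω ⊢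
    rcases le_abs.1 hω with h | h
    · exact Or.inl h
    · exact Or.inr (by linarith)
  refine (measureReal_mono hsub).trans ((measureReal_union_le _ _).trans ?_)
  have d1 := mul_le_mul_of_nonneg_left (hmgf s a1) (Real.exp_pos (-s * u)).le
  have d2 := mul_le_mul_of_nonneg_left (hmgf (-s) a2) (Real.exp_pos (-(-s) * -u)).le
  rw [← Real.exp_add] at d1 d2
  rw [neg_sq, show -(-s) * -u = -s * u by ring] at d2
  rw [show -(-s) * -u = -s * u by ring] at b2
  linarith

end chernoff

/-- Markov's inequality for a power of a sum of independent centred variables. -/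
theorem measureReal_ge_le_of_integral_pow_le {Ω : Type*} [MeasurableSpace Ω] {μ : Measure Ω}
    [IsFiniteMeasure μ] {S : Ω → ℝ} {m : ℕ} {B u : ℝ} (hu : 0 < u)
    (hi : Integrable (fun ω => |S ω| ^ m) μ) (hB : ∫ ω, |S ω| ^ m ∂μ ≤ B) :
    μ.real {ω | u ≤ |S ω|} ≤ B / u ^ m := by
  rw [le_div_iff₀ (by positivity), mul_comm]
  refine le_trans ?_ ((mul_meas_ge_le_integral_of_nonneg
    (Eventually.of_forall fun ω => by positivity) hi (u ^ m)).trans hB)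
  refine mul_le_mul_of_nonneg_left (measureReal_mono fun ω hω => ?_) (by positivity)
  exact pow_le_pow_left₀ hu.le hω m

/-! ### Entries of the Gram matrix for one design. -/

section design
variable {n p : ℕ} {PX : Measure (Design n p)} [IsProbabilityMeasure PX]

/-- Centred product of two entries of a row. -/
noncomputable def centredProd (j l : Fin p) (i : Fin n) (X : Design n p) : ℝ :=
  X i j * X i l - if j = l then 1 else 0

omit [IsProbabilityMeasure PX] in
theorem measurable_centredProd (j l : Fin p) (i : Fin n) :
    Measurable (centredProd (n := n) j l i) := by
  unfold centredProd; fun_prop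

omit [IsProbabilityMeasure PX] in
theorem iIndepFun_centredProd (hX : IsStandardDesign PX) (j l : Fin p) :
    iIndepFun (centredProd (n := n) j l) PX :=
  hX.indep_rows.comp (fun _ (x : Fin p → ℝ) => x j * x l - if j = l then 1 else 0)
    fun _ => by fun_prop

omit [IsProbabilityMeasure PX] in
theorem centredProd_comm (j l : Fin p) (i : Fin n) (X : Design n p) :
    centredProd j l i X = centredProd l j i X := by
  simp only [centredProd, mul_comm, eq_comm]

omit [IsProbabilityMeasure PX] in
theorem memLp_entry (hX : IsStandardDesign PX) (i : Fin n) (j : Fin p) :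
    MemLp (fun X : Design n p => X i j) 2 PX := by
  rw [memLp_two_iff_integrable_sq (by fun_prop : Measurable _).aestronglyMeasurable]
  -- Square integrability is implicit in the second-moment assumption: a non-integrable square would
  -- have integral zero by convention, not one.
  by_contra h
  have := hX.second_moment_one i j
  rw [integral_undef h] at this
  exact zero_ne_one this

omit [IsProbabilityMeasure PX] in
theorem integrable_entry_mul (hX : IsStandardDesign PX) (i : Fin n) (j l : Fin p) :
    Integrable (fun X : Design n p => X i j * X i l) PX :=
  integrable_mul_of_memLp_two (memLp_entry hX i j) (memLp_entry hX i l)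

theorem integrable_centredProd (hX : IsStandardDesign PX) (j l : Fin p) (i : Fin n) :
    Integrable (centredProd (n := n) j l i) PX :=
  (integrable_entry_mul hX i j l).sub (integrable_const _)

theorem integral_centredProd (hX : IsStandardDesign PX) (hA : UncorrelatedDesign PX)
    (j l : Fin p) (i : Fin n) : ∫ X, centredProd j l i X ∂PX = 0 := by
  unfold centredProd
  rw [integral_sub (integrable_entry_mul hX i j l) (integrable_const _)]
  rcases lt_trichotomy j l with h | h | h
  · simp [hA i j l h, h.ne]
  · subst h
    have := hX.second_moment_one i j
    simp only [sq] at this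
    simp [this]
  · have := hA i l j h
    simp only [mul_comm] at this
    simp [this, h.ne']

theorem sum_centredProd (j l : Fin p) (X : Design n p) :
    ∑ i, centredProd j l i X = (fun i => X i j) ⬝ᵥ (fun i => X i l) - if j = l then (n : ℝ) else 0 := by
  simp [centredProd, dotProduct, Finset.sum_sub_distrib]

/-- Designs with an entry of the Gram matrix at distance at least `u` from that of `n` times the
identity. -/
def gramDeviates (n p : ℕ) (u : ℝ) : Set (Design n p) :=
  {X | ∃ j l : Fin p, u ≤ |∑ i, centredProd j l i X|}

omit [IsProbabilityMeasure PX] in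
theorem measureReal_gramDeviates_le {u B : ℝ}
    (h : ∀ j l : Fin p, j ≤ l → PX.real {X | u ≤ |∑ i, centredProd j l i X|} ≤ B) :
    PX.real (gramDeviates n p u) ≤ (p : ℝ) ^ 2 * B := by
  have h' : ∀ j l : Fin p, PX.real {X | u ≤ |∑ i, centredProd j l i X|} ≤ B := fun j l => by
    rcases le_total j l with hjl | hjl
    · exact h j l hjl
    · simpa only [centredProd_comm j l] using h l j hjl
  have e : gramDeviates n p u = ⋃ q : Fin p × Fin p, {X | u ≤ |∑ i, centredProd q.1 q.2 i X|} := by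
    ext X; simp [gramDeviates]
  rw [e]
  refine (measureReal_iUnion_fintype_le _).trans
    ((Finset.sum_le_sum fun q _ => h' q.1 q.2).trans (le_of_eq ?_))
  simp [sq]

/-- Expected squared off-diagonal entries of the Gram matrix. -/
theorem integral_gramOffDiag_le (hX : IsStandardDesign PX) (hA : UncorrelatedDesign PX) {C : ℝ}
    (hB : ∀ (i : Fin n) (j l : Fin p), j < l → Integrable (fun X => (X i j * X i l) ^ 4) PX ∧
      ∫ X, (X i j * X i l) ^ 4 ∂PX ≤ C) :
    Integrable (fun X : Design n p => gramOffDiag (fun j i => X i j)) PX ∧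
      ∫ X : Design n p, gramOffDiag (fun j i => X i j) ∂PX ≤ (p : ℝ) ^ 2 * ((1 + |C|) * n) := by
  have hB' : ∀ (i : Fin n) (j l : Fin p), j ≠ l → Integrable (fun X => (X i j * X i l) ^ 4) PX ∧
      ∫ X, (X i j * X i l) ^ 4 ∂PX ≤ C := fun i j l hjl => by
    rcases lt_or_gt_of_ne hjl with h | h
    · exact hB i j l h
    · simpa only [mul_comm] using hB i l j h
  have hsq : ∀ (i : Fin n) (j l : Fin p), j ≠ l → MemLp (centredProd (n := n) j l i) 2 PX ∧
      ∫ X, centredProd j l i X ^ 2 ∂PX ≤ 1 + |C| := fun i j l hjl => by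
    obtain ⟨h1, h2⟩ := hB' i j l hjl
    -- Off the diagonal no centring is needed, so the mixed fourth moments bound the variance.
    have hle : ∀ X : Design n p, centredProd j l i X ^ 2 ≤ 1 + (X i j * X i l) ^ 4 := fun X => by
      simp only [centredProd, hjl, if_false, sub_zero]
      nlinarith [sq_nonneg ((X i j * X i l) ^ 2 - 1), sq_nonneg ((X i j * X i l) ^ 2)]
    have hmeas := measurable_centredProd (n := n) j l i
    have hint : Integrable (fun X : Design n p => centredProd j l i X ^ 2) PX :=
      ((integrable_const 1).add h1).mono' (by fun_prop) (Eventually.of_forall fun X => by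
        rw [Real.norm_eq_abs, abs_of_nonneg (sq_nonneg _)]; exact hle X)
    refine ⟨(memLp_two_iff_integrable_sq hmeas.aestronglyMeasurable).2 hint, ?_⟩
    refine (integral_mono hint ((integrable_const 1).add h1) hle).trans ?_
    simp only [Pi.add_apply]
    rw [integral_add (integrable_const 1) h1]
    simpa using h2.trans (le_abs_self C)
  have hterm : ∀ j l : Fin p, Integrable (fun X : Design n p =>
      if j = l then (0 : ℝ) else ((fun i => X i j) ⬝ᵥ fun i => X i l) ^ 2) PX ∧
      ∫ X : Design n p, (if j = l then (0 : ℝ) else ((fun i => X i j) ⬝ᵥ fun i => X i l) ^ 2) ∂PX ≤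
        (1 + |C|) * n := fun j l => by
    split_ifs with hjl
    · simp; positivity
    have e : ∀ X : Design n p, (fun i => X i j) ⬝ᵥ (fun i => X i l) =
        ∑ i ∈ Finset.univ, centredProd j l i X := fun X => by
      rw [sum_centredProd]; simp [hjl]
    simp only [e]
    refine ⟨(memLp_finsetSum _ fun i _ => (hsq i j l hjl).1).integrable_sq, ?_⟩
    have := integral_sum_sq_le (iIndepFun_centredProd hX j l) (fun i => (hsq i j l hjl).1)
      (fun i => integral_centredProd hX hA j l i) (fun i => (hsq i j l hjl).2) Finset.univ
    simpa using this
  unfold gramOffDiag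
  refine ⟨integrable_finsetSum _ fun j _ => integrable_finsetSum _ fun l _ => (hterm j l).1, ?_⟩
  rw [integral_finsetSum _ fun j _ => integrable_finsetSum _ fun l _ => (hterm j l).1]
  simp only [integral_finsetSum _ fun l _ => (hterm _ l).1]
  refine (Finset.sum_le_sum fun j _ => Finset.sum_le_sum fun l _ => (hterm j l).2).trans (le_of_eq ?_)
  simp; ring

end design

section design
variable {n p : ℕ} {PX : Measure (Design n p)} [IsProbabilityMeasure PX]

/-- Union bound over the `p²` entries with Markov for the `m`-th power. The constant is chosen
before `n`, `p` and the law, so it is uniform along a sequence; `m ≥ 2` is what makes the `m`-th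
moments bound the variances. -/
theorem measureReal_abs_sum_centredProd_ge_le {m : ℕ} (hm : 2 ≤ m) (C : ℝ) :
    ∃ K : ℝ, 0 ≤ K ∧ ∀ (n p : ℕ) (PX : Measure (Design n p)) [IsProbabilityMeasure PX],
      IsStandardDesign PX → UncorrelatedDesign PX →
      (∀ (i : Fin n) (j l : Fin p), j ≤ l → Integrable (fun X => |X i j * X i l| ^ m) PX ∧
        ∫ X, |X i j * X i l| ^ m ∂PX ≤ C) →
      ∀ u : ℝ, 0 < u → PX.real (gramDeviates n p u) ≤ (p : ℝ) ^ 2 * (K * √n ^ m / u ^ m) := by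
  obtain ⟨K, hK0, hK⟩ := exists_integral_abs_sum_pow_le m (1 + 2 ^ (m - 1) * (C + 1)) (2 ^ (m - 1) * (C + 1))
  refine ⟨K, hK0, fun n p PX _ hX hA hB u hu => measureReal_gramDeviates_le fun j l hjl => ?_⟩
  have hmeas := fun i => measurable_centredProd (n := n) j l i
  have hle : ∀ (i : Fin n) (X : Design n p),
      |centredProd j l i X| ^ m ≤ 2 ^ (m - 1) * (|X i j * X i l| ^ m + 1) := fun i X => by
    have h1 : |centredProd j l i X| ≤ |X i j * X i l| + 1 := by
      unfold centredProd
      refine (abs_sub _ _).trans ?_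
      split_ifs <;> simp
    refine (pow_le_pow_left₀ (abs_nonneg _) h1 m).trans ?_
    simpa using add_pow_le (abs_nonneg (X i j * X i l)) zero_le_one m
  have ib : ∀ i : Fin n, Integrable (fun X : Design n p => 2 ^ (m - 1) * (|X i j * X i l| ^ m + 1)) PX :=
    fun i => ((hB i j l hjl).1.add (integrable_const 1)).const_mul _
  have ipow : ∀ i : Fin n, Integrable (fun X => |centredProd j l i X| ^ m) PX := fun i =>
    (ib i).mono' (by have := hmeas i; fun_prop) (Eventually.of_forall fun X => by
      rw [Real.norm_eq_abs, abs_of_nonneg (by positivity)]; exact hle i X)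
  have bpow : ∀ i : Fin n, ∫ X, |centredProd j l i X| ^ m ∂PX ≤ 2 ^ (m - 1) * (C + 1) := fun i => by
    refine (integral_mono (ipow i) (ib i) (hle i)).trans ?_
    rw [integral_const_mul, integral_add (hB i j l hjl).1 (integrable_const 1)]
    have := (hB i j l hjl).2
    simp only [integral_const, probReal_univ, one_smul]
    gcongr
  have hsqle : ∀ (i : Fin n) (X : Design n p),
      centredProd j l i X ^ 2 ≤ 1 + |centredProd j l i X| ^ m := fun i X => by
    rw [← sq_abs]
    rcases le_total |centredProd j l i X| 1 with h | h
    · have := pow_le_one₀ (n := 2) (abs_nonneg (centredProd j l i X)) h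
      have : 0 ≤ |centredProd j l i X| ^ m := by positivity
      linarith
    · have := pow_le_pow_right₀ h hm
      linarith
  have isq : ∀ i : Fin n, Integrable (fun X => centredProd j l i X ^ 2) PX := fun i =>
    ((integrable_const 1).add (ipow i)).mono' (by have := hmeas i; fun_prop)
      (Eventually.of_forall fun X => by
        rw [Real.norm_eq_abs, abs_of_nonneg (sq_nonneg _)]; exact hsqle i X)
  have bsq : ∀ i : Fin n, ∫ X, centredProd j l i X ^ 2 ∂PX ≤ 1 + 2 ^ (m - 1) * (C + 1) := fun i => by
    refine (integral_mono (isq i) ((integrable_const 1).add (ipow i)) (hsqle i)).trans ?_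
    simp only [Pi.add_apply]
    rw [integral_add (integrable_const 1) (ipow i)]
    simpa using bpow i
  have m2 : ∀ i : Fin n, MemLp (centredProd (n := n) j l i) 2 PX := fun i =>
    (memLp_two_iff_integrable_sq (hmeas i).aestronglyMeasurable).2 (isq i)
  have mm : ∀ i : Fin n, MemLp (centredProd (n := n) j l i) m PX := fun i => by
    rw [← integrable_norm_rpow_iff (hmeas i).aestronglyMeasurable
      (by simp; omega) (ENNReal.natCast_ne_top m)]
    simpa using ipow i
  have key := hK (Fin n) (Design n p) PX (centredProd j l) hmeas (iIndepFun_centredProd hX j l) m2 mm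
    (integral_centredProd hX hA j l) bsq bpow Finset.univ
  simp only [Finset.card_univ, Fintype.card_fin] at key
  refine measureReal_ge_le_of_integral_pow_le hu ?_ key
  have := (memLp_finsetSum Finset.univ fun i _ => mm i).integrable_norm_pow (by omega)
  simpa using this

/-- Averaging a truncation over many coordinates bounds its mean by the pairwise moments. -/
theorem sq_integral_le_of_pairwise {Ω : Type*} [MeasurableSpace Ω] {μ : Measure Ω}
    [IsProbabilityMeasure μ] {p : ℕ} (hp : 0 < p) {Z : Fin p → Ω → ℝ} {a T C : ℝ}
    (hZ : ∀ j, Measurable (Z j)) (h0 : ∀ j ω, 0 ≤ Z j ω) (hT : ∀ j ω, Z j ω ≤ T)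
    (ha : ∀ j, ∫ ω, Z j ω ∂μ = a) (hC : ∀ j l, j ≠ l → ∫ ω, Z j ω * Z l ω ∂μ ≤ C) (hC0 : 0 ≤ C) :
    a ^ 2 ≤ C + T ^ 2 / p := by
  have hm : ∀ j, MemLp (Z j) 2 μ := fun j =>
    MemLp.of_bound (hZ j).aestronglyMeasurable T (Eventually.of_forall fun ω => by
      rw [Real.norm_eq_abs, abs_of_nonneg (h0 j ω)]; exact hT j ω)
  have hS : MemLp (fun ω => ∑ j, Z j ω) 2 μ := memLp_finsetSum _ fun j _ => hm j
  -- Nonnegativity of this variance bounds `(p a)²` by the sum of all pair moments, of which only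
  -- the `p` diagonal ones need the bound `T²`.
  have hv := variance_nonneg (fun ω => ∑ j, Z j ω) μ
  rw [variance_eq_sub hS] at hv
  rw [integral_finsetSum _ fun j _ => (hm j).integrable one_le_two] at hv
  simp only [Pi.pow_apply, ha, sq (∑ j, Z j _), Finset.sum_mul_sum] at hv
  have hjl := fun j l => integrable_mul_of_memLp_two (hm j) (hm l)
  rw [integral_finsetSum _ fun j _ => integrable_finsetSum _ fun l _ => hjl j l] at hv
  simp only [integral_finsetSum _ fun l _ => hjl _ l] at hv
  have hle : ∀ j l, ∫ ω, Z j ω * Z l ω ∂μ ≤ C + if j = l then T ^ 2 else 0 := fun j l => by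
    split_ifs with h
    · subst h
      refine (integral_mono (g := fun _ => T ^ 2) (hjl j j) (integrable_const _) fun ω => ?_).trans ?_
      · have := h0 j ω
        have := hT j ω
        dsimp only
        nlinarith
      · simpa using hC0
    · simpa using hC j l h
  have hsum := Finset.sum_le_sum fun j (_ : j ∈ Finset.univ) =>
    Finset.sum_le_sum fun l (_ : l ∈ Finset.univ) => hle j l
  simp only [Finset.sum_add_distrib, Finset.sum_ite_eq, Finset.mem_univ, if_true, Finset.sum_const,
    Finset.card_univ, Fintype.card_fin, nsmul_eq_mul] at hsum hv
  have hp' : (0 : ℝ) < p := by exact_mod_cast hp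
  have : (p : ℝ) ^ 2 * a ^ 2 ≤ (p : ℝ) ^ 2 * (C + T ^ 2 / p) := by
    have e : (p : ℝ) ^ 2 * (C + T ^ 2 / p) = p * (p * C) + p * T ^ 2 := by field_simp
    rw [e]; linarith
  exact le_of_mul_le_mul_left this (by positivity)

end design

/-! ### The Gram matrix along the sequence. -/

section sequence
variable {n p : ℕ → ℕ} {PX : ∀ t, Measure (Design (n t) (p t))} [∀ t, IsProbabilityMeasure (PX t)]

/-- If the entries have a fixed law, the bound on the mixed fourth moments bounds the fourth moment
of the entries. -/
theorem FixedEntryLaw.exists_fourth_moment_le (hn : Tendsto n atTop atTop)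
    (hp : Tendsto p atTop atTop) (hB : FourthMomentBound PX) (hF : FixedEntryLaw PX) :
    ∃ C : ℝ, ∀ᶠ t in atTop, ∀ (i : Fin (n t)) (j : Fin (p t)),
      Integrable (fun X => X i j ^ 4) (PX t) ∧ ∫ X, X i j ^ 4 ∂(PX t) ≤ C := by
  obtain ⟨C, hC⟩ := hB
  obtain ⟨ν, hν⟩ := hF
  have hn0 : ∀ᶠ t in atTop, 0 < n t := hn.eventually_gt_atTop 0
  have hp0 : ∀ᶠ t in atTop, 0 < p t := hp.eventually_gt_atTop 0
  have hprob : IsProbabilityMeasure ν := by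
    obtain ⟨t, h1, h2, h3⟩ := (hν.and (hn0.and hp0)).exists
    rw [← h1 ⟨0, h2⟩ ⟨0, h3⟩]
    exact Measure.isProbabilityMeasure_map (by fun_prop : Measurable _).aemeasurable
  -- The law `ν` is the same for all large `t`, so `T` can be held fixed while `p` grows; the
  -- diagonal contribution `T² / p` then disappears.
  have htrunc : ∀ T : ℕ, ∫ x, min (x ^ 4) (T : ℝ) ∂ν ≤ √|C| := fun T => by
    refine Real.le_sqrt_of_sq_le ?_
    refine ge_of_tendsto (x := atTop) (f := fun t : ℕ => |C| + (T : ℝ) ^ 2 / (p t : ℝ)) ?_ ?_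
    · have : Tendsto (fun t => (T : ℝ) ^ 2 / (p t : ℝ)) atTop (𝓝 0) :=
        (tendsto_natCast_atTop_atTop.comp hp).const_div_atTop _
      simpa using this.const_add |C|
    · filter_upwards [hν, hn0, hp0, hC] with t h1 h2 h3 h4
      have hmT : Measurable fun x : ℝ => min (x ^ 4) (T : ℝ) := by fun_prop
      refine sq_integral_le_of_pairwise (μ := PX t) h3 (Z := fun j X => min (X ⟨0, h2⟩ j ^ 4) (T : ℝ))
        (fun j => by fun_prop) (fun j X => le_min (by positivity) (Nat.cast_nonneg _))
        (fun j X => min_le_right _ _) (fun j => ?_) (fun j l hjl => ?_) (abs_nonneg C)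
      · rw [← h1 ⟨0, h2⟩ j, integral_map (by fun_prop : Measurable _).aemeasurable
          hmT.aestronglyMeasurable]
      · have h5 : Integrable (fun X => (X ⟨0, h2⟩ j * X ⟨0, h2⟩ l) ^ 4) (PX t) ∧
            ∫ X, (X ⟨0, h2⟩ j * X ⟨0, h2⟩ l) ^ 4 ∂(PX t) ≤ C := by
          rcases lt_or_gt_of_ne hjl with h | h
          · exact h4 _ j l h
          · simpa only [mul_comm] using h4 ⟨0, h2⟩ l j h
        refine (integral_mono_of_nonneg (Eventually.of_forall fun X => ?_) h5.1
          (Eventually.of_forall fun X => ?_)).trans (h5.2.trans (le_abs_self C))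
        · exact mul_nonneg (le_min (by positivity) (Nat.cast_nonneg _))
            (le_min (by positivity) (Nat.cast_nonneg _))
        · dsimp only
          rw [mul_pow]
          exact mul_le_mul (min_le_left _ _) (min_le_left _ _)
            (le_min (by positivity) (Nat.cast_nonneg _)) (by positivity)
  -- Fatou's lemma removes the truncation, and integrability comes with it.
  have hlint : ∫⁻ x, ENNReal.ofReal (x ^ 4) ∂ν ≤ ENNReal.ofReal (√|C|) := by
    have hlim : ∀ x : ℝ, Tendsto (fun T : ℕ => ENNReal.ofReal (min (x ^ 4) (T : ℝ))) atTop
        (𝓝 (ENNReal.ofReal (x ^ 4))) := fun x => by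
      refine tendsto_const_nhds.congr' ?_
      filter_upwards [tendsto_natCast_atTop_atTop.eventually_ge_atTop (x ^ 4)] with T hT
      rw [min_eq_left hT]
    calc ∫⁻ x, ENNReal.ofReal (x ^ 4) ∂ν
        = ∫⁻ x, liminf (fun T : ℕ => ENNReal.ofReal (min (x ^ 4) (T : ℝ))) atTop ∂ν :=
          lintegral_congr fun x => (hlim x).liminf_eq.symm
      _ ≤ liminf (fun T : ℕ => ∫⁻ x, ENNReal.ofReal (min (x ^ 4) (T : ℝ)) ∂ν) atTop :=
          lintegral_liminf_le fun T => by fun_prop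
      _ ≤ ENNReal.ofReal (√|C|) := by
          refine liminf_le_of_le (by isBoundedDefault) fun b hb => ?_
          obtain ⟨T, hT⟩ := hb.exists
          refine hT.trans ?_
          rw [← ofReal_integral_eq_lintegral_ofReal]
          · exact ENNReal.ofReal_le_ofReal (htrunc T)
          · refine Integrable.of_bound (by fun_prop : Measurable _).aestronglyMeasurable (T : ℝ)
              (Eventually.of_forall fun x => ?_)
            rw [Real.norm_eq_abs, abs_of_nonneg (le_min (by positivity) (Nat.cast_nonneg _))]
            exact min_le_right _ _
          · exact Eventually.of_forall fun x => le_min (by positivity) (Nat.cast_nonneg _)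
  have hint : Integrable (fun x : ℝ => x ^ 4) ν := by
    refine ⟨by fun_prop, ?_⟩
    rw [hasFiniteIntegral_iff_ofReal (Eventually.of_forall fun x => by positivity)]
    exact hlint.trans_lt ENNReal.ofReal_lt_top
  have hle : ∫ x, x ^ 4 ∂ν ≤ √|C| := by
    rw [integral_eq_lintegral_of_nonneg_ae (Eventually.of_forall fun x => by positivity)
      (by fun_prop)]
    exact ENNReal.toReal_le_of_le_ofReal (Real.sqrt_nonneg _) hlint
  refine ⟨√|C|, ?_⟩
  filter_upwards [hν] with t h1 i j
  have hmeas : AEMeasurable (fun X : Design (n t) (p t) => X i j) (PX t) :=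
    (by fun_prop : Measurable _).aemeasurable
  rw [← h1 i j] at hint hle
  rw [integrable_map_measure (by fun_prop) hmeas] at hint
  rw [integral_map hmeas (by fun_prop)] at hle
  exact ⟨hint, hle⟩

/-- At deviation `η n / log p` the bound `p² K n^(m/2) / u^m` equals `K / η^m` times the `m`-th
power of the square root of `log² p * p^(4/m) / n`, which is the ratio assumed to vanish. -/
theorem tendsto_gramDeviates_of_moments (hn : Tendsto n atTop atTop) (hp : Tendsto p atTop atTop)
    (hX : ∀ t, IsStandardDesign (PX t)) (hA : ∀ t, UncorrelatedDesign (PX t)) {m : ℕ} (hm : 2 ≤ m)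
    (hB : ∃ C : ℝ, ∀ᶠ t in atTop, ∀ (i : Fin (n t)) (j l : Fin (p t)), j ≤ l →
      Integrable (fun X => |X i j * X i l| ^ m) (PX t) ∧ ∫ X, |X i j * X i l| ^ m ∂(PX t) ≤ C)
    (ho : (fun t => Real.log (p t) ^ 2 * (p t : ℝ) ^ ((4 : ℝ) / (m : ℝ))) =o[atTop] fun t => (n t : ℝ))
    {η : ℝ} (hη : 0 < η) :
    Tendsto (fun t => (PX t).real (gramDeviates (n t) (p t) (η * n t / Real.log (p t)))) atTop (𝓝 0) := by
  obtain ⟨C, hC⟩ := hB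
  obtain ⟨K, hK0, hK⟩ := measureReal_abs_sum_centredProd_ge_le hm C
  have hlim : Tendsto (fun t => K / η ^ m *
      √(Real.log (p t) ^ 2 * (p t : ℝ) ^ ((4 : ℝ) / (m : ℝ)) / n t) ^ m) atTop (𝓝 0) := by
    have h1 := ((ho.tendsto_div_nhds_zero.sqrt).pow m).const_mul (K / η ^ m)
    simpa [show m ≠ 0 by omega] using h1
  refine squeeze_zero' (Eventually.of_forall fun t => measureReal_nonneg) ?_ hlim
  filter_upwards [hC, hn.eventually_gt_atTop 0, hp.eventually_gt_atTop 1] with t ht hnt hpt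
  have hn' : (0 : ℝ) < n t := by exact_mod_cast hnt
  have hp' : (1 : ℝ) < p t := by exact_mod_cast hpt
  have hl : 0 < Real.log (p t) := Real.log_pos hp'
  refine (hK (n t) (p t) (PX t) (hX t) (hA t) ht _ (by positivity)).trans (le_of_eq ?_)
  have hm' : (m : ℝ) ≠ 0 := by positivity
  have e1 : √((p t : ℝ) ^ ((4 : ℝ) / (m : ℝ))) ^ m = (p t : ℝ) ^ 2 := by
    rw [Real.sqrt_eq_rpow, ← Real.rpow_mul (by positivity), ← Real.rpow_natCast,
      ← Real.rpow_mul (by positivity), show (4 : ℝ) / m * (1 / 2) * m = (2 : ℕ) by field_simp; norm_num,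
      Real.rpow_natCast]
  have e2 : √(n t : ℝ) ^ m * √(n t : ℝ) ^ m = (n t : ℝ) ^ m := by
    rw [← mul_pow, Real.mul_self_sqrt hn'.le]
  rw [Real.sqrt_div (by positivity), Real.sqrt_mul (by positivity), Real.sqrt_sq hl.le,
    div_pow (_ * _) (√_), mul_pow (Real.log _),
    e1, div_pow, mul_pow, ← e2]
  have : 0 < √(n t : ℝ) ^ m := by positivity
  field_simp

/-- The case `m = 1` is reduced to `m = 2`: the fixed entry law supplies the fourth moment needed on
the diagonal, the mixed fourth moments handle the rest, and the growth condition for `m = 1` is the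
stronger one. -/
theorem tendsto_gramDeviates_of_polyMoment (hn : Tendsto n atTop atTop) (hp : Tendsto p atTop atTop)
    (hX : ∀ t, IsStandardDesign (PX t)) (hA : ∀ t, UncorrelatedDesign (PX t))
    (hB1 : FourthMomentBound PX) (hB : PolyMomentCondition PX) {η : ℝ} (hη : 0 < η) :
    Tendsto (fun t => (PX t).real (gramDeviates (n t) (p t) (η * n t / Real.log (p t)))) atTop (𝓝 0) := by
  obtain ⟨m, hm1, hF, hB, ho⟩ := hB
  rcases hm1.eq_or_lt with rfl | hm
  · obtain ⟨C, hC⟩ := (hF rfl).exists_fourth_moment_le hn hp hB1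
    obtain ⟨C', hC'⟩ := hB1
    refine tendsto_gramDeviates_of_moments hn hp hX hA le_rfl ⟨max C (1 + C'), ?_⟩ ?_ hη
    · filter_upwards [hC, hC'] with t h1 h2 i j l hjl
      rcases hjl.eq_or_lt with rfl | hjl
      · have e : (fun X : Design (n t) (p t) => |X i j * X i j| ^ 2) = fun X => X i j ^ 4 := by
          ext X; rw [sq_abs]; ring
        rw [e]
        exact ⟨(h1 i j).1, (h1 i j).2.trans (le_max_left _ _)⟩
      · obtain ⟨h3, h4⟩ := h2 i j l hjl
        have hle : ∀ X : Design (n t) (p t), |X i j * X i l| ^ 2 ≤ 1 + (X i j * X i l) ^ 4 := fun X => by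
          rw [sq_abs]
          nlinarith [sq_nonneg ((X i j * X i l) ^ 2 - 1), sq_nonneg ((X i j * X i l) ^ 2)]
        have i5 : Integrable (fun X : Design (n t) (p t) => 1 + (X i j * X i l) ^ 4) (PX t) :=
          (integrable_const 1).add h3
        have hi : Integrable (fun X => |X i j * X i l| ^ 2) (PX t) :=
          i5.mono' (by fun_prop : Measurable _).aestronglyMeasurable
            (Eventually.of_forall fun X => by
              rw [Real.norm_eq_abs, abs_of_nonneg (by positivity)]; exact hle X)
        refine ⟨hi, ((integral_mono hi i5 hle).trans ?_).trans (le_max_right _ _)⟩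
        rw [integral_add (integrable_const 1) h3]
        simpa using h4
    · refine IsBigO.trans_isLittleO (IsBigO.of_bound 1 ?_) ho
      filter_upwards [hp.eventually_ge_atTop 1] with t ht
      have hp' : (1 : ℝ) ≤ p t := by exact_mod_cast ht
      rw [one_mul, Real.norm_eq_abs, Real.norm_eq_abs, abs_of_nonneg (by positivity),
        abs_of_nonneg (by positivity)]
      refine mul_le_mul_of_nonneg_left (Real.rpow_le_rpow_of_exponent_le hp' ?_) (sq_nonneg _)
      norm_num
  · exact tendsto_gramDeviates_of_moments hn hp hX hA hm hB ho hη

theorem tendsto_gramDeviates_of_expMoment (hp : Tendsto p atTop atTop)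
    (hX : ∀ t, IsStandardDesign (PX t)) (hA : ∀ t, UncorrelatedDesign (PX t))
    (hB : ExpMomentCondition PX) {η : ℝ} (hη : 0 < η) :
    Tendsto (fun t => (PX t).real (gramDeviates (n t) (p t) (η * n t / Real.log (p t)))) atTop (𝓝 0) := by
  obtain ⟨⟨h₀, hh₀, hE⟩, ho⟩ := hB
  set h := h₀ / 2 with hh
  have hh0 : 0 < h := by positivity
  obtain ⟨C₁, hC₁⟩ := hE h (by rw [abs_of_pos hh0]; linarith)
  obtain ⟨C₂, hC₂⟩ := hE (-h) (by rw [abs_neg, abs_of_pos hh0]; linarith)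
  -- The factor `exp h` pays for subtracting the mean, which is zero or one.
  set C := Real.exp h * (1 + |C₁| + |C₂|) with hC
  have hC0 : 0 < C := by positivity
  set A := 16 * C / h ^ 2 with hA'
  have hA0 : 0 < A := by positivity
  have hlog : Tendsto (fun t => Real.log (p t)) atTop atTop :=
    Real.tendsto_log_atTop.comp (tendsto_natCast_atTop_atTop.comp hp)
  -- The constant makes the Chernoff exponent at least `3 log p`, which beats the factor `p²` of the
  -- union bound by one power of `p`.
  have hq : ∀ᶠ t in atTop, Real.log (p t) ^ 3 ≤ η ^ 2 / (12 * A) * n t := by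
    filter_upwards [ho.bound (show 0 < η ^ 2 / (12 * A) by positivity),
      hlog.eventually_ge_atTop 0] with t ht hl
    rwa [Real.norm_eq_abs, Real.norm_eq_abs, abs_of_nonneg (by positivity),
      abs_of_nonneg (by positivity)] at ht
  have hlim : Tendsto (fun t => 2 * Real.exp (-Real.log (p t))) atTop (𝓝 0) := by
    simpa using (Real.tendsto_exp_neg_atTop_nhds_zero.comp hlog).const_mul 2
  refine squeeze_zero' (Eventually.of_forall fun t => measureReal_nonneg) ?_ hlim
  filter_upwards [hC₁, hC₂, hq, hlog.eventually_ge_atTop (η / (A * h)), hlog.eventually_gt_atTop 0,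
    hp.eventually_gt_atTop 0] with t h1 h2 h3 h4 hl hpt
  set ℓ := Real.log (p t) with hℓ
  have hp' : (0 : ℝ) < p t := by exact_mod_cast hpt
  have hδ : ∀ j l : Fin (p t), |if j = l then (1 : ℝ) else 0| ≤ 1 := fun j l => by
    split_ifs <;> simp
  have hexp : ∀ (g D : ℝ), |g| ≤ h → (D ≤ |C₁| ∨ D ≤ |C₂|) → ∀ (j l : Fin (p t)) (i : Fin (n t)),
      Integrable (fun X => Real.exp (g * (X i j * X i l))) (PX t) ∧
        ∫ X, Real.exp (g * (X i j * X i l)) ∂(PX t) ≤ D →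
      Integrable (fun X => Real.exp (g * centredProd j l i X)) (PX t) ∧
        ∫ X, Real.exp (g * centredProd j l i X) ∂(PX t) ≤ C := fun g D hg hD j l i ⟨k1, k2⟩ => by
    have e : ∀ X : Design (n t) (p t), Real.exp (g * centredProd j l i X) =
        Real.exp (-g * if j = l then 1 else 0) * Real.exp (g * (X i j * X i l)) := fun X => by
      rw [← Real.exp_add, centredProd]; congr 1; ring
    simp only [e]
    refine ⟨k1.const_mul _, ?_⟩
    rw [integral_const_mul]
    have k3 : Real.exp (-g * if j = l then 1 else 0) ≤ Real.exp h := by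
      apply Real.exp_le_exp.2
      refine (le_abs_self _).trans ?_
      rw [abs_mul, abs_neg]
      calc |g| * _ ≤ h * 1 := mul_le_mul hg (hδ j l) (abs_nonneg _) hh0.le
        _ = h := mul_one h
    refine mul_le_mul k3 (k2.trans ?_) (integral_nonneg fun X => (Real.exp_pos _).le) (Real.exp_pos _).le
    rcases hD with hD | hD <;> linarith [abs_nonneg C₁, abs_nonneg C₂]
  -- The minimizer of `-s (η n / ℓ) + n A s²`; it is admissible once `ℓ ≥ η / (A h)`.
  set s := η / (2 * A * ℓ) with hs
  have hs0 : 0 ≤ s := by positivity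
  have hs1 : s ≤ h / 2 := by
    rw [hs, div_le_iff₀ (by positivity)]
    rw [div_le_iff₀ (by positivity)] at h4
    linarith
  have hfin : ∀ j l : Fin (p t), j ≤ l → (PX t).real {X | η * n t / ℓ ≤ |∑ i, centredProd j l i X|} ≤
      2 * Real.exp (-s * (η * n t / ℓ) + (n t) * (A * s ^ 2)) := fun j l hjl => by
    have a1 := fun i => hexp h C₁ (abs_of_pos hh0).le (Or.inl (le_abs_self _)) j l i (h1 i j l hjl)
    have a2 := fun i => hexp (-h) C₂ (by rw [abs_neg, abs_of_pos hh0]) (Or.inr (le_abs_self _)) j l i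
      (h2 i j l hjl)
    have := measureReal_abs_sum_ge_le (μ := PX t) hh0 (fun i => measurable_centredProd j l i)
      (iIndepFun_centredProd (hX t) j l) (integrable_centredProd (hX t) j l)
      (integral_centredProd (hX t) (hA t) j l) (fun i => (a1 i).1) (fun i => (a2 i).1)
      (fun i => (a1 i).2) (fun i => (a2 i).2) hs0 hs1 (η * n t / ℓ)
    simpa only [Fintype.card_fin] using this
  refine (measureReal_gramDeviates_le hfin).trans ?_
  have e1 : -s * (η * n t / ℓ) + (n t) * (A * s ^ 2) = -(η ^ 2 * n t / (4 * A * ℓ ^ 2)) := by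
    rw [hs]; field_simp; ring
  have e2 : (p t : ℝ) ^ 2 = Real.exp (2 * ℓ) := by
    rw [mul_comm, Real.exp_mul, Real.exp_log hp']; norm_cast
  have e3 : 3 * ℓ ≤ η ^ 2 * n t / (4 * A * ℓ ^ 2) := by
    rw [le_div_iff₀ (by positivity)]
    rw [div_mul_eq_mul_div, le_div_iff₀ (by positivity)] at h3
    linarith
  rw [e1, e2, mul_left_comm, ← Real.exp_add]
  gcongr
  linarith

end sequence

/-! ### Exponents for the scaled columns of a nearly orthogonal design. -/

section
variable {n p : ℕ} {X : Design n p} {b x ℓ : ℝ}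

theorem scaledCols_dotProduct (b : ℝ) (X : Design n p) (j l : Fin p) :
    scaledCols b X j ⬝ᵥ scaledCols b X l = b ^ 2 * ((fun i => X i j) ⬝ᵥ fun i => X i l) := by
  simp only [scaledCols, dotProduct, Finset.mul_sum]
  exact Finset.sum_congr rfl fun i _ => by ring

theorem gramOffDiag_scaledCols (b : ℝ) (X : Design n p) :
    gramOffDiag (scaledCols b X) = b ^ 4 * gramOffDiag fun j i => X i j := by
  simp only [gramOffDiag, Finset.mul_sum]
  refine Finset.sum_congr rfl fun j _ => Finset.sum_congr rfl fun l _ => ?_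
  split_ifs
  · simp
  · rw [scaledCols_dotProduct]; ring

/-- The deviation level `n / (2ℓ)` is chosen so that, after scaling by `b²`, the error is bounded
independently of `p`. Errors in the exponents then cost only constant factors. -/
theorem abs_scaledCols_dotProduct_sub_le (hn : 0 < n) (hℓ : 0 < ℓ) (hb : b ^ 2 * n = x ^ 2 * ℓ)
    (hX : X ∉ gramDeviates n p (1 / 2 * n / ℓ)) (j l : Fin p) :
    |scaledCols b X j ⬝ᵥ scaledCols b X l - if j = l then x ^ 2 * ℓ else 0| ≤ x ^ 2 / 2 := by
  have h1 : |∑ i, centredProd j l i X| ≤ 1 / 2 * n / ℓ := by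
    by_contra h
    push Not at h
    exact hX ⟨j, l, h.le⟩
  rw [sum_centredProd] at h1
  have e : scaledCols b X j ⬝ᵥ scaledCols b X l - (if j = l then x ^ 2 * ℓ else 0) =
      b ^ 2 * ((fun i => X i j) ⬝ᵥ (fun i => X i l) - if j = l then (n : ℝ) else 0) := by
    rw [scaledCols_dotProduct]
    split_ifs
    · rw [← hb]; ring
    · ring
  rw [e, abs_mul, abs_of_nonneg (sq_nonneg b)]
  calc _ ≤ b ^ 2 * (1 / 2 * n / ℓ) := mul_le_mul_of_nonneg_left h1 (sq_nonneg b)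
    _ = b ^ 2 * n / (2 * ℓ) := by field_simp
    _ = x ^ 2 / 2 := by rw [hb]; field_simp

theorem scaledCols_self_mem_Icc (hn : 0 < n) (hℓ : 0 < ℓ) (hb : b ^ 2 * n = x ^ 2 * ℓ)
    (hX : X ∉ gramDeviates n p (1 / 2 * n / ℓ)) (j : Fin p) :
    scaledCols b X j ⬝ᵥ scaledCols b X j ∈
      Set.Icc (x ^ 2 * ℓ - x ^ 2 / 2) (x ^ 2 * ℓ + x ^ 2 / 2) := by
  have := abs_le.1 (abs_scaledCols_dotProduct_sub_le hn hℓ hb hX j j)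
  simp only [if_true] at this
  constructor <;> linarith [this.1, this.2]

/-- Exponent of the tail bounds: `p` to the power `-(√2 - x)² / 2`, where `ℓ = log p`. -/
noncomputable def tailRate (x ℓ : ℝ) : ℝ := Real.exp (-(ℓ * ((√2 - x) ^ 2 / 2)))

/-- With a column of squared length about `x² ℓ`, the score has standardized mean `x √ℓ` and is cut
at `√(2ℓ)`; `κ = √2 / x` is the optimal tilt, moving that mean onto the threshold. The term `1 / 2`
absorbs the deviation of `H`. -/
theorem tail_exponent_le (hx0 : 0 < x) (hx : x ≤ √2) {H : ℝ}
    (hH : H ≤ x ^ 2 * ℓ + x ^ 2 / 2) :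
    ((√2 / x) ^ 2 - 1) * H / 2 - (√2 / x - 1) * (√2 * x * ℓ) ≤
      1 / 2 + -(ℓ * ((√2 - x) ^ 2 / 2)) := by
  have h2 : √2 ^ 2 = 2 := Real.sq_sqrt (by norm_num)
  have hx2 : x ^ 2 ≤ 2 := by rw [← h2]; exact pow_le_pow_left₀ hx0.le hx 2
  have e1 : (√2 / x) ^ 2 - 1 = (2 - x ^ 2) / x ^ 2 := by rw [div_pow, h2]; field_simp
  have h3 : ((√2 / x) ^ 2 - 1) * H ≤ ((√2 / x) ^ 2 - 1) * (x ^ 2 * ℓ + x ^ 2 / 2) := by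
    refine mul_le_mul_of_nonneg_left hH ?_
    rw [e1]
    exact div_nonneg (by linarith) (by positivity)
  have e2 : ((√2 / x) ^ 2 - 1) * (x ^ 2 * ℓ + x ^ 2 / 2) = (2 - x ^ 2) * (ℓ + 1 / 2) := by
    rw [e1]; field_simp
  have e3 : (√2 / x - 1) * (√2 * x * ℓ) = (2 - √2 * x) * ℓ := by
    field_simp; linear_combination ℓ * h2
  have e4 : (√2 - x) ^ 2 = 2 - 2 * (√2 * x) + x ^ 2 := by rw [sub_sq, h2]; ring
  rw [e3, e4]
  rw [e2] at h3
  nlinarith [sq_nonneg x]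

theorem one_le_sqrt_two_div (hx0 : 0 < x) (hx : x ≤ √2) : 1 ≤ √2 / x := by
  rwa [one_le_div hx0]

theorem integral_coshTail_scaledCols_le (hn : 0 < n) (hℓ : 0 < ℓ) (hx0 : 0 < x) (hx : x ≤ √2)
    (hb : b ^ 2 * n = x ^ 2 * ℓ) (hX : X ∉ gramDeviates n p (1 / 2 * n / ℓ)) (j : Fin p) :
    ∫ y, coshTail (√2 * x * ℓ) (scaledCols b X j) y ∂(stdNormal n) ≤
      2 * Real.exp 1 * tailRate x ℓ := by
  refine (integral_coshTail_le (one_le_sqrt_two_div hx0 hx)).trans ?_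
  rw [mul_assoc 2, tailRate, ← Real.exp_add]
  gcongr
  refine (tail_exponent_le hx0 hx (scaledCols_self_mem_Icc hn hℓ hb hX j).2).trans ?_
  linarith

theorem integral_coshTail_mul_scaledCols_le (hn : 0 < n) (hℓ : 0 < ℓ) (hx0 : 0 < x) (hx : x ≤ √2)
    (hb : b ^ 2 * n = x ^ 2 * ℓ) (hX : X ∉ gramDeviates n p (1 / 2 * n / ℓ)) {j l : Fin p}
    (hjl : j ≠ l) :
    ∫ y, coshTail (√2 * x * ℓ) (scaledCols b X j) y * coshTail (√2 * x * ℓ) (scaledCols b X l) y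
      ∂(stdNormal n) ≤ 4 * Real.exp 1 ^ 2 * tailRate x ℓ ^ 2 := by
  have h2 : √2 ^ 2 = 2 := Real.sq_sqrt (by norm_num)
  refine (integral_coshTail_mul_le (one_le_sqrt_two_div hx0 hx)).trans ?_
  have h1 := abs_scaledCols_dotProduct_sub_le hn hℓ hb hX j l
  simp only [hjl, if_false, sub_zero] at h1
  -- The tilt `2 / x²` is exactly compensated by the bound `x² / 2` on the inner product.
  have h3 : |(√2 / x) ^ 2 * (scaledCols b X j ⬝ᵥ scaledCols b X l)| ≤ 1 := by
    rw [abs_mul, abs_of_nonneg (by positivity), div_pow, h2, div_mul_eq_mul_div,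
      div_le_one (by positivity)]
    linarith
  have h4 : Real.cosh ((√2 / x) ^ 2 * (scaledCols b X j ⬝ᵥ scaledCols b X l)) ≤ Real.exp 1 := by
    refine (Real.cosh_le_cosh.2 (h3.trans (le_abs_self 1))).trans ?_
    rw [Real.cosh_eq]
    have : Real.exp (-1) ≤ Real.exp 1 := Real.exp_le_exp.2 (by norm_num)
    linarith
  have h5 := tail_exponent_le hx0 hx (scaledCols_self_mem_Icc hn hℓ hb hX j).2
  have h6 := tail_exponent_le hx0 hx (scaledCols_self_mem_Icc hn hℓ hb hX l).2
  have h7 : Real.exp (((√2 / x) ^ 2 - 1) * (scaledCols b X j ⬝ᵥ scaledCols b X j +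
      scaledCols b X l ⬝ᵥ scaledCols b X l) / 2 - 2 * (√2 / x - 1) * (√2 * x * ℓ)) ≤
      Real.exp 1 * tailRate x ℓ ^ 2 := by
    rw [tailRate, ← Real.exp_nat_mul, ← Real.exp_add]
    apply Real.exp_le_exp.2
    push_cast
    linarith
  calc _ ≤ 4 * (Real.exp 1 * tailRate x ℓ ^ 2) * Real.exp 1 := by
        have := Real.cosh_pos ((√2 / x) ^ 2 * (scaledCols b X j ⬝ᵥ scaledCols b X l))
        gcongr
    _ = _ := by ring

/-- Lower bound for the expected truncated likelihood ratio at a nearly orthogonal design. -/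
theorem le_integral_min_one_mixRatio_scaledCols {h ε D M S : ℝ} (hn : 0 < n) (hℓ : 1 ≤ ℓ)
    (hx0 : 0 < x) (hx : x ≤ √2) (hb : b ^ 2 * n = x ^ 2 * ℓ)
    (h0 : 0 ≤ h) (h1 : h ≤ 1 / 4) (hε : 0 < ε)
    (hX : X ∉ gramDeviates n p (1 / 2 * n / ℓ)) (hS : gramOffDiag (fun j i => X i j) ≤ S)
    (hD : ∀ j, ∫ y, (coshTrunc (√2 * x * ℓ) (scaledCols b X j) y - 1) ^ 2 ∂(stdNormal n) ≤ D)
    (hM : ∀ j, scaledCols b X j ⬝ᵥ scaledCols b X j *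
      ∫ y, sinhTrunc (√2 * x * ℓ) (scaledCols b X j) y ^ 2 ∂(stdNormal n) ≤ M) :
    1 - ε - (1 / ε + 19) * (h ^ 2 * ((2 + 4 * Real.exp 1 * tailRate x ℓ / (x ^ 2 * ℓ)) * (b ^ 4 * S) +
      (p : ℝ) ^ 2 * (4 * Real.exp 1 ^ 2 * tailRate x ℓ ^ 2) + p * D + p * M)) ≤
      ∫ y, min 1 (mixRatio h (scaledCols b X) y) ∂(stdNormal n) := by
  have hℓ0 : 0 < ℓ := by linarith
  have hE : 0 < tailRate x ℓ := Real.exp_pos _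
  have hx2 : x ^ 2 ≤ 2 := by
    calc x ^ 2 ≤ √2 ^ 2 := pow_le_pow_left₀ hx0.le hx 2
      _ = 2 := Real.sq_sqrt (by norm_num)
  -- For `ℓ ≥ 1` the deviation `x² / 2` is at most half of `x² ℓ`, which gives the value of `H₀`.
  have key := le_integral_min_one_mixRatio (T := √2 * x * ℓ) (w := scaledCols b X)
    (H₀ := x ^ 2 * ℓ / 2) h0 h1 hε (by positivity)
    (by positivity : 0 ≤ 4 * Real.exp 1 ^ 2 * tailRate x ℓ ^ 2)
    (fun j => by
      have := (scaledCols_self_mem_Icc hn hℓ0 hb hX j).1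
      nlinarith [sq_nonneg x])
    (fun j l hjl => by
      have := abs_scaledCols_dotProduct_sub_le hn hℓ0 hb hX j l
      simp only [hjl, if_false, sub_zero] at this
      linarith)
    (integral_coshTail_scaledCols_le hn hℓ0 hx0 hx hb hX)
    (fun j l hjl => integral_coshTail_mul_scaledCols_le hn hℓ0 hx0 hx hb hX hjl) hD hM
  refine le_trans ?_ key
  rw [gramOffDiag_scaledCols]
  have e : 2 * Real.exp 1 * tailRate x ℓ / (x ^ 2 * ℓ / 2) =
      4 * Real.exp 1 * tailRate x ℓ / (x ^ 2 * ℓ) := by field_simp; norm_num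
  rw [e]
  gcongr

/-- For the dense regime: the column is short, so the untruncated second moment already has
quadratic size and only the tail mean is added. -/
theorem integral_coshTrunc_sub_one_sq_scaledCols_le_of_small (hn : 0 < n) (hℓ : 1 ≤ ℓ)
    (hx0 : 0 < x) (hx : x ≤ √2) (hb : b ^ 2 * n = x ^ 2 * ℓ)
    (hX : X ∉ gramDeviates n p (1 / 2 * n / ℓ)) (hy : b ^ 2 * n ≤ 1 / 2) (j : Fin p) :
    ∫ y, (coshTrunc (√2 * x * ℓ) (scaledCols b X j) y - 1) ^ 2 ∂(stdNormal n) ≤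
        4 * (b ^ 2 * n) ^ 2 + 4 * Real.exp 1 * tailRate x ℓ ∧
      scaledCols b X j ⬝ᵥ scaledCols b X j *
        ∫ y, sinhTrunc (√2 * x * ℓ) (scaledCols b X j) y ^ 2 ∂(stdNormal n) ≤
        8 * (b ^ 2 * n) ^ 2 := by
  have hℓ0 : 0 < ℓ := by linarith
  obtain ⟨k1, k2⟩ := scaledCols_self_mem_Icc hn hℓ0 hb hX j
  have hq := integral_coshTail_scaledCols_le hn hℓ0 hx0 hx hb hX j
  set H := scaledCols b X j ⬝ᵥ scaledCols b X j
  have hH0 : 0 ≤ H := by nlinarith [sq_nonneg x]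
  have hH2 : H ≤ 2 * (b ^ 2 * n) := by rw [hb]; nlinarith [sq_nonneg x]
  have hH1 : |H| ≤ 1 := by rw [abs_of_nonneg hH0]; linarith
  have hHs : H ^ 2 ≤ 4 * (b ^ 2 * n) ^ 2 := by nlinarith
  constructor
  · rw [integral_coshTrunc_sub_one_sq]
    have := integral_coshTrunc_sq_le (T := √2 * x * ℓ) (w := scaledCols b X j)
    have := cosh_sub_one_le_sq hH1
    linarith
  · have h3 := mul_le_mul_of_nonneg_left
      (integral_sinhTrunc_sq_le (T := √2 * x * ℓ) (w := scaledCols b X j)) hH0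
    have := mul_sinh_le hH1
    linarith

/-- Growth exponent of the second moment of the truncated likelihood ratio of one coordinate. -/
noncomputable def diagExponent (x : ℝ) : ℝ :=
  if x ≤ √2 / 2 then x ^ 2 else 1 - (√2 - x) ^ 2

/-- The second moment lives near standardized score `2x √ℓ`. For `x ≤ √2 / 2` this is below the cut
`√(2ℓ)` and truncation gains nothing; beyond, the tilt `κ = √2 / x ≤ 2` places the mass at the cut
and lowers the exponent. -/
theorem integral_coshTrunc_sq_scaledCols_le (hn : 0 < n) (hℓ : 0 < ℓ)
    (hx0 : 0 < x) (hx : x ≤ √2) (hb : b ^ 2 * n = x ^ 2 * ℓ)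
    (hX : X ∉ gramDeviates n p (1 / 2 * n / ℓ)) (j : Fin p) :
    ∫ y, coshTrunc (√2 * x * ℓ) (scaledCols b X j) y ^ 2 ∂(stdNormal n) ≤
      2 * Real.exp 1 * Real.exp (ℓ * diagExponent x) := by
  have h2 : √2 ^ 2 = 2 := Real.sq_sqrt (by norm_num)
  obtain ⟨k1, k2⟩ := scaledCols_self_mem_Icc hn hℓ hb hX j
  have hx2 : x ^ 2 ≤ 2 := by rw [← h2]; exact pow_le_pow_left₀ hx0.le hx 2
  rw [mul_assoc 2, ← Real.exp_add]
  unfold diagExponent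
  split_ifs with hs
  · refine integral_coshTrunc_sq_le.trans ?_
    set H := scaledCols b X j ⬝ᵥ scaledCols b X j
    rw [Real.cosh_eq]
    have hH0 : 0 ≤ H := Finset.sum_nonneg fun i _ => mul_self_nonneg _
    have e1 : Real.exp (-H) ≤ Real.exp H := Real.exp_le_exp.2 (by linarith)
    have e2 : Real.exp H ≤ Real.exp (1 + ℓ * x ^ 2) := Real.exp_le_exp.2 (by linarith)
    linarith [Real.exp_pos (1 + ℓ * x ^ 2)]
  · push Not at hs
    have hκ : √2 / x ≤ 2 := by rw [div_le_iff₀ hx0]; linarith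
    refine (integral_coshTrunc_sq_le_of_le_two (by positivity) hκ).trans ?_
    refine mul_le_mul_of_nonneg_left (Real.exp_le_exp.2 ?_) zero_le_two
    set H := scaledCols b X j ⬝ᵥ scaledCols b X j
    have e1 : (√2 / x) ^ 2 / 2 - 1 = (1 - x ^ 2) / x ^ 2 := by rw [div_pow, h2]; field_simp
    have e2 : (2 - √2 / x) * (√2 * x * ℓ) = (2 * (√2 * x) - 2) * ℓ := by
      field_simp; linear_combination (-1 : ℝ) * h2
    have e4 : (√2 - x) ^ 2 = 2 - 2 * (√2 * x) + x ^ 2 := by rw [sub_sq, h2]; ring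
    have e3 : (1 - x ^ 2) / x ^ 2 * H ≤ (1 - x ^ 2) * ℓ + 1 := by
      rw [div_mul_eq_mul_div, div_le_iff₀ (by positivity)]
      have : (1 - x ^ 2) * (H - x ^ 2 * ℓ) ≤ 1 * (x ^ 2 / 2) := by
        refine (le_abs_self _).trans ?_
        rw [abs_mul]
        exact mul_le_mul (abs_le.2 ⟨by linarith, by linarith [sq_nonneg x]⟩)
          (abs_le.2 ⟨by linarith, by linarith⟩) (abs_nonneg _) zero_le_one
      nlinarith [sq_nonneg x]
    rw [e1, e2, e4]
    linarith

theorem integral_coshTrunc_sub_one_sq_scaledCols_le (hn : 0 < n) (hℓ : 1 ≤ ℓ)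
    (hx0 : 0 < x) (hx : x ≤ √2) (hb : b ^ 2 * n = x ^ 2 * ℓ)
    (hX : X ∉ gramDeviates n p (1 / 2 * n / ℓ)) (j : Fin p) :
    ∫ y, (coshTrunc (√2 * x * ℓ) (scaledCols b X j) y - 1) ^ 2 ∂(stdNormal n) ≤
        2 * Real.exp 1 * Real.exp (ℓ * diagExponent x) + 1 ∧
      scaledCols b X j ⬝ᵥ scaledCols b X j *
        ∫ y, sinhTrunc (√2 * x * ℓ) (scaledCols b X j) y ^ 2 ∂(stdNormal n) ≤
        4 * ℓ * (2 * Real.exp 1 * Real.exp (ℓ * diagExponent x)) := by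
  have hℓ0 : 0 < ℓ := by linarith
  have hR := integral_coshTrunc_sq_scaledCols_le hn hℓ0 hx0 hx hb hX j
  have hx2 : x ^ 2 ≤ 2 := by
    calc x ^ 2 ≤ √2 ^ 2 := pow_le_pow_left₀ hx0.le hx 2
      _ = 2 := Real.sq_sqrt (by norm_num)
  refine ⟨integral_coshTrunc_sub_one_sq_le_add_one.trans (by linarith), ?_⟩
  refine mul_le_mul ?_ (integral_sinhTrunc_sq_le_coshTrunc_sq.trans hR)
    (integral_nonneg fun y => sq_nonneg _) (by positivity)
  -- The squared length is at most `2ℓ + 1`, hence at most `4ℓ`.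
  have := (scaledCols_self_mem_Icc hn hℓ0 hb hX j).2
  nlinarith

end

/-! ### Assembling the error terms. -/

theorem le_integral_of_forall_notMem {Ω : Type*} [MeasurableSpace Ω] {μ : Measure Ω}
    [IsProbabilityMeasure μ] {g : Ω → ℝ} {a : ℝ} {s : Set Ω} (hg : Integrable g μ)
    (h0 : ∀ ω, 0 ≤ g ω) (ha : a ≤ 1) (h : ∀ ω ∉ s, a ≤ g ω) : a - μ.real s ≤ ∫ ω, g ω ∂μ := by
  -- The exceptional set is not assumed measurable, so a measurable hull of the same measure is
  -- used.
  have hm := measurableSet_toMeasurable μ s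
  have hi : Integrable ((toMeasurable μ s).indicator fun _ => (1 : ℝ)) μ :=
    (integrable_const 1).indicator hm
  have e : a - μ.real s = ∫ ω, (a - (toMeasurable μ s).indicator (fun _ => (1 : ℝ)) ω) ∂μ := by
    rw [integral_sub (integrable_const a) hi, integral_indicator_const _ hm]
    simp [measureReal_def]
  rw [e]
  refine integral_mono ((integrable_const a).sub hi) hg fun ω => ?_
  dsimp only
  by_cases hω : ω ∈ toMeasurable μ s
  · rw [Set.indicator_of_mem hω]; linarith [h0 ω]
  · rw [Set.indicator_of_notMem hω, sub_zero]
    exact h ω fun hs => hω (subset_toMeasurable μ s hs)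

/-- Since `h p ≤ k` and `b² k = r² / c`, the Gram part becomes `r⁴ n`, the pair tails `(k E)²`, and
the diagonal keeps the factor `k² / p`. -/
theorem error_bound_le {n p : ℕ} {k r h b c x ℓ E K D M : ℝ} (hn : 0 < n) (hp : 0 < p)
    (hk : 0 < k) (hc : 0 < c) (h0 : 0 ≤ h) (hh : h ≤ k / p) (hb : b ^ 2 = r ^ 2 / (c * k))
    (hbn : b ^ 2 * n = x ^ 2 * ℓ) (hr : 0 < r) (hE : 0 ≤ E) (hK : 0 ≤ K) (hDM : 0 ≤ D + M) :
    h ^ 2 * ((2 + 4 * Real.exp 1 * E / (x ^ 2 * ℓ)) * (b ^ 4 * (K * ((p : ℝ) ^ 2 * n))) +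
      (p : ℝ) ^ 2 * (4 * Real.exp 1 ^ 2 * E ^ 2) + p * D + p * M) ≤
      2 * K / c ^ 2 * ((r ^ 2) ^ 2 * n) + 4 * Real.exp 1 * K / c * (r ^ 2 * (k * E)) +
        4 * Real.exp 1 ^ 2 * (k * E) ^ 2 + k ^ 2 / p * (D + M) := by
  have hp' : (0 : ℝ) < p := by exact_mod_cast hp
  have hn' : (0 : ℝ) < n := by exact_mod_cast hn
  have hh2 : h ^ 2 ≤ (k / p) ^ 2 := pow_le_pow_left₀ h0 hh 2
  rw [← hbn, show b ^ 4 = (b ^ 2) ^ 2 by ring, hb]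
  have hpos : 0 ≤ (2 + 4 * Real.exp 1 * E / (r ^ 2 / (c * k) * n)) *
      ((r ^ 2 / (c * k)) ^ 2 * (K * ((p : ℝ) ^ 2 * n))) +
      (p : ℝ) ^ 2 * (4 * Real.exp 1 ^ 2 * E ^ 2) + p * (D + M) := by positivity
  rw [add_assoc, ← mul_add]
  refine (mul_le_mul_of_nonneg_right hh2 hpos).trans (le_of_eq ?_)
  field_simp

section sequence
variable {n p : ℕ → ℕ} {PX : ∀ t, Measure (Design (n t) (p t))} [∀ t, IsProbabilityMeasure (PX t)]

/-- The common core of the dense and sparse regimes, which differ only in the diagonal bounds `D`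
and `M` and in the effective signal `x`. -/
theorem tendsto_minimaxError {k r x D M : ℕ → ℝ} {δ : ℝ}
    (hn : Tendsto n atTop atTop) (hp : Tendsto p atTop atTop)
    (hX : ∀ t, IsStandardDesign (PX t)) (hA : ∀ t, UncorrelatedDesign (PX t))
    (hB1 : FourthMomentBound PX)
    (hdev : Tendsto (fun t => (PX t).real (gramDeviates (n t) (p t)
      (1 / 2 * n t / Real.log (p t)))) atTop (𝓝 0))
    (hδ : 0 < δ) (hδ2 : δ < 1 / 2) (hr : ∀ t, 0 < r t)
    (hk : Tendsto k atTop atTop) (hkp : Tendsto (fun t => k t / p t) atTop (𝓝 0))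
    (hx0 : ∀ᶠ t in atTop, 0 < x t) (hx : ∀ᶠ t in atTop, x t ≤ √2)
    (hxr : ∀ᶠ t in atTop, r t ^ 2 / ((1 - 2 * δ) * k t) * n t = x t ^ 2 * Real.log (p t))
    (hE : Tendsto (fun t => k t * tailRate (x t) (Real.log (p t))) atTop (𝓝 0))
    (hr4 : Tendsto (fun t => (r t ^ 2) ^ 2 * n t) atTop (𝓝 0))
    (hr2 : Tendsto (fun t => r t ^ 2) atTop (𝓝 0))
    (hDM : ∀ᶠ t in atTop, 0 ≤ D t + M t ∧
      ∀ X ∉ gramDeviates (n t) (p t) (1 / 2 * n t / Real.log (p t)), ∀ j,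
        let w := scaledCols (r t / √((1 - 2 * δ) * k t)) X j
        ∫ y, (coshTrunc (√2 * x t * Real.log (p t)) w y - 1) ^ 2 ∂(stdNormal (n t)) ≤ D t ∧
          w ⬝ᵥ w * ∫ y, sinhTrunc (√2 * x t * Real.log (p t)) w y ^ 2 ∂(stdNormal (n t)) ≤ M t)
    (hdiag : Tendsto (fun t => k t ^ 2 / p t * (D t + M t)) atTop (𝓝 0)) :
    Tendsto (fun t => minimaxError (PX t) (k t) (r t)) atTop (𝓝 1) := by
  obtain ⟨C, hC⟩ := hB1
  have hlog : Tendsto (fun t => Real.log (p t)) atTop atTop :=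
    Real.tendsto_log_atTop.comp (tendsto_natCast_atTop_atTop.comp hp)
  have hc : 0 < 1 - 2 * δ := by linarith
  rw [Metric.tendsto_nhds]
  intro ε₀ hε₀
  -- The losses are `2ε` on good designs, `2ε` for bad designs and `ε` for the prior mass, so `5ε <
  -- ε₀`.
  set ε := ε₀ / 6 with hε
  have hε0 : 0 < ε := by positivity
  -- By Markov, the sum of squared off-diagonal Gram entries reaches `K p² n` with probability at
  -- most `ε`.
  set K := (1 + |C|) / ε with hK
  have hK0 : 0 < K := by positivity
  have herr : Tendsto (fun t => (1 / ε + 19) * (2 * K / (1 - 2 * δ) ^ 2 * ((r t ^ 2) ^ 2 * n t) +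
      4 * Real.exp 1 * K / (1 - 2 * δ) * (r t ^ 2 * (k t * tailRate (x t) (Real.log (p t)))) +
      4 * Real.exp 1 ^ 2 * (k t * tailRate (x t) (Real.log (p t))) ^ 2 +
      k t ^ 2 / p t * (D t + M t))) atTop (𝓝 0) := by
    have := ((((hr4.const_mul (2 * K / (1 - 2 * δ) ^ 2)).add
      ((hr2.mul hE).const_mul (4 * Real.exp 1 * K / (1 - 2 * δ)))).add
      ((hE.pow 2).const_mul (4 * Real.exp 1 ^ 2))).add hdiag).const_mul (1 / ε + 19)
    simpa using this
  have hmass : Tendsto (fun t => 1 / (δ ^ 2 * k t)) atTop (𝓝 0) :=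
    (hk.const_mul_atTop (by positivity : 0 < δ ^ 2)).const_div_atTop 1
  filter_upwards [hC, hx0, hx, hxr, hDM, hn.eventually_gt_atTop 0, hp.eventually_gt_atTop 0,
    hlog.eventually_ge_atTop 1, hk.eventually_gt_atTop 0,
    hkp.eventually_le_const (by norm_num : (0 : ℝ) < 1 / 4), herr.eventually_lt_const hε0,
    hmass.eventually_lt_const hε0, hdev.eventually_lt_const hε0]
    with t h1 h2 h3 h4 h5 hnt hpt hℓ hkt hkpt he hm hd
  have hp' : (0 : ℝ) < p t := by exact_mod_cast hpt
  have hn' : (0 : ℝ) < n t := by exact_mod_cast hnt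
  set ℓ := Real.log (p t) with hℓdef
  set h := (1 - δ) * k t / p t with hh
  set b := r t / √((1 - 2 * δ) * k t) with hb
  have hb2 : b ^ 2 = r t ^ 2 / ((1 - 2 * δ) * k t) := by
    rw [hb, div_pow, Real.sq_sqrt (by positivity)]
  have h0 : 0 ≤ h := by
    have : 0 ≤ 1 - δ := by linarith
    positivity
  have hhk : h ≤ k t / p t := by
    rw [hh]
    gcongr
    nlinarith
  have hbn : b ^ 2 * n t = x t ^ 2 * ℓ := by rw [hb2]; exact h4
  have hkp1 : k t ≤ p t := by
    rw [div_le_iff₀ hp'] at hkpt; linarith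
  obtain ⟨iS, bS⟩ := integral_gramOffDiag_le (hX t) (hA t) h1
  have hSnonneg : ∀ X : Design (n t) (p t), 0 ≤ gramOffDiag fun j i => X i j := fun X =>
    Finset.sum_nonneg fun j _ => Finset.sum_nonneg fun l _ => by
      split_ifs
      · exact le_rfl
      · exact sq_nonneg _
  set u := K * ((p t : ℝ) ^ 2 * n t) with hu
  have hu0 : 0 < u := by positivity
  have hmarkov : (PX t).real {X | u ≤ gramOffDiag fun j i => X i j} ≤ ε := by
    have h6 := (mul_meas_ge_le_integral_of_nonneg (Eventually.of_forall hSnonneg) iS u).trans bS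
    have e : (p t : ℝ) ^ 2 * ((1 + |C|) * n t) = u * ε := by rw [hu, hK]; field_simp
    rw [e] at h6
    exact le_of_mul_le_mul_left h6 hu0
  set bad := gramDeviates (n t) (p t) (1 / 2 * n t / ℓ) ∪ {X | u ≤ gramOffDiag fun j i => X i j}
    with hbad
  have hbadP : (PX t).real bad ≤ 2 * ε := by
    have := measureReal_union_le (μ := PX t) (gramDeviates (n t) (p t) (1 / 2 * n t / ℓ))
      {X | u ≤ gramOffDiag fun j i => X i j}
    linarith
  have hgood : ∀ X ∉ bad, 1 - 2 * ε ≤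
      ∫ y, min 1 (mixRatio h (scaledCols b X) y) ∂(stdNormal (n t)) := fun X hXb => by
    have hX1 : X ∉ gramDeviates (n t) (p t) (1 / 2 * n t / ℓ) := fun h => hXb (Or.inl h)
    have hX2 : gramOffDiag (fun j i => X i j) ≤ u := by
      by_contra h
      push Not at h
      exact hXb (Or.inr h.le)
    have key := le_integral_min_one_mixRatio_scaledCols hnt hℓ h2 h3 hbn h0 (hhk.trans hkpt) hε0
      hX1 hX2 (fun j => (h5.2 X hX1 j).1) (fun j => (h5.2 X hX1 j).2)
    have hbd := error_bound_le (E := tailRate (x t) ℓ) (K := K) (D := D t) (M := M t) hnt hpt hkt hc h0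
      hhk hb2 hbn (hr t) (Real.exp_pos _).le hK0.le h5.1
    have := mul_le_mul_of_nonneg_left hbd (by positivity : 0 ≤ 1 / ε + 19)
    linarith
  have hint := le_integral_of_forall_notMem
    (integrable_integral_min_one_mixRatio (PX := PX t) h0 ((hhk.trans hkpt).trans (by norm_num)) b)
    (fun X => integral_nonneg fun y => (min_one_mixRatio_mem_Icc h0
      ((hhk.trans hkpt).trans (by norm_num)) _ _).1) (by linarith : 1 - 2 * ε ≤ 1) hgood
  have hlow := le_minimaxError (PX := PX t) h0 ((hhk.trans hkpt).trans (by norm_num)) (k t) (r t) b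
  have hprior := priorMassOutside_le hkt (hr t) hδ hδ2 hkp1
  have hup := minimaxError_le_one (PX := PX t) (k t) (r t)
  rw [Real.dist_eq, abs_sub_lt_iff]
  constructor <;> linarith

end sequence

/-! ### Exponents below the detection boundary. -/

theorem phi_le {β : ℝ} (hβ : 1 / 2 < β) (hβ1 : β < 1) : phi β ≤ √2 * (1 - √(1 - β)) := by
  unfold phi
  split_ifs
  · have hs := Real.sq_sqrt (by linarith : 0 ≤ 1 - β)
    have h : √(1 - β) ≤ 1 := Real.sqrt_le_one.2 (by linarith)
    refine Real.sqrt_le_iff.2 ⟨mul_nonneg (Real.sqrt_nonneg _) (by linarith), ?_⟩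
    rw [mul_pow, Real.sq_sqrt (by norm_num)]
    -- The difference of the two squares is `(1 - 2 √(1 - β))²`: the branches touch at `β = 3 / 4`,
    -- and the tail condition holds below `phi` for all `β`.
    nlinarith [sq_nonneg (1 - 2 * √(1 - β))]
  · exact le_rfl

theorem phi_pos {β : ℝ} (hβ : 1 / 2 < β) : 0 < phi β := by
  unfold phi
  split_ifs
  · exact Real.sqrt_pos.2 (by linarith)
  · refine mul_pos (by positivity) (sub_pos.2 ?_)
    rw [Real.sqrt_lt' one_pos]
    linarith

/-- Strictly below the detection boundary, both relevant exponents are bounded away from zero. -/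
theorem exists_exponent_gap {β x₀ : ℝ} (hβ : 1 / 2 < β) (hβ1 : β < 1) (h0 : 0 < x₀)
    (hx₀ : x₀ < phi β) :
    x₀ ≤ √2 ∧ ∃ ε > 0, ∀ x, 0 < x → x ≤ x₀ →
      1 - β + ε ≤ (√2 - x) ^ 2 / 2 ∧ 1 - 2 * β + diagExponent x ≤ -ε := by
  have h2 : √2 ^ 2 = 2 := Real.sq_sqrt (by norm_num)
  have hs := Real.sq_sqrt (by linarith : 0 ≤ 1 - β)
  have hs0 : 0 < √(1 - β) := Real.sqrt_pos.2 (by linarith)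
  have h20 : 0 < √2 := by positivity
  have hd : √2 * √(1 - β) < √2 - x₀ := by linarith [phi_le hβ hβ1]
  have hd0 : 0 < √2 * √(1 - β) := by positivity
  have hd2 : 2 * (1 - β) < (√2 - x₀) ^ 2 := by
    have := pow_lt_pow_left₀ hd hd0.le two_ne_zero
    rwa [mul_pow, h2, hs] at this
  -- For `β ≤ 3 / 4` this is the boundary `√(2β - 1)` itself; for larger `β` it is automatic, since
  -- `x² ≤ 1 / 2`.
  have hgap : ∃ ε > 0, ∀ x, 0 < x → x ≤ x₀ → x ≤ √2 / 2 → 1 - 2 * β + x ^ 2 ≤ -ε := by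
    by_cases hb : β ≤ 3 / 4
    · rw [phi, if_pos hb, Real.lt_sqrt h0.le] at hx₀
      exact ⟨2 * β - 1 - x₀ ^ 2, by linarith, fun x h1 h3 _ => by
        linarith [pow_le_pow_left₀ h1.le h3 2]⟩
    · push Not at hb
      refine ⟨2 * β - 3 / 2, by linarith, fun x h1 _ h3 => ?_⟩
      have := pow_le_pow_left₀ h1.le h3 2
      rw [div_pow, h2] at this
      linarith
  obtain ⟨ε, hε, hgap⟩ := hgap
  refine ⟨by linarith, min ((√2 - x₀) ^ 2 / 2 - (1 - β)) ε, lt_min (by linarith) hε,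
    fun x h1 h3 => ?_⟩
  have m1 := min_le_left ((√2 - x₀) ^ 2 / 2 - (1 - β)) ε
  have m2 := min_le_right ((√2 - x₀) ^ 2 / 2 - (1 - β)) ε
  have hmono : (√2 - x₀) ^ 2 ≤ (√2 - x) ^ 2 :=
    pow_le_pow_left₀ (by linarith) (by linarith) 2
  refine ⟨by linarith, ?_⟩
  unfold diagExponent
  split_ifs with hx
  · linarith [hgap x h1 h3 hx]
  -- In this branch the diagonal exponent is `2 (1 - β) - (√2 - x)²`, minus twice the margin of the
  -- tail condition.
  · linarith

/-- In `EReal` the limsup is meaningful without any boundedness of `f`, so its negativity really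
gives a uniform eventual margin. -/
theorem exists_eventually_le_of_limsup_lt_zero {f : ℕ → ℝ}
    (h : limsup (fun t => (f t : EReal)) atTop < 0) : ∃ c > 0, ∀ᶠ t in atTop, f t ≤ -c := by
  obtain ⟨a, h1, h2⟩ := EReal.lt_iff_exists_real_btwn.1 h
  refine ⟨-a, neg_pos.2 (by exact_mod_cast h2), ?_⟩
  filter_upwards [eventually_lt_of_limsup_lt h1] with t ht
  rw [neg_neg]
  exact_mod_cast ht.le

theorem tendsto_exp_neg_mul {ℓ : ℕ → ℝ} (hℓ : Tendsto ℓ atTop atTop) {ε : ℝ} (hε : 0 < ε) :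
    Tendsto (fun t => Real.exp (-(ε * ℓ t))) atTop (𝓝 0) :=
  Real.tendsto_exp_neg_atTop_nhds_zero.comp (hℓ.const_mul_atTop hε)

theorem tendsto_mul_exp_neg_mul {ℓ : ℕ → ℝ} (hℓ : Tendsto ℓ atTop atTop) {ε : ℝ} (hε : 0 < ε) :
    Tendsto (fun t => ℓ t * Real.exp (-(ε * ℓ t))) atTop (𝓝 0) := by
  have := (tendsto_rpow_mul_exp_neg_mul_atTop_nhds_zero 1 ε hε).comp hℓ
  simpa [Function.comp_def] using this

theorem tendsto_mul_tailRate {β ε : ℝ} {x ℓ k : ℕ → ℝ} (hε : 0 < ε)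
    (hℓ : Tendsto ℓ atTop atTop) (hk : ∀ᶠ t in atTop, k t = Real.exp (ℓ t * (1 - β)))
    (hx : ∀ᶠ t in atTop, 1 - β + ε ≤ (√2 - x t) ^ 2 / 2) :
    Tendsto (fun t => k t * tailRate (x t) (ℓ t)) atTop (𝓝 0) := by
  refine squeeze_zero' ?_ ?_ (tendsto_exp_neg_mul hℓ hε)
  · filter_upwards [hk] with t h1
    rw [h1, tailRate]
    positivity
  · filter_upwards [hk, hx, hℓ.eventually_ge_atTop 0] with t h1 h2 h3
    rw [h1, tailRate, ← Real.exp_add]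
    refine Real.exp_le_exp.2 ?_
    nlinarith

/-! ### The sparse and dense regimes. -/

section sequence
variable {n p : ℕ → ℕ} {PX : ∀ t, Measure (Design (n t) (p t))} [∀ t, IsProbabilityMeasure (PX t)]
  {β δ : ℝ} {k r : ℕ → ℝ}

/-- The prior inflates the signal by `1 / √(1 - 2δ)`. The strict gap to the boundary leaves room for
this, after which both exponents stay away from zero. -/
theorem tendsto_minimaxError_of_sparse
    (hn : Tendsto n atTop atTop) (hp : Tendsto p atTop atTop)
    (hX : ∀ t, IsStandardDesign (PX t)) (hA : ∀ t, UncorrelatedDesign (PX t))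
    (hB1 : FourthMomentBound PX)
    (hdev : Tendsto (fun t => (PX t).real (gramDeviates (n t) (p t)
      (1 / 2 * n t / Real.log (p t)))) atTop (𝓝 0))
    (hr : ∀ t, 0 < r t) (hk : Tendsto k atTop atTop)
    (hkp : Tendsto (fun t => k t / p t) atTop (𝓝 0))
    (hr4 : Tendsto (fun t => (r t ^ 2) ^ 2 * n t) atTop (𝓝 0))
    (hr2 : Tendsto (fun t => r t ^ 2) atTop (𝓝 0))
    (hke : ∀ᶠ t in atTop, k t = Real.exp (Real.log (p t) * (1 - β)))
    (hβ : 1 / 2 < β) (hβ1 : β < 1)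
    (hL : limsup (fun t =>
        ((r t / √(k t * Real.log (p t) / (n t : ℝ)) - phi β : ℝ) : EReal)) atTop < 0) :
    Tendsto (fun t => minimaxError (PX t) (k t) (r t)) atTop (𝓝 1) := by
  have hℓ : Tendsto (fun t => Real.log (p t)) atTop atTop :=
    Real.tendsto_log_atTop.comp (tendsto_natCast_atTop_atTop.comp hp)
  obtain ⟨c, hc, hcL⟩ := exists_eventually_le_of_limsup_lt_zero hL
  have hφ := phi_pos hβ
  -- The margin is capped so that `phi β - c' / 2` remains positive.
  obtain ⟨c', hc', hc'c, hc'φ⟩ : ∃ c' > 0, c' ≤ c ∧ c' < phi β :=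
    ⟨min c (phi β / 2), lt_min hc (by linarith), min_le_left _ _,
      (min_le_right _ _).trans_lt (by linarith)⟩
  obtain ⟨h2, ε, hε, hgap⟩ := exists_exponent_gap hβ hβ1 (by linarith : 0 < phi β - c' / 2)
    (by linarith)
  -- By continuity at `δ = 0`, half of the margin pays for the inflation.
  obtain ⟨δ, hδ, hδ2, hδ3⟩ : ∃ δ > 0, δ < 1 / 2 ∧
      phi β - c' ≤ √(1 - 2 * δ) * (phi β - c' / 2) := by
    have hlim : Tendsto (fun δ : ℝ => √(1 - 2 * δ) * (phi β - c' / 2)) (𝓝[>] 0)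
        (𝓝 (√(1 - 2 * 0) * (phi β - c' / 2))) :=
      ((by fun_prop : Continuous fun δ : ℝ => √(1 - 2 * δ) * (phi β - c' / 2)).tendsto
        0).mono_left nhdsWithin_le_nhds
    rw [mul_zero, sub_zero, Real.sqrt_one, one_mul] at hlim
    have h1 := hlim.eventually_const_le (by linarith : phi β - c' < phi β - c' / 2)
    obtain ⟨δ, h3, h4, h5⟩ := (h1.and (Ioo_mem_nhdsGT (by norm_num : (0 : ℝ) < 1 / 2))).exists
    exact ⟨δ, h4, h5, h3⟩
  have hδ0 : 0 < 1 - 2 * δ := by linarith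
  set x : ℕ → ℝ := fun t => r t / √(k t * Real.log (p t) / n t) / √(1 - 2 * δ) with hxdef
  have hx0 : ∀ᶠ t in atTop, 0 < x t := by
    filter_upwards [hn.eventually_gt_atTop 0, hk.eventually_gt_atTop 0,
      hℓ.eventually_gt_atTop 0] with t h1 h3 h4
    have := hr t
    have : (0 : ℝ) < n t := by exact_mod_cast h1
    simp only [hxdef]
    positivity
  have hxle : ∀ᶠ t in atTop, x t ≤ phi β - c' / 2 := by
    filter_upwards [hcL] with t ht
    rw [hxdef, div_le_iff₀ (by positivity)]
    linarith
  have hxr : ∀ᶠ t in atTop, r t ^ 2 / ((1 - 2 * δ) * k t) * n t = x t ^ 2 * Real.log (p t) := by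
    filter_upwards [hn.eventually_gt_atTop 0, hk.eventually_gt_atTop 0,
      hℓ.eventually_gt_atTop 0] with t h1 h3 h4
    have : (0 : ℝ) < n t := by exact_mod_cast h1
    simp only [hxdef]
    rw [div_pow, div_pow, Real.sq_sqrt (by positivity), Real.sq_sqrt hδ0.le]
    field_simp
  have hE := tendsto_mul_tailRate hε hℓ hke (x := x) (by
    filter_upwards [hx0, hxle] with t h1 h3 using (hgap _ h1 h3).1)
  refine tendsto_minimaxError (x := x) (δ := δ)
    (D := fun t => 2 * Real.exp 1 * Real.exp (Real.log (p t) * diagExponent (x t)) + 1)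
    (M := fun t => 4 * Real.log (p t) *
      (2 * Real.exp 1 * Real.exp (Real.log (p t) * diagExponent (x t))))
    hn hp hX hA hB1 hdev hδ hδ2 hr hk hkp hx0 (hxle.mono fun t h => h.trans h2) hxr hE hr4 hr2 ?_ ?_
  · filter_upwards [hx0, hxle, hxr, hn.eventually_gt_atTop 0, hℓ.eventually_ge_atTop 1,
      hk.eventually_gt_atTop 0] with t h1 h3 h4 h5 h6 h7
    refine ⟨by positivity, fun X hXt j => ?_⟩
    refine integral_coshTrunc_sub_one_sq_scaledCols_le h5 h6 h1 (h3.trans h2) ?_ hXt j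
    rw [div_pow, Real.sq_sqrt (by positivity)]
    exact h4
  -- With `k² / p = p^(1 - 2β)`, the first summand comes from the second moment in `D`, the second
  -- from `M` with its extra logarithm, and the last from the `+ 1` in `D`.
  · have hlim : Tendsto (fun t => 2 * Real.exp 1 * Real.exp (-(ε * Real.log (p t))) +
        8 * Real.exp 1 * (Real.log (p t) * Real.exp (-(ε * Real.log (p t)))) +
        Real.exp (-((2 * β - 1) * Real.log (p t)))) atTop (𝓝 0) := by
      have := (((tendsto_exp_neg_mul hℓ hε).const_mul (2 * Real.exp 1)).add
        ((tendsto_mul_exp_neg_mul hℓ hε).const_mul (8 * Real.exp 1))).add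
        (tendsto_exp_neg_mul hℓ (by linarith : 0 < 2 * β - 1))
      simpa using this
    refine squeeze_zero' ?_ ?_ hlim
    · filter_upwards [hℓ.eventually_ge_atTop 0] with t h1
      positivity
    · filter_upwards [hx0, hxle, hp.eventually_gt_atTop 0, hℓ.eventually_ge_atTop 0, hke]
        with t h1 h3 h4 h5 h6
      have hpe : (p t : ℝ) = Real.exp (Real.log (p t)) := by
        rw [Real.exp_log]; exact_mod_cast h4
      have hkk : k t ^ 2 / p t = Real.exp (-((2 * β - 1) * Real.log (p t))) := by
        nth_rw 1 [hpe]
        rw [h6, ← Real.exp_nat_mul, ← Real.exp_sub]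
        congr 1
        push_cast
        ring
      have hexp : Real.exp (-((2 * β - 1) * Real.log (p t))) *
          Real.exp (Real.log (p t) * diagExponent (x t)) ≤ Real.exp (-(ε * Real.log (p t))) := by
        rw [← Real.exp_add]
        refine Real.exp_le_exp.2 ?_
        nlinarith [(hgap _ h1 h3).2]
      rw [hkk]
      have h7 := mul_le_mul_of_nonneg_left hexp
        (by positivity : 0 ≤ 2 * Real.exp 1 + 8 * Real.exp 1 * Real.log (p t))
      linarith

/-- Here `k ≥ √p` eventually, so the squared column length `y` tends to zero, and so does `x`. No
delicate truncation is needed: the main diagonal term is a multiple of `k² y² / p`, that is, of `(r²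
n / √p)²`. -/
theorem tendsto_minimaxError_of_dense
    (hn : Tendsto n atTop atTop) (hp : Tendsto p atTop atTop)
    (hX : ∀ t, IsStandardDesign (PX t)) (hA : ∀ t, UncorrelatedDesign (PX t))
    (hB1 : FourthMomentBound PX)
    (hdev : Tendsto (fun t => (PX t).real (gramDeviates (n t) (p t)
      (1 / 2 * n t / Real.log (p t)))) atTop (𝓝 0))
    (hr : ∀ t, 0 < r t) (hk : Tendsto k atTop atTop)
    (hkp : Tendsto (fun t => k t / p t) atTop (𝓝 0))
    (hr4 : Tendsto (fun t => (r t ^ 2) ^ 2 * n t) atTop (𝓝 0))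
    (hr2 : Tendsto (fun t => r t ^ 2) atTop (𝓝 0))
    (hke : ∀ᶠ t in atTop, k t = Real.exp (Real.log (p t) * (1 - β)))
    (hβ0 : 0 < β) (hβ : β ≤ 1 / 2)
    (hL : (fun t => r t ^ 2) =o[atTop] fun t => √(p t : ℝ) / (n t : ℝ)) :
    Tendsto (fun t => minimaxError (PX t) (k t) (r t)) atTop (𝓝 1) := by
  have hℓ : Tendsto (fun t => Real.log (p t)) atTop atTop :=
    Real.tendsto_log_atTop.comp (tendsto_natCast_atTop_atTop.comp hp)
  have hρ : Tendsto (fun t => r t ^ 2 * n t / √(p t : ℝ)) atTop (𝓝 0) := by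
    refine hL.tendsto_div_nhds_zero.congr fun t => ?_
    rw [div_div_eq_mul_div]
  have hsk : ∀ᶠ t in atTop, √(p t : ℝ) ≤ k t := by
    filter_upwards [hke, hp.eventually_gt_atTop 0, hℓ.eventually_ge_atTop 0] with t h1 h2 h3
    have hpe : (p t : ℝ) = Real.exp (Real.log (p t)) := by
      rw [Real.exp_log]; exact_mod_cast h2
    refine Real.sqrt_le_iff.2 ⟨by rw [h1]; positivity, ?_⟩
    nth_rw 1 [hpe]
    rw [h1, ← Real.exp_nat_mul]
    refine Real.exp_le_exp.2 ?_
    push_cast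
    nlinarith
  set y : ℕ → ℝ := fun t => r t ^ 2 / ((1 - 2 * (1 / 4)) * k t) * n t with hy
  have hy0 : ∀ᶠ t in atTop, 0 < y t := by
    filter_upwards [hn.eventually_gt_atTop 0, hk.eventually_gt_atTop 0] with t h1 h2
    have : (0 : ℝ) < n t := by exact_mod_cast h1
    have := hr t
    simp only [hy]
    norm_num
    positivity
  have hylim : Tendsto y atTop (𝓝 0) := by
    have h0 : Tendsto (fun t => 2 * (r t ^ 2 * n t / √(p t : ℝ))) atTop (𝓝 0) := by
      simpa using hρ.const_mul 2
    refine squeeze_zero' (hy0.mono fun t h => h.le) ?_ h0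
    filter_upwards [hsk, hp.eventually_gt_atTop 0] with t h1 h2
    have : 0 < √(p t : ℝ) := Real.sqrt_pos.2 (by exact_mod_cast h2)
    have hk0 : 0 < k t := this.trans_le h1
    calc y t = 2 * (r t ^ 2 * n t / k t) := by simp only [hy]; field_simp; ring
      _ ≤ _ := by gcongr
  set x : ℕ → ℝ := fun t => √(y t / Real.log (p t)) with hxdef
  have hx0 : ∀ᶠ t in atTop, 0 < x t := by
    filter_upwards [hy0, hℓ.eventually_gt_atTop 0] with t h1 h2
    exact Real.sqrt_pos.2 (by positivity)
  have hxlim : Tendsto x atTop (𝓝 0) := by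
    have := (hylim.div_atTop hℓ).sqrt
    rwa [Real.sqrt_zero] at this
  have hx2 : ∀ᶠ t in atTop, x t ≤ √2 := hxlim.eventually_le_const (by positivity)
  have hxr : ∀ᶠ t in atTop, r t ^ 2 / ((1 - 2 * (1 / 4)) * k t) * n t =
      x t ^ 2 * Real.log (p t) := by
    filter_upwards [hy0, hℓ.eventually_gt_atTop 0] with t h1 h2
    simp only [hxdef]
    rw [Real.sq_sqrt (by positivity), div_mul_cancel₀ _ h2.ne']
  -- As `x → 0` the tail exponent tends to `1`, which exceeds `1 - β + β / 2`.
  have hE := tendsto_mul_tailRate (half_pos hβ0) hℓ hke (x := x) (by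
    have h1 : Tendsto (fun t => (√2 - x t) ^ 2 / 2) atTop (𝓝 ((√2 - 0) ^ 2 / 2)) :=
      ((hxlim.const_sub √2).pow 2).div_const 2
    rw [sub_zero, Real.sq_sqrt (by norm_num)] at h1
    exact h1.eventually_const_le (by linarith))
  refine tendsto_minimaxError (x := x) (δ := 1 / 4)
    (D := fun t => 4 * y t ^ 2 + 4 * Real.exp 1 * tailRate (x t) (Real.log (p t)))
    (M := fun t => 8 * y t ^ 2)
    hn hp hX hA hB1 hdev (by norm_num) (by norm_num) hr hk hkp hx0 hx2 hxr hE hr4 hr2 ?_ ?_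
  · filter_upwards [hx0, hx2, hxr, hn.eventually_gt_atTop 0, hℓ.eventually_ge_atTop 1,
      hk.eventually_gt_atTop 0, hylim.eventually_le_const (by norm_num : (0 : ℝ) < 1 / 2)]
      with t h1 h3 h4 h5 h6 h7 h8
    have hE0 : 0 < tailRate (x t) (Real.log (p t)) := Real.exp_pos _
    refine ⟨by positivity, fun X hXt j => ?_⟩
    have e : (r t / √((1 - 2 * (1 / 4)) * k t)) ^ 2 * n t = y t := by
      rw [div_pow, Real.sq_sqrt (mul_nonneg (by norm_num) h7.le)]
    have := integral_coshTrunc_sub_one_sq_scaledCols_le_of_small h5 h6 h1 h3 (e.trans h4) hXt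
      (e.trans_le h8) j
    rwa [e] at this
  -- With `δ = 1 / 4`, `y = 2 r² n / k`; the `12 y²` in `D + M` gives `48`, and the tail mean is
  -- split as `k / p` times `k` times the tail rate.
  · have hlim : Tendsto (fun t => 48 * (r t ^ 2 * n t / √(p t : ℝ)) ^ 2 +
        4 * Real.exp 1 * (k t / p t * (k t * tailRate (x t) (Real.log (p t))))) atTop (𝓝 0) := by
      have := ((hρ.pow 2).const_mul 48).add ((hkp.mul hE).const_mul (4 * Real.exp 1))
      simpa using this
    refine hlim.congr' ?_
    filter_upwards [hk.eventually_gt_atTop 0, hp.eventually_gt_atTop 0] with t h1 h2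
    have hp0 : (0 : ℝ) < p t := by exact_mod_cast h2
    rw [div_pow, Real.sq_sqrt hp0.le]
    simp only [hy]
    field_simp
    ring

end sequence
end SparseRegression

theorem theorem1
    (n p : ℕ → ℕ) (hn : Tendsto n atTop atTop) (hp : Tendsto p atTop atTop)
    (PX : ∀ t, Measure (SparseRegression.Design (n t) (p t)))
    [∀ t, IsProbabilityMeasure (PX t)]
    (hX : ∀ t, SparseRegression.IsStandardDesign (PX t))
    (hA1 : ∀ t, SparseRegression.UncorrelatedDesign (PX t))
    (hB1 : SparseRegression.FourthMomentBound PX)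
    (hB23 : SparseRegression.ExpMomentCondition PX ∨ SparseRegression.PolyMomentCondition PX)
    (β : ℝ) (hβ0 : 0 < β) (hβ1 : β < 1)
    (k : ℕ → ℝ) (hk : ∀ t, k t = (p t : ℝ) ^ (1 - β))
    (r : ℕ → ℝ) (hr : ∀ t, 0 < r t)
    (hL1 : (fun t => r t ^ 2) =o[atTop] fun t => (n t : ℝ) ^ (-(1 / 2) : ℝ))
    (hL2a : β ≤ 1 / 2 → (fun t => r t ^ 2) =o[atTop] fun t => √(p t : ℝ) / (n t : ℝ))
    (hL2b : 1 / 2 < β →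
      limsup (fun t =>
        ((r t / √(k t * Real.log (p t) / (n t : ℝ)) - SparseRegression.phi β : ℝ) : EReal))
        atTop < 0) :
    Tendsto (fun t => SparseRegression.minimaxError (PX t) (k t) (r t)) atTop (𝓝 1) := by
  have hpR : Tendsto (fun t => (p t : ℝ)) atTop atTop := tendsto_natCast_atTop_atTop.comp hp
  have hnR : Tendsto (fun t => (n t : ℝ)) atTop atTop := tendsto_natCast_atTop_atTop.comp hn
  have hk' : k = fun t => (p t : ℝ) ^ (1 - β) := funext hk
  have hkt : Tendsto k atTop atTop := by
    rw [hk']; exact (tendsto_rpow_atTop (by linarith)).comp hpR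
  have hke : ∀ᶠ t in atTop, k t = Real.exp (Real.log (p t) * (1 - β)) := by
    filter_upwards [hpR.eventually_gt_atTop 0] with t ht
    rw [hk, Real.rpow_def_of_pos ht]
  have hkp : Tendsto (fun t => k t / p t) atTop (𝓝 0) := by
    refine ((tendsto_rpow_neg_atTop hβ0).comp hpR).congr' ?_
    filter_upwards [hpR.eventually_gt_atTop 0] with t ht
    rw [hk, Function.comp_apply, div_eq_mul_inv, ← Real.rpow_neg_one, ← Real.rpow_add ht]
    congr 1
    ring
  have hr2 : Tendsto (fun t => r t ^ 2) atTop (𝓝 0) :=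
    hL1.trans_tendsto ((tendsto_rpow_neg_atTop (by norm_num : (0 : ℝ) < 1 / 2)).comp hnR)
  -- This is the only quantity that needs the full strength of `r² = o(n^(-1/2))`: it controls the
  -- Gram part.
  have hr4 : Tendsto (fun t => (r t ^ 2) ^ 2 * n t) atTop (𝓝 0) := by
    have h1 := hL1.tendsto_div_nhds_zero.pow 2
    rw [zero_pow two_ne_zero] at h1
    refine h1.congr' ?_
    filter_upwards [hnR.eventually_gt_atTop 0] with t ht
    rw [div_pow, ← Real.rpow_mul_natCast ht.le, div_eq_mul_inv, ← Real.rpow_neg ht.le]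
    norm_num
  have hdev : Tendsto (fun t => (PX t).real (SparseRegression.gramDeviates (n t) (p t)
      (1 / 2 * n t / Real.log (p t)))) atTop (𝓝 0) := by
    rcases hB23 with hB | hB
    · exact SparseRegression.tendsto_gramDeviates_of_expMoment hp hX hA1 hB (by norm_num)
    · exact SparseRegression.tendsto_gramDeviates_of_polyMoment hn hp hX hA1 hB1 hB (by norm_num)
  rcases le_or_gt β (1 / 2) with hβ | hβ
  · exact SparseRegression.tendsto_minimaxError_of_dense hn hp hX hA1 hB1 hdev hr hkt hkp hr4 hr2 hke hβ0 hβ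
      (hL2a hβ)
  · exact SparseRegression.tendsto_minimaxError_of_sparse hn hp hX hA1 hB1 hdev hr hkt hkp hr4 hr2 hke hβ hβ1
      (hL2b hβ)
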